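/- Let $N>2$ be an integer, $1<p\le 2$, $p'=p/(p-1)$, and let $\Omega\subset\mathbb R^N$ be a bounded, connected, open set with Lipschitz boundary, $\partial\Omega=\Gamma_n\cup\Gamma_d$ with $\Gamma_n\cap\Gamma_d=\emptyset$ and $\sigma(\Gamma_d)>0$, where $\sigma$ is the $(N-1)$-dimensional measure on $\partial\Omega$. Let $W^{1,p}_{\Gamma_d}(\Omega)$ be the space of all $w\in W^{1,p}(\Omega)$ with null trace on $\Gamma_d$, and let $T_k(s)=\max(-k,\min(s,k))$. Let $a:\Omega\times\mathbb R^N\to\mathbb R^N$, $\lambda:\Omega\times\mathbb R\to\mathbb R$ and $\Phi:\Omega\times\mathbb R\to\mathbb R^N$ be Carathéodory functions, $f\in L^1(\Omega)$, and let there be $\alpha>0$, $\beta\in\mathbb R$, $d\in L^{p'}(\Omega)$ and $b\in L^{N/(p-1)}(\Omega)$ such that for a.e. $x\in\Omega$, all $\xi,\xi'\in\mathbb R^N$ and all $r,r',s\in\mathbb R$: (i) $a(x,\xi)\cdot\xi\ge\alpha|\xi|^p$ and $|a(x,\xi)|\le\beta(|d(x)|+|\xi|^{p-1})$; (ii) $(a(x,\xi)-a(x,\xi'))\cdot(\xi-\xi')\ge\alpha\,|\xi-\xi'|^2/(|\xi|+|\xi'|)^{2-p}$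 (the right-hand side being read as $0$ if $\xi=\xi'=0$); in particular $a(x,\cdot)$ is monotone; (iii) $\lambda(x,s)s\ge0$, $(\lambda(x,r)-\lambda(x,r'))(r-r')\ge0$, and for each $k>0$ there is $c_k>0$ such that $|\lambda(x,s)|\le c_k$ for all $|s|\le k$ and a.e. $x\in\Omega$; (iv) $|\Phi(x,s)|\le|b(x)|(1+|s|)^{p-1}$; (v) $|\Phi(x,r)-\Phi(x,r')|\le L|r-r'|\,|b(x)|\,(|r|+|r'|+1)^{\gamma}$ with some constants $L>0$ and $\gamma<p-\tfrac32$. A measurable, a.e. finite function $u$ on $\Omega$ is called a renormalized solution of $$\lambda(x,u)-\operatorname{div}\big(a(x,Du)+\Phi(x,u)\big)=f\ \text{in }\Omega,\qquad \big(a(x,Du)+\Phi(x,u)\big)\cdot\mathbf n=0\ \text{on }\Gamma_n,\qquad u=0\ \text{on }\Gamma_d,$$ if $T_k(u)\in W^{1,p}_{\Gamma_d}(\Omega)$ for every $k>0$; if, with $Du$ the a.e. unique measurable field such that $DT_k(u)=\mathbf 1_{\{|u|<k\}}Du$ a.e. in $\Omega$ for every $k>0$, $$\lim_{n\to\infty}\frac1n\int_{\{|u|<n\}}a(x,Du)\cdot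 Du\,dx=0;$$ and if for every $h\in W^{1,\infty}(\mathbb R)$ with compact support and every $\varphi\in W^{1,p}_{\Gamma_d}(\Omega)\cap L^\infty(\Omega)$ $$\int_\Omega\lambda(x,u)\varphi h(u)\,dx+\int_\Omega h(u)\,\big(a(x,Du)+\Phi(x,u)\big)\cdot D\varphi\,dx+\int_\Omega\varphi h'(u)\,\big(a(x,Du)+\Phi(x,u)\big)\cdot Du\,dx=\int_\Omega f\varphi h(u)\,dx.$$ Then the renormalized solution is unique: any two renormalized solutions $u$, $v$ of this problem satisfy $u=v$ a.e. in $\Omega$. -/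

import Mathlib

open MeasureTheory Filter Topology
open scoped ENNReal NNReal ContDiff

noncomputable section

namespace NoncoerciveElliptic

/-- `ℝ^N` with its Euclidean norm. -/
abbrev Space (N : ℕ) : Type := EuclideanSpace ℝ (Fin N)

/-- The boundary of `Ω` is Lipschitz: near each boundary point, in suitable orthonormal
coordinates, `Ω` is the strict epigraph of a Lipschitz function. The unit vector `e` gives the
vertical direction, `inner ℝ e x` is the vertical coordinate of `x`, and `x - (inner ℝ e x) • e`
is the orthogonal projection of `x` to the hyperplane orthogonal to `e`, so only the values of `ψ`
on this hyperplane matter. -/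
def HasLipschitzBoundary {N : ℕ} (Ω : Set (Space N)) : Prop :=
  ∀ x₀ ∈ frontier Ω, ∃ (r : ℝ) (e : Space N) (K : ℝ≥0) (ψ : Space N → ℝ),
    0 < r ∧ ‖e‖ = 1 ∧ LipschitzWith K ψ ∧
    Ω ∩ Metric.ball x₀ r =
      {x ∈ Metric.ball x₀ r | ψ (x - (inner ℝ e x) • e) < inner ℝ e x}

/-- The `(N-1)`-dimensional (Hausdorff) measure on `∂Ω`. -/
def surfaceMeasure {N : ℕ} (Ω : Set (Space N)) : Measure (Space N) :=
  (Measure.hausdorffMeasure ((N : ℝ) - 1)).restrict (frontier Ω)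

/-- The geometric setting: a bounded, connected, open set with Lipschitz boundary, split into a
Neumann part `Γn` and a Dirichlet part `Γd` of positive surface measure. -/
structure IsAdmissibleDomain {N : ℕ} (Ω Γn Γd : Set (Space N)) : Prop where
  isOpen : IsOpen Ω
  isConnected : IsConnected Ω
  isBounded : Bornology.IsBounded Ω
  lipschitz_boundary : HasLipschitzBoundary Ω
  union_eq : Γn ∪ Γd = frontier Ω
  disjoint : Disjoint Γn Γd
  nullMeasurable_dirichlet : NullMeasurableSet Γd (surfaceMeasure Ω)
  dirichlet_pos : 0 < surfaceMeasure Ω Γd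

/-- `G` is the weak gradient of `w` in `Ω`. -/
def HasWeakGradient {N : ℕ} (Ω : Set (Space N)) (w : Space N → ℝ) (G : Space N → Space N) :
    Prop :=
  LocallyIntegrableOn w Ω ∧ LocallyIntegrableOn G Ω ∧
  ∀ ψ : Space N → ℝ, ContDiff ℝ ∞ ψ → HasCompactSupport ψ → tsupport ψ ⊆ Ω →
    ∫ x in Ω, w x • gradient ψ x = - ∫ x in Ω, ψ x • G x

/-- `w ∈ W^{1,q}(Ω)`. -/
def MemSobolev {N : ℕ} (Ω : Set (Space N)) (q : ℝ≥0∞) (w : Space N → ℝ) : Prop :=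
  MemLp w q (volume.restrict Ω) ∧
  ∃ G : Space N → Space N, HasWeakGradient Ω w G ∧ MemLp G q (volume.restrict Ω)

/-- `g ∈ L^q(∂Ω)` is the trace of `w ∈ W^{1,q}(Ω)`: the trace operator is the continuous
extension of the restriction `φ ↦ φ|∂Ω`, so `g` is the limit in `L^q(∂Ω)` of the restrictions of
some `C¹` functions `φ k` that converge to `w` in `W^{1,q}(Ω)`. -/
def HasTrace {N : ℕ} (Ω : Set (Space N)) (q : ℝ≥0∞) (w g : Space N → ℝ) : Prop :=
  MemLp g q (surfaceMeasure Ω) ∧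
  ∃ (G : Space N → Space N) (φ : ℕ → Space N → ℝ),
    HasWeakGradient Ω w G ∧ (∀ k, ContDiff ℝ 1 (φ k)) ∧
    Tendsto (fun k => eLpNorm (fun x => φ k x - w x) q (volume.restrict Ω)) atTop (𝓝 0) ∧
    Tendsto (fun k => eLpNorm (fun x => gradient (φ k) x - G x) q (volume.restrict Ω))
      atTop (𝓝 0) ∧
    Tendsto (fun k => eLpNorm (fun x => φ k x - g x) q (surfaceMeasure Ω)) atTop (𝓝 0)

/-- `w ∈ W^{1,q}_{Γd}(Ω)`: `w ∈ W^{1,q}(Ω)` has null trace on `Γd`. -/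
def MemSobolevNullTrace {N : ℕ} (Ω Γd : Set (Space N)) (q : ℝ≥0∞) (w : Space N → ℝ) : Prop :=
  MemSobolev Ω q w ∧
  ∃ g : Space N → ℝ, HasTrace Ω q w g ∧ ∀ᵐ x ∂(surfaceMeasure Ω), x ∈ Γd → g x = 0

/-- The truncation at height `±k`. -/
def trunc (k s : ℝ) : ℝ := max (-k) (min s k)

/-- `F : Ω × X → Y` is a Carathéodory function. -/
def IsCaratheodory {N : ℕ} {X Y : Type*} [TopologicalSpace X] [TopologicalSpace Y]
    [MeasurableSpace Y] (Ω : Set (Space N)) (F : Space N → X → Y) : Prop :=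
  (∀ ξ, AEMeasurable (fun x => F x ξ) (volume.restrict Ω)) ∧
  ∀ᵐ x ∂(volume.restrict Ω), Continuous (F x)

/-- The structural assumptions on the data `a`, `lam`, `Φ`, `f`, for `p < N`, with the coercivity
constant `α`, the growth constant `β` and the functions `d`, `b` of the growth conditions. -/
structure StructuralAssumptions {N : ℕ} (Ω : Set (Space N)) (p α β : ℝ)
    (a : Space N → Space N → Space N) (lam : Space N → ℝ → ℝ) (Φ : Space N → ℝ → Space N)
    (d b f : Space N → ℝ) : Prop where
  caratheodory_a : IsCaratheodory Ω a
  caratheodory_lam : IsCaratheodory Ω lam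
  caratheodory_Φ : IsCaratheodory Ω Φ
  α_pos : 0 < α
  coercive : ∀ᵐ x ∂(volume.restrict Ω), ∀ ξ, α * ‖ξ‖ ^ p ≤ inner ℝ (a x ξ) ξ
  monotone : ∀ᵐ x ∂(volume.restrict Ω), ∀ ξ ξ', 0 ≤ inner ℝ (a x ξ - a x ξ') (ξ - ξ')
  d_mem : MemLp d (ENNReal.ofReal (p / (p - 1))) (volume.restrict Ω)
  growth_a : ∀ᵐ x ∂(volume.restrict Ω), ∀ ξ, ‖a x ξ‖ ≤ β * (|d x| + ‖ξ‖ ^ (p - 1))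
  sign_lam : ∀ᵐ x ∂(volume.restrict Ω), ∀ s, 0 ≤ lam x s * s
  bound_lam : ∀ k > 0, ∃ c > 0, ∀ᵐ x ∂(volume.restrict Ω), ∀ s, |s| ≤ k → |lam x s| ≤ c
  growth_Φ : ∀ᵐ x ∂(volume.restrict Ω), ∀ s, ‖Φ x s‖ ≤ |b x| * (1 + |s|) ^ (p - 1)
  b_mem : MemLp b (ENNReal.ofReal ((N : ℝ) / (p - 1))) (volume.restrict Ω)
  f_mem : MemLp f 1 (volume.restrict Ω)

/-- `v` is the (generalized) gradient of `u`: `D T_k(u) = 1_{|u| < k} v` a.e. for all `k > 0`. -/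
def IsGeneralizedGradient {N : ℕ} (Ω : Set (Space N)) (u : Space N → ℝ)
    (v : Space N → Space N) : Prop :=
  AEMeasurable v (volume.restrict Ω) ∧
  ∀ k > 0, HasWeakGradient Ω (fun x => trunc k (u x)) ({x | |u x| < k}.indicator v)

/-- `u` is a renormalized solution of
`lam(x,u) - div (a(x,Du) + Φ(x,u)) = f` in `Ω`, `(a(x,Du) + Φ(x,u)) · n = 0` on `∂Ω \ Γd`,
`u = 0` on `Γd`. The functions `h ∈ W^{1,∞}(ℝ)` with compact support are the compactly supported
Lipschitz functions. -/
def IsRenormalizedSolution {N : ℕ} (Ω Γd : Set (Space N)) (p : ℝ)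
    (a : Space N → Space N → Space N) (lam : Space N → ℝ → ℝ) (Φ : Space N → ℝ → Space N)
    (f : Space N → ℝ) (u : Space N → ℝ) : Prop :=
  AEMeasurable u (volume.restrict Ω) ∧
  (∀ k > 0, MemSobolevNullTrace Ω Γd (ENNReal.ofReal p) (fun x => trunc k (u x))) ∧
  ∃ Du : Space N → Space N, IsGeneralizedGradient Ω u Du ∧
    Tendsto (fun n : ℕ =>
      (1 / (n : ℝ)) * ∫ x in Ω ∩ {x | |u x| < (n : ℝ)}, inner ℝ (a x (Du x)) (Du x))
      atTop (𝓝 0) ∧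
    ∀ (h : ℝ → ℝ) (φ : Space N → ℝ) (Dφ : Space N → Space N),
      (∃ K : ℝ≥0, LipschitzWith K h) → HasCompactSupport h →
      MemSobolevNullTrace Ω Γd (ENNReal.ofReal p) φ → MemLp φ ∞ (volume.restrict Ω) →
      HasWeakGradient Ω φ Dφ →
      (∫ x in Ω, lam x (u x) * φ x * h (u x))
        + (∫ x in Ω, h (u x) * inner ℝ (a x (Du x)) (Dφ x))
        + (∫ x in Ω, h (u x) * inner ℝ (Φ x (u x)) (Dφ x))
        + (∫ x in Ω, φ x * deriv h (u x) * inner ℝ (a x (Du x)) (Du x))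
        + (∫ x in Ω, φ x * deriv h (u x) * inner ℝ (Φ x (u x)) (Du x))
      = ∫ x in Ω, f x * φ x * h (u x)

end NoncoerciveElliptic

end

/-! Let ζ be `cutoff` and S be `smoothSign`: bounded, nondecreasing, S(0) = 0, constant off [-1, 1].
The equations of u and v, renormalized by ζ(u/n) and ζ(v/n), are tested with the same function S((u
- v)/k), in which u and v may be truncated at height 2n + 1, and subtracted. The zero order terms
have a good sign. Assumption (ii) produces Q = |Du - Dv|²/(|Du| + |Dv|)^(2-p) with the factor S'((u
- v)/k)/k. Young's inequality absorbs the difference of the convection terms into half of this, at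
the cost of (u - v)² W with W = |b|² (|u| + |v| + 1)^(2γ) (|Du| + |Dv|)^(2-p). As n → ∞ this leaves,
for every m, ∫ ζ(u/m) (S'/k) Q ≤ (L²/α²) k ∫ S' ((u - v)/k)² W (`energy_estimate`). On {|u - v| < 1}
the weight W is integrable, and for each x the last integrand vanishes once k is small; so the right
side is o(k) (`tendsto_convectionWeight`).

Young's inequality again, |Du - Dv| ≤ Q/(εk) + εk (|Du| + |Dv|)^(2-p), turns this into ∫ ζ(u/m)
(S'/k) |Du - Dv| → 0 as k → 0 with m fixed. Hence, along a suitable choice of k → 0 as m → ∞, the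
functions ζ(u/m) S((u - v)/k) have null trace on Γd and gradients tending to 0 in L¹, and they
converge in L¹ to a function of u - v that vanishes only where u = v. A limit with zero gradient is
constant on the connected set Ω, and the trace inequality together with σ(Γd) > 0 makes the constant
0 (`ae_eq_zero_of_tendsto_sobolevTriple`).

The analytic input is the integrability of W (`integrable_weight`) and the vanishing, as n → ∞, of
the convection fluxes near the levels between n and 2n (`tendsto_convection`). Both combine
∫_{|u|<n} |Du|^p = O(n), improved to o(n) for the fluxes, with |{|u| ≥ t}| = O(t^(-q)), q =
N(p-1)/(N-p) (`exists_level_decay`), and |b|^(N/(p-1)) ∈ L¹, through a weighted three-term mean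
inequality. The decay comes from the W^{1,1} Sobolev inequality for 1 - ζ(u/m), which gives a
recursion between the levels m and 2m. The condition γ < p - 3/2 says that δ = 2p - 3 - 2γ > 0,
which is the rate of the geometric series obtained by summing over dyadic levels of 1 + |u|.

Functions, gradients and traces are handled together as a `SobolevTriple`, a joint limit of C¹
functions. This class is stable under C¹ composition, which is why S is a smooth substitute for a
truncation, and inequalities proved for C¹ functions pass to it by approximation. -/

namespace NoncoerciveElliptic

/-! ### Gradients of differentiable functions -/

section Gradient

variable {N : ℕ}

theorem continuous_gradient {φ : Space N → ℝ} (hφ : ContDiff ℝ 1 φ) :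
    Continuous (gradient φ) :=
  (InnerProductSpace.toDual ℝ (Space N)).symm.continuous.comp (hφ.continuous_fderiv one_ne_zero)

theorem norm_gradient (φ : Space N → ℝ) (x : Space N) : ‖gradient φ x‖ = ‖fderiv ℝ φ x‖ := by
  simp [gradient]

theorem inner_gradient (φ : Space N → ℝ) (x e : Space N) :
    inner ℝ (gradient φ x) e = fderiv ℝ φ x e := by
  simp [gradient]

theorem gradient_comp_prodMk {F : ℝ × ℝ → ℝ} {φ χ : Space N → ℝ} {x : Space N}
    (hF : DifferentiableAt ℝ F (φ x, χ x)) (hφ : DifferentiableAt ℝ φ x)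
    (hχ : DifferentiableAt ℝ χ x) :
    gradient (fun y => F (φ y, χ y)) x =
      fderiv ℝ F (φ x, χ x) (1, 0) • gradient φ x
        + fderiv ℝ F (φ x, χ x) (0, 1) • gradient χ x := by
  refine ext_inner_right ℝ fun e => ?_
  have h := (hF.hasFDerivAt.comp x (hφ.hasFDerivAt.prodMk hχ.hasFDerivAt)).fderiv
  rw [inner_add_left, real_inner_smul_left, real_inner_smul_left, inner_gradient, inner_gradient,
    inner_gradient]
  have h2 : fderiv ℝ (fun y => F (φ y, χ y)) x e
      = fderiv ℝ F (φ x, χ x) (fderiv ℝ φ x e, fderiv ℝ χ x e) := by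
    have := congrArg (fun L => L e) h
    simpa [Function.comp_def] using this
  rw [h2]
  have h3 : ((fderiv ℝ φ x e, fderiv ℝ χ x e) : ℝ × ℝ)
      = fderiv ℝ φ x e • (1, 0) + fderiv ℝ χ x e • (0, 1) := by simp
  rw [h3, map_add, map_smul, map_smul]
  simp [mul_comm]

end Gradient

/-! ### Convergence to zero in `L^q` -/

section Convergence

variable {X E : Type*} [MeasurableSpace X] {μ : Measure X} [NormedAddCommGroup E]

/-- Dominated convergence to zero in `L^q`. -/
theorem tendsto_eLpNorm_zero_of_dominated {q : ℝ≥0∞} (hq0 : q ≠ 0) (hq : q ≠ ⊤)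
    {F : ℕ → X → E} {g : X → ℝ} (hF : ∀ n, AEStronglyMeasurable (F n) μ) (hg : MemLp g q μ)
    (hb : ∀ n, ∀ᵐ x ∂μ, ‖F n x‖ ≤ g x)
    (hlim : ∀ᵐ x ∂μ, Tendsto (fun n => F n x) atTop (𝓝 0)) :
    Tendsto (fun n => eLpNorm (F n) q μ) atTop (𝓝 0) := by
  have hpos : 0 < q.toReal := ENNReal.toReal_pos hq0 hq
  simp_rw [eLpNorm_eq_lintegral_rpow_enorm_toReal hq0 hq]
  have key : Tendsto (fun n => ∫⁻ x, ‖F n x‖ₑ ^ q.toReal ∂μ) atTop (𝓝 (∫⁻ _, 0 ∂μ)) := by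
    refine tendsto_lintegral_of_dominated_convergence' (fun x => ‖g x‖ₑ ^ q.toReal)
      (fun n => (hF n).enorm.pow_const _) (fun n => ?_) ?_ ?_
    · filter_upwards [hb n] with x hx
      gcongr
      exact enorm_le_iff_norm_le.2 (hx.trans (le_abs_self _))
    · exact (lintegral_rpow_enorm_lt_top_of_eLpNorm_lt_top hq0 hq hg.2).ne
    · filter_upwards [hlim] with x hx
      have := ((ENNReal.continuous_rpow_const (y := q.toReal)).tendsto _).comp hx.enorm
      simpa [Function.comp_def, hpos] using this
  simp only [lintegral_zero] at key
  have := ((ENNReal.continuous_rpow_const (y := 1 / q.toReal)).tendsto _).comp key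
  simpa [Function.comp_def, hpos] using this

theorem tendsto_eLpNorm_one_of_tendsto [IsFiniteMeasure μ] {q : ℝ≥0∞} (hq : 1 ≤ q)
    {F : ℕ → X → E} (hF : ∀ n, AEStronglyMeasurable (F n) μ)
    (h : Tendsto (fun n => eLpNorm (F n) q μ) atTop (𝓝 0)) :
    Tendsto (fun n => eLpNorm (F n) 1 μ) atTop (𝓝 0) := by
  have hC : μ Set.univ ^ (1 / (1 : ℝ≥0∞).toReal - 1 / q.toReal) ≠ ⊤ := by
    refine ENNReal.rpow_ne_top_of_nonneg ?_ (measure_ne_top _ _)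
    rcases eq_or_ne q ⊤ with rfl | hq'
    · simp
    · have : 1 ≤ q.toReal := by
        simpa using (ENNReal.toReal_le_toReal ENNReal.one_ne_top hq').2 hq
      simpa using inv_le_one_of_one_le₀ this
  have h0 := ENNReal.Tendsto.mul_const h (Or.inr hC)
  rw [zero_mul] at h0
  exact tendsto_of_tendsto_of_tendsto_of_le_of_le tendsto_const_nhds h0 (fun _ => zero_le)
    (fun n => eLpNorm_le_eLpNorm_mul_rpow_measure_univ hq (hF n))

theorem tendsto_eLpNorm_zero_of_le_add {E' E'' : Type*} [NormedAddCommGroup E']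
    [NormedAddCommGroup E''] {q : ℝ≥0∞} (hq : 1 ≤ q) {F : ℕ → X → E} {A : ℕ → X → E'}
    {B : ℕ → X → E''} (C : ℝ) (hA : ∀ n, AEStronglyMeasurable (A n) μ)
    (hB : ∀ n, AEStronglyMeasurable (B n) μ)
    (h : ∀ n, ∀ᵐ x ∂μ, ‖F n x‖ ≤ C * (‖A n x‖ + ‖B n x‖))
    (hA0 : Tendsto (fun n => eLpNorm (A n) q μ) atTop (𝓝 0))
    (hB0 : Tendsto (fun n => eLpNorm (B n) q μ) atTop (𝓝 0)) :
    Tendsto (fun n => eLpNorm (F n) q μ) atTop (𝓝 0) := by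
  have h1 : ∀ n, eLpNorm (F n) q μ
      ≤ ENNReal.ofReal C * (eLpNorm (A n) q μ + eLpNorm (B n) q μ) := fun n => by
    refine (eLpNorm_le_mul_eLpNorm_of_ae_le_mul (g := fun x => ‖A n x‖ + ‖B n x‖) (c := C)
      ?_ q).trans ?_
    · filter_upwards [h n] with x hx
      rwa [Real.norm_of_nonneg (by positivity)]
    · gcongr
      refine (eLpNorm_add_le (hA n).norm (hB n).norm hq).trans_eq ?_
      rw [eLpNorm_norm, eLpNorm_norm]
  have h2 := ENNReal.Tendsto.const_mul (a := ENNReal.ofReal C) (hA0.add hB0)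
    (Or.inr ENNReal.ofReal_ne_top)
  simp only [add_zero, mul_zero] at h2
  exact tendsto_of_tendsto_of_tendsto_of_le_of_le tendsto_const_nhds h2 (fun _ => zero_le) h1

theorem tendsto_eLpNorm_zero_of_le_mul {E' : Type*} [NormedAddCommGroup E'] {q : ℝ≥0∞}
    {F : ℕ → X → E} {A : ℕ → X → E'} (C : ℝ)
    (h : ∀ n, ∀ᵐ x ∂μ, ‖F n x‖ ≤ C * ‖A n x‖)
    (hA0 : Tendsto (fun n => eLpNorm (A n) q μ) atTop (𝓝 0)) :
    Tendsto (fun n => eLpNorm (F n) q μ) atTop (𝓝 0) := by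
  have h2 := ENNReal.Tendsto.const_mul (a := ENNReal.ofReal C) hA0 (Or.inr ENNReal.ofReal_ne_top)
  simp only [mul_zero] at h2
  exact tendsto_of_tendsto_of_tendsto_of_le_of_le tendsto_const_nhds h2 (fun _ => zero_le)
    (fun n => eLpNorm_le_mul_eLpNorm_of_ae_le_mul (h n) q)

end Convergence

/-! ### Weak gradients of C¹ functions and uniqueness -/

section WeakGradient

variable {N : ℕ} {Ω : Set (Space N)}

theorem integrable_restrict_of_continuous {E : Type*} [NormedAddCommGroup E]
    (hb : Bornology.IsBounded Ω) {g : Space N → E} (hg : Continuous g) :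
    Integrable g (volume.restrict Ω) := by
  have : IntegrableOn g (closure Ω) volume :=
    hg.continuousOn.integrableOn_compact hb.isCompact_closure
  exact this.mono_set subset_closure

/-- Since ψ and its gradient vanish off Ω, both integrals may be taken over the whole space, where
integration by parts in each direction has no boundary term; nothing is asked of Ω. -/
theorem hasWeakGradient_of_contDiff {φ : Space N → ℝ} (hφ : ContDiff ℝ 1 φ) :
    HasWeakGradient Ω φ (gradient φ) := by
  refine ⟨hφ.continuous.locallyIntegrable.locallyIntegrableOn Ω,
    (continuous_gradient hφ).locallyIntegrable.locallyIntegrableOn Ω, fun ψ hψ hcs hsub => ?_⟩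
  have hψ1 : ContDiff ℝ 1 ψ := hψ.of_le (by exact_mod_cast le_top)
  have hz : ∀ x ∉ Ω, ψ x = 0 := fun x hx => image_eq_zero_of_notMem_tsupport fun h => hx (hsub h)
  have hz' : ∀ x ∉ Ω, gradient ψ x = 0 := by
    intro x hx
    have : x ∉ tsupport (fderiv ℝ ψ) := fun h => hx (hsub (tsupport_fderiv_subset ℝ h))
    simp [gradient, image_eq_zero_of_notMem_tsupport this]
  rw [setIntegral_eq_integral_of_forall_compl_eq_zero (fun x hx => by rw [hz' x hx, smul_zero]),
    setIntegral_eq_integral_of_forall_compl_eq_zero (fun x hx => by rw [hz x hx, zero_smul])]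
  have i1 : Integrable (fun x => φ x • gradient ψ x) := by
    refine (hφ.continuous.smul (continuous_gradient hψ1)).integrable_of_hasCompactSupport ?_
    have : HasCompactSupport (gradient ψ) := (hcs.fderiv ℝ).comp_left (map_zero _)
    exact this.smul_left
  have i2 : Integrable (fun x => ψ x • gradient φ x) :=
    (hψ.continuous.smul (continuous_gradient hφ)).integrable_of_hasCompactSupport hcs.smul_right
  refine ext_inner_left ℝ fun e => ?_
  rw [inner_neg_right, ← integral_inner i1, ← integral_inner i2]
  simp_rw [real_inner_smul_right, fun (χ : Space N → ℝ) x =>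
    (real_inner_comm (gradient χ x) e).trans (inner_gradient χ x e)]
  have c1 : Continuous fun x => fderiv ℝ φ x e := (hφ.continuous_fderiv one_ne_zero).clm_apply
    continuous_const
  have c2 : Continuous fun x => fderiv ℝ ψ x e := (hψ1.continuous_fderiv one_ne_zero).clm_apply
    continuous_const
  have hcs' : HasCompactSupport fun x => fderiv ℝ ψ x e := by
    exact (hcs.fderiv ℝ).comp_left (g := fun L : Space N →L[ℝ] ℝ => L e) (by simp)
  have := integral_mul_fderiv_eq_neg_fderiv_mul_of_integrable (μ := volume) (f := φ) (g := ψ)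
    (v := e) ((c1.mul hψ.continuous).integrable_of_hasCompactSupport hcs.mul_left)
    ((hφ.continuous.mul c2).integrable_of_hasCompactSupport hcs'.mul_left)
    ((hφ.continuous.mul hψ.continuous).integrable_of_hasCompactSupport hcs.mul_left)
    (fun x _ => hφ.differentiable one_ne_zero x) (fun x _ => hψ1.differentiable one_ne_zero x)
  rw [this]
  congr 1
  exact integral_congr_ae (.of_forall fun x => mul_comm _ _)

/-- The fundamental lemma of the calculus of variations. It allows the gradients hidden in the
existential definitions of Sobolev membership and of trace to be identified with a prescribed one.
-/
theorem HasWeakGradient.ae_eq (hΩ : IsOpen Ω) {w : Space N → ℝ} {G G' : Space N → Space N}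
    (h : HasWeakGradient Ω w G) (h' : HasWeakGradient Ω w G') :
    G =ᵐ[volume.restrict Ω] G' := by
  have hl : LocallyIntegrableOn (fun x => G x - G' x) Ω := h.2.1.sub h'.2.1
  have := hΩ.ae_eq_zero_of_integral_contDiff_smul_eq_zero hl fun ψ hψ hcs hsub => by
    have hz : ∀ x ∉ Ω, ψ x = 0 :=
      fun x hx => image_eq_zero_of_notMem_tsupport fun h => hx (hsub h)
    have e1 := h.2.2 ψ hψ hcs hsub
    rw [h'.2.2 ψ hψ hcs hsub, neg_inj] at e1
    have hInt : ∀ K : Space N → Space N, LocallyIntegrableOn K Ω →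
        IntegrableOn (fun x => ψ x • K x) Ω := by
      intro K hK
      have i1 : IntegrableOn (fun x => ψ x • K x) (tsupport ψ) :=
        (hK.integrableOn_compact_subset hsub hcs).continuousOn_smul hψ.continuous.continuousOn hcs
      refine (integrableOn_iff_integrable_of_support_subset ?_).1 i1 |>.integrableOn
      exact (Function.support_smul_subset_left _ _).trans (subset_tsupport ψ)
    rw [← setIntegral_eq_integral_of_forall_compl_eq_zero (s := Ω)
      (fun x hx => by rw [hz x hx, zero_smul])]
    simp_rw [smul_sub]
    rw [integral_sub (hInt _ h.2.1) (hInt _ h'.2.1), e1, sub_self]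
  rw [EventuallyEq, ae_restrict_iff' hΩ.measurableSet]
  filter_upwards [this] with x hx hxΩ using sub_eq_zero.1 (hx hxΩ)

end WeakGradient

/-- `(w, G, g)` is a limit in `L^q(Ω) × L^q(Ω) × L^q(∂Ω)` of triples `(φ, ∇φ, φ|∂Ω)` with
`φ` of class `C¹`. -/
structure SobolevTriple {N : ℕ} (Ω : Set (Space N)) (q : ℝ≥0∞) (w : Space N → ℝ)
    (G : Space N → Space N) (g : Space N → ℝ) : Prop where
  memLp : MemLp w q (volume.restrict Ω)
  memLp_grad : MemLp G q (volume.restrict Ω)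
  memLp_trace : MemLp g q (surfaceMeasure Ω)
  approx : ∃ φ : ℕ → Space N → ℝ, (∀ k, ContDiff ℝ 1 (φ k)) ∧
    Tendsto (fun k => eLpNorm (fun x => φ k x - w x) q (volume.restrict Ω)) atTop (𝓝 0) ∧
    Tendsto (fun k => eLpNorm (fun x => gradient (φ k) x - G x) q (volume.restrict Ω))
      atTop (𝓝 0) ∧
    Tendsto (fun k => eLpNorm (fun x => φ k x - g x) q (surfaceMeasure Ω)) atTop (𝓝 0)

/-! ### Sobolev functions with gradient and trace as joint limits of C¹ functions -/

section Triple

variable {N : ℕ} {Ω : Set (Space N)} {q : ℝ≥0∞}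

theorem isFiniteMeasure_restrict (hb : Bornology.IsBounded Ω) :
    IsFiniteMeasure (volume.restrict Ω) :=
  ⟨by simpa using hb.measure_lt_top⟩

/-- The integration by parts formula of the approximants passes to the limit: ψ and its gradient are
bounded, so convergence in L¹(Ω) is enough, and this follows from L^q because Ω has finite measure.
-/
theorem SobolevTriple.hasWeakGradient (hb : Bornology.IsBounded Ω) (hq : 1 ≤ q)
    {w : Space N → ℝ} {G : Space N → Space N} {g : Space N → ℝ} (h : SobolevTriple Ω q w G g) :
    HasWeakGradient Ω w G := by
  have := isFiniteMeasure_restrict hb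
  obtain ⟨φ, hφ, h1, h2, -⟩ := h.approx
  have hw := h.memLp.integrable hq
  have hG := h.memLp_grad.integrable hq
  have m1 : ∀ k, AEStronglyMeasurable (fun x => φ k x - w x) (volume.restrict Ω) := fun k =>
    (hφ k).continuous.aestronglyMeasurable.sub h.memLp.1
  have m2 : ∀ k, AEStronglyMeasurable (fun x => gradient (φ k) x - G x) (volume.restrict Ω) :=
    fun k => (continuous_gradient (hφ k)).aestronglyMeasurable.sub h.memLp_grad.1
  refine ⟨IntegrableOn.locallyIntegrableOn hw, IntegrableOn.locallyIntegrableOn hG,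
    fun ψ hψ hcs hsub => ?_⟩
  have hψ1 : ContDiff ℝ 1 ψ := hψ.of_le (by exact_mod_cast le_top)
  have hcs' : HasCompactSupport (gradient ψ) := (hcs.fderiv ℝ).comp_left (map_zero _)
  obtain ⟨C, hC⟩ := hcs.exists_bound_of_continuous hψ.continuous
  obtain ⟨C', hC'⟩ := hcs'.exists_bound_of_continuous (continuous_gradient hψ1)
  have t1 : Tendsto (fun k => ∫ x in Ω, φ k x • gradient ψ x) atTop
      (𝓝 (∫ x in Ω, w x • gradient ψ x)) := by
    refine tendsto_integral_of_L1' _ (hw.smul_bdd C'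
      (continuous_gradient hψ1).aestronglyMeasurable (.of_forall hC')).1 (.of_forall fun k =>
      integrable_restrict_of_continuous hb ((hφ k).continuous.smul (continuous_gradient hψ1))) ?_
    refine tendsto_eLpNorm_zero_of_le_mul C' (fun k => .of_forall fun x => ?_)
      (tendsto_eLpNorm_one_of_tendsto hq m1 h1)
    simp only [Pi.sub_apply, Pi.smul_apply']
    rw [← sub_smul, norm_smul, mul_comm]
    gcongr
    exact hC' x
  have t2 : Tendsto (fun k => ∫ x in Ω, ψ x • gradient (φ k) x) atTop
      (𝓝 (∫ x in Ω, ψ x • G x)) := by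
    refine tendsto_integral_of_L1' _ (hG.bdd_smul C
      hψ.continuous.aestronglyMeasurable (.of_forall hC)).1 (.of_forall fun k =>
      integrable_restrict_of_continuous hb (hψ.continuous.smul (continuous_gradient (hφ k)))) ?_
    refine tendsto_eLpNorm_zero_of_le_mul C (fun k => .of_forall fun x => ?_)
      (tendsto_eLpNorm_one_of_tendsto hq m2 h2)
    simp only [Pi.sub_apply, Pi.smul_apply']
    rw [← smul_sub, norm_smul]
    gcongr
    exact hC x
  refine tendsto_nhds_unique t1 (t2.neg.congr fun k => ?_)
  exact ((hasWeakGradient_of_contDiff (hφ k)).2.2 ψ hψ hcs hsub).symm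

theorem SobolevTriple.memSobolevNullTrace (hb : Bornology.IsBounded Ω) (hq : 1 ≤ q)
    {Γd : Set (Space N)} {w : Space N → ℝ} {G : Space N → Space N} {g : Space N → ℝ}
    (h : SobolevTriple Ω q w G g) (hg : ∀ᵐ x ∂(surfaceMeasure Ω), x ∈ Γd → g x = 0) :
    MemSobolevNullTrace Ω Γd q w := by
  have hG := h.hasWeakGradient hb hq
  obtain ⟨φ, hφ⟩ := h.approx
  exact ⟨⟨h.memLp, G, hG, h.memLp_grad⟩, g, ⟨h.memLp_trace, G, φ, hG, hφ⟩, hg⟩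

/-- Membership and trace each come with their own gradient; uniqueness merges both with the given
`G`. -/
theorem MemSobolevNullTrace.exists_triple (hΩ : IsOpen Ω) {Γd : Set (Space N)} {w : Space N → ℝ}
    {G : Space N → Space N} (h : MemSobolevNullTrace Ω Γd q w) (hG : HasWeakGradient Ω w G) :
    ∃ g, SobolevTriple Ω q w G g ∧ ∀ᵐ x ∂(surfaceMeasure Ω), x ∈ Γd → g x = 0 := by
  obtain ⟨⟨hw, G₁, hG₁, hm⟩, g, ⟨hgm, G₂, φ, hG₂, hφ, h1, h2, h3⟩, hg⟩ := h
  have e1 := hG₁.ae_eq hΩ hG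
  have e2 := hG₂.ae_eq hΩ hG
  refine ⟨g, ⟨hw, hm.ae_eq e1, hgm, φ, hφ, h1, h2.congr fun k => ?_, h3⟩, hg⟩
  refine eLpNorm_congr_ae ?_
  filter_upwards [e2] with x hx
  rw [hx]

/-- The chain rule for `F(w₁, w₂)` with `F` of class `C¹` with bounded derivative. -/
theorem SobolevTriple.comp_prodMk (hq : 1 ≤ q) (hq' : q ≠ ⊤)
    {w₁ w₂ : Space N → ℝ} {G₁ G₂ : Space N → Space N} {g₁ g₂ : Space N → ℝ}
    (h₁ : SobolevTriple Ω q w₁ G₁ g₁) (h₂ : SobolevTriple Ω q w₂ G₂ g₂)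
    {F : ℝ × ℝ → ℝ} (hF : ContDiff ℝ 1 F) (hF0 : F 0 = 0) {C : ℝ}
    (hC : ∀ z, ‖fderiv ℝ F z‖ ≤ C) :
    SobolevTriple Ω q (fun x => F (w₁ x, w₂ x))
      (fun x => fderiv ℝ F (w₁ x, w₂ x) (1, 0) • G₁ x + fderiv ℝ F (w₁ x, w₂ x) (0, 1) • G₂ x)
      (fun x => F (g₁ x, g₂ x)) := by
  have hq0 : q ≠ 0 := (zero_lt_one.trans_le hq).ne'
  have hC0 : 0 ≤ C := (norm_nonneg _).trans (hC 0)
  have hLip : ∀ z z', ‖F z - F z'‖ ≤ C * (‖z.1 - z'.1‖ + ‖z.2 - z'.2‖) := fun z z' => by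
    have := Convex.norm_image_sub_le_of_norm_fderiv_le (𝕜 := ℝ) (f := F) (C := C) (s := Set.univ)
      (fun x _ => hF.differentiable one_ne_zero x) (fun x _ => hC x) convex_univ
      (Set.mem_univ z') (Set.mem_univ z)
    refine this.trans ?_
    gcongr
    rw [Prod.norm_def]
    exact max_le_add_of_nonneg (norm_nonneg _) (norm_nonneg _)
  have hcF := hF.continuous
  have hcF' := hF.continuous_fderiv one_ne_zero
  have c10 : Continuous fun z => fderiv ℝ F z (1, 0) := hcF'.clm_apply continuous_const
  have c01 : Continuous fun z => fderiv ℝ F z (0, 1) := hcF'.clm_apply continuous_const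
  have b10 : ∀ z, ‖fderiv ℝ F z (1, 0)‖ ≤ C := fun z => by
    refine ((fderiv ℝ F z).le_opNorm _).trans ?_
    simpa using hC z
  have b01 : ∀ z, ‖fderiv ℝ F z (0, 1)‖ ≤ C := fun z => by
    refine ((fderiv ℝ F z).le_opNorm _).trans ?_
    simpa using hC z
  -- As F(0) = 0, |F(z)| ≤ C(|z₁| + |z₂|), so no finiteness of the measure is needed. This matters
  -- for the surface measure.
  have hbd : ∀ {E : Type} {m : MeasurableSpace E} {ν : Measure E} {u₁ u₂ : E → ℝ},
      MemLp u₁ q ν → MemLp u₂ q ν → MemLp (fun x => F (u₁ x, u₂ x)) q ν := by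
    intro E m ν u₁ u₂ m₁ m₂
    refine ((m₁.norm.add m₂.norm).const_mul C).of_le
      (hcF.comp_aestronglyMeasurable (m₁.1.prodMk m₂.1)) (.of_forall fun x => ?_)
    have := hLip (u₁ x, u₂ x) 0
    rw [hF0] at this
    refine le_trans (by simpa using this) (le_abs_self _)
  have mw : AEStronglyMeasurable (fun x => (w₁ x, w₂ x)) (volume.restrict Ω) :=
    h₁.memLp.1.prodMk h₂.memLp.1
  have mG : MemLp (fun x => fderiv ℝ F (w₁ x, w₂ x) (1, 0) • G₁ x
      + fderiv ℝ F (w₁ x, w₂ x) (0, 1) • G₂ x) q (volume.restrict Ω) := by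
    refine MemLp.add ?_ ?_
    · refine (h₁.memLp_grad.norm.const_mul C).of_le
        ((c10.comp_aestronglyMeasurable mw).smul h₁.memLp_grad.1) (.of_forall fun x => ?_)
      rw [norm_smul]
      refine le_trans ?_ (le_abs_self _)
      gcongr
      exact b10 _
    · refine (h₂.memLp_grad.norm.const_mul C).of_le
        ((c01.comp_aestronglyMeasurable mw).smul h₂.memLp_grad.1) (.of_forall fun x => ?_)
      rw [norm_smul]
      refine le_trans ?_ (le_abs_self _)
      gcongr
      exact b01 _
  refine ⟨hbd h₁.memLp h₂.memLp, mG, hbd h₁.memLp_trace h₂.memLp_trace, ?_⟩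
  obtain ⟨φ, hφ, hφ1, hφ2, hφ3⟩ := h₁.approx
  obtain ⟨χ, hχ, hχ1, hχ2, hχ3⟩ := h₂.approx
  have mφ := fun k => (hφ k).continuous.aestronglyMeasurable (μ := volume.restrict Ω)
  have mχ := fun k => (hχ k).continuous.aestronglyMeasurable (μ := volume.restrict Ω)
  -- The derivative of F is only continuous, so its values at the approximants converge only where
  -- the approximants do; a common subsequence converging almost everywhere is extracted.
  obtain ⟨i, hi, hia⟩ :=
    (tendstoInMeasure_of_tendsto_eLpNorm hq0 mφ h₁.memLp.1 hφ1).exists_seq_tendsto_ae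
  obtain ⟨j, hj, hja⟩ := (tendstoInMeasure_of_tendsto_eLpNorm hq0 (fun k => mχ (i k)) h₂.memLp.1
    (hχ1.comp hi.tendsto_atTop)).exists_seq_tendsto_ae
  have hij : Tendsto (fun k => i (j k)) atTop atTop := hi.tendsto_atTop.comp hj.tendsto_atTop
  refine ⟨fun k x => F (φ (i (j k)) x, χ (i (j k)) x), fun k => hF.comp ((hφ _).prodMk (hχ _)),
    ?_, ?_, ?_⟩
  · exact tendsto_eLpNorm_zero_of_le_add hq C (fun k => (mφ (i (j k))).sub h₁.memLp.1)
      (fun k => (mχ (i (j k))).sub h₂.memLp.1) (fun k => .of_forall fun x => hLip _ _)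
      (hφ1.comp hij) (hχ1.comp hij)
  -- The error splits into DF(approximants) applied to the gradient errors, small since DF is
  -- bounded, and the increment of DF applied to the fixed gradients, small by dominated
  -- convergence.
  · have hd : ∀ k x, gradient (fun x => F (φ (i (j k)) x, χ (i (j k)) x)) x
        - (fderiv ℝ F (w₁ x, w₂ x) (1, 0) • G₁ x + fderiv ℝ F (w₁ x, w₂ x) (0, 1) • G₂ x)
        = (fderiv ℝ F (φ (i (j k)) x, χ (i (j k)) x) (1, 0) • (gradient (φ (i (j k))) x - G₁ x)
          + fderiv ℝ F (φ (i (j k)) x, χ (i (j k)) x) (0, 1) • (gradient (χ (i (j k))) x - G₂ x))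
        + ((fderiv ℝ F (φ (i (j k)) x, χ (i (j k)) x) (1, 0)
            - fderiv ℝ F (w₁ x, w₂ x) (1, 0)) • G₁ x
          + (fderiv ℝ F (φ (i (j k)) x, χ (i (j k)) x) (0, 1)
            - fderiv ℝ F (w₁ x, w₂ x) (0, 1)) • G₂ x) := fun k x => by
      rw [gradient_comp_prodMk (hF.differentiable one_ne_zero _)
        ((hφ _).differentiable one_ne_zero _) ((hχ _).differentiable one_ne_zero _)]
      module
    have mgφ := fun k => ((continuous_gradient (hφ k)).aestronglyMeasurable
      (μ := volume.restrict Ω)).sub h₁.memLp_grad.1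
    have mgχ := fun k => ((continuous_gradient (hχ k)).aestronglyMeasurable
      (μ := volume.restrict Ω)).sub h₂.memLp_grad.1
    have mF := fun k => (mφ (i (j k))).prodMk (mχ (i (j k)))
    have mA : ∀ k, AEStronglyMeasurable (fun x =>
        fderiv ℝ F (φ (i (j k)) x, χ (i (j k)) x) (1, 0) • (gradient (φ (i (j k))) x - G₁ x)
        + fderiv ℝ F (φ (i (j k)) x, χ (i (j k)) x) (0, 1) • (gradient (χ (i (j k))) x - G₂ x))
        (volume.restrict Ω) := fun k =>
      ((c10.comp_aestronglyMeasurable (mF k)).smul (mgφ _)).add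
        ((c01.comp_aestronglyMeasurable (mF k)).smul (mgχ _))
    have mB : ∀ k, AEStronglyMeasurable (fun x =>
        (fderiv ℝ F (φ (i (j k)) x, χ (i (j k)) x) (1, 0)
            - fderiv ℝ F (w₁ x, w₂ x) (1, 0)) • G₁ x
          + (fderiv ℝ F (φ (i (j k)) x, χ (i (j k)) x) (0, 1)
            - fderiv ℝ F (w₁ x, w₂ x) (0, 1)) • G₂ x) (volume.restrict Ω) := fun k =>
      (((c10.comp_aestronglyMeasurable (mF k)).sub (c10.comp_aestronglyMeasurable mw)).smul
        h₁.memLp_grad.1).add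
      (((c01.comp_aestronglyMeasurable (mF k)).sub (c01.comp_aestronglyMeasurable mw)).smul
        h₂.memLp_grad.1)
    refine tendsto_eLpNorm_zero_of_le_add hq 1 mA mB
      (fun k => .of_forall fun x => ?_) ?_ ?_
    · rw [hd, one_mul]
      exact norm_add_le _ _
    · refine tendsto_eLpNorm_zero_of_le_add hq C (fun k => mgφ (i (j k)))
        (fun k => mgχ (i (j k))) (fun k => .of_forall fun x => ?_)
        (hφ2.comp hij) (hχ2.comp hij)
      refine (norm_add_le _ _).trans ?_
      rw [norm_smul, norm_smul, mul_add]
      gcongr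
      · exact b10 _
      · rfl
      · exact b01 _
      · rfl
    · refine tendsto_eLpNorm_zero_of_dominated hq0 hq' mB
        ((h₁.memLp_grad.norm.add h₂.memLp_grad.norm).const_mul (2 * C))
        (fun k => .of_forall fun x => ?_) ?_
      · refine (norm_add_le _ _).trans ?_
        rw [norm_smul, norm_smul, Pi.add_apply, mul_add]
        gcongr
        · refine (norm_sub_le _ _).trans ?_
          rw [two_mul]
          exact add_le_add (b10 _) (b10 _)
        · refine (norm_sub_le _ _).trans ?_
          rw [two_mul]
          exact add_le_add (b01 _) (b01 _)
      · filter_upwards [hia, hja] with x hx hx'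
        have hz : Tendsto (fun k => (φ (i (j k)) x, χ (i (j k)) x)) atTop (𝓝 (w₁ x, w₂ x)) :=
          (hx.comp hj.tendsto_atTop).prodMk_nhds hx'
        have l1 := ((c10.tendsto _).comp hz).sub_const (fderiv ℝ F (w₁ x, w₂ x) (1, 0))
        have l2 := ((c01.tendsto _).comp hz).sub_const (fderiv ℝ F (w₁ x, w₂ x) (0, 1))
        have := (l1.smul_const (G₁ x)).add (l2.smul_const (G₂ x))
        simpa [Function.comp_def] using this
  · exact tendsto_eLpNorm_zero_of_le_add hq C
      (fun k => (hφ (i (j k))).continuous.aestronglyMeasurable.sub h₁.memLp_trace.1)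
      (fun k => (hχ (i (j k))).continuous.aestronglyMeasurable.sub h₂.memLp_trace.1)
      (fun k => .of_forall fun x => hLip _ _) (hφ3.comp hij) (hχ3.comp hij)

end Triple

/-! ### The Sobolev inequality on bounded Lipschitz domains -/

section Sobolev

variable {N : ℕ} {Ω : Set (Space N)}

/-- The image of a Haar measure under a linear isomorphism is a Haar measure, hence a positive
multiple of Lebesgue measure. The value of the constant is irrelevant. -/
theorem exists_lintegral_comp_linearEquiv {V : Type*} [NormedAddCommGroup V] [NormedSpace ℝ V]
    [FiniteDimensional ℝ V] [MeasurableSpace V] [BorelSpace V] (ν : Measure V)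
    [ν.IsAddHaarMeasure] (L : V ≃L[ℝ] Space N) :
    ∃ c : ℝ≥0∞, c ≠ 0 ∧ c ≠ ⊤ ∧ ∀ F : Space N → ℝ≥0∞, Measurable F →
      ∫⁻ y, F (L y) ∂ν = c * ∫⁻ x, F x := by
  have : (ν.map L).IsAddHaarMeasure := L.isAddHaarMeasure_map ν
  refine ⟨(ν.map L).addHaarScalarFactor volume, ENNReal.coe_ne_zero.2
    (Measure.addHaarScalarFactor_pos_of_isAddHaarMeasure _ _).ne', ENNReal.coe_ne_top,
    fun F hF => ?_⟩
  have h := Measure.isAddLeftInvariant_eq_smul (ν.map L) (volume : Measure (Space N))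
  rw [← lintegral_map hF L.continuous.measurable]
  conv_lhs => rw [h]
  rw [lintegral_smul_measure]
  rfl

/-- A nonempty open set spans the space, and a basis can be extracted from any spanning set. -/
theorem exists_basis_mem_of_isOpen {U : Set (Space N)} (hU : IsOpen U) (hne : U.Nonempty) :
    ∃ v : Module.Basis (Fin N) ℝ (Space N), ∀ i, v i ∈ U := by
  have hs : Submodule.span ℝ U = ⊤ := by
    refine Submodule.eq_top_of_nonempty_interior' _ ?_
    obtain ⟨x, hx⟩ := hne
    exact ⟨x, mem_interior.2 ⟨U, Submodule.subset_span, hU, hx⟩⟩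
  let v := Module.Basis.ofSpan hs.ge
  have : Fintype ↑((linearIndepOn_empty ℝ id).extend (Set.empty_subset U)) :=
    FiniteDimensional.fintypeBasisIndex v
  have hcard : Fintype.card ↑((linearIndepOn_empty ℝ id).extend (Set.empty_subset U)) = N := by
    rw [← Module.finrank_eq_card_basis v]
    simp
  refine ⟨v.reindex (Fintype.equivFinOfCardEq hcard), fun i => ?_⟩
  rw [Module.Basis.reindex_apply]
  exact Module.Basis.ofSpan_subset hs.ge (Set.mem_range_self _)

/-- The cone property of Lipschitz domains, with `N` independent directions. -/
theorem exists_cone_basis (hΩ : IsOpen Ω) (hL : HasLipschitzBoundary Ω) {x₀ : Space N}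
    (hx : x₀ ∈ closure Ω) :
    ∃ r > 0, ∃ v : Module.Basis (Fin N) ℝ (Space N), ∀ x ∈ Ω ∩ Metric.ball x₀ r, ∀ i, ∀ t : ℝ, t ≤ 0 →
      x + t • v i ∈ Metric.ball x₀ r → x + t • v i ∈ Ω := by
  by_cases hxΩ : x₀ ∈ Ω
  · obtain ⟨r, hr, hsub⟩ := Metric.isOpen_iff.1 hΩ x₀ hxΩ
    exact ⟨r, hr, (EuclideanSpace.basisFun (Fin N) ℝ).toBasis, fun x _ i t _ h => hsub h⟩
  · have hf : x₀ ∈ frontier Ω := by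
      rw [frontier, hΩ.interior_eq]
      exact ⟨hx, hxΩ⟩
    obtain ⟨r, e, K, ψ, hr, he, hψ, heq⟩ := hL x₀ hf
    -- The open cone of directions that descend faster than the graph of ψ can. Moving against such
    -- a direction raises the point by more than ψ grows, so the point stays in the epigraph; -e
    -- shows that the cone is nonempty.
    let U : Set (Space N) := {v | K * ‖v - (inner ℝ e v) • e‖ < -inner ℝ e v}
    have hU : IsOpen U := isOpen_lt (by fun_prop) (by fun_prop)
    have hee : inner ℝ e e = (1 : ℝ) := by rw [real_inner_self_eq_norm_sq, he]; norm_num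
    obtain ⟨v, hv⟩ := exists_basis_mem_of_isOpen hU ⟨-e, by
      simp only [U, Set.mem_ofPred_eq, inner_neg_right, hee]; simp⟩
    refine ⟨r, hr, v, fun x hxr i t ht hball => ?_⟩
    have hx1 : x ∈ {x ∈ Metric.ball x₀ r | ψ (x - (inner ℝ e x) • e) < inner ℝ e x} :=
      heq ▸ hxr
    have : x + t • v i ∈ Ω ∩ Metric.ball x₀ r := by
      rw [heq]
      refine ⟨hball, ?_⟩
      have h1 := hψ.dist_le_mul (x + t • v i - (inner ℝ e (x + t • v i)) • e)
        (x - (inner ℝ e x) • e)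
      rw [Real.dist_eq, dist_eq_norm] at h1
      have h2 : x + t • v i - (inner ℝ e (x + t • v i)) • e - (x - (inner ℝ e x) • e)
          = t • (v i - (inner ℝ e (v i)) • e) := by
        rw [inner_add_right, real_inner_smul_right]
        module
      rw [h2, norm_smul, Real.norm_eq_abs, abs_of_nonpos ht] at h1
      have h3 := (abs_le.1 h1).2
      have h4 := hx1.2
      have h5 : K * ‖v i - (inner ℝ e (v i)) • e‖ < -inner ℝ e (v i) := hv i
      show ψ _ < inner ℝ e (x + t • v i)
      rw [inner_add_right (x := e) (y := x), real_inner_smul_right]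
      rw [inner_add_right (x := e) (y := x), real_inner_smul_right] at h3
      nlinarith
    exact this.1

/-- The fundamental theorem of calculus on the half-line ending at the point and lying in the
direction -`v i`. By the cone property the half-line is in Ω as long as it is in the ball, and
outside the ball f vanishes, so only the gradient in Ω is seen. The sum of all ‖`v j`‖ makes the
integrand independent of i. -/
theorem enorm_le_lintegral_update (f : Space N → ℝ) (hf : ContDiff ℝ 1 f)
    (hcs : HasCompactSupport f) {x₀ : Space N} {r : ℝ} (hsub : tsupport f ⊆ Metric.ball x₀ r)
    (v : Module.Basis (Fin N) ℝ (Space N))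
    (hv : ∀ x ∈ Ω ∩ Metric.ball x₀ r, ∀ i, ∀ t : ℝ, t ≤ 0 →
      x + t • v i ∈ Metric.ball x₀ r → x + t • v i ∈ Ω) (y : Fin N → ℝ) (i : Fin N) :
    Ω.indicator (fun x => ‖f x‖ₑ) (v.equivFunL.symm y) ≤
      ∫⁻ s, (∑ j, ‖v j‖ₑ) * Ω.indicator (fun x => ‖fderiv ℝ f x‖ₑ)
        (v.equivFunL.symm (Function.update y i s)) := by
  set L := v.equivFunL.symm with hLdef
  by_cases hy : L y ∈ Ω
  swap
  · simp [hy]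
  by_cases hfy : f (L y) = 0
  · refine le_of_eq_of_le ?_ zero_le
    rw [Set.indicator_of_mem hy, hfy, enorm_zero]
  have hyB : L y ∈ Ω ∩ Metric.ball x₀ r := ⟨hy, hsub (subset_tsupport f hfy)⟩
  rw [Set.indicator_of_mem hy]
  have hLs : ∀ s, L (Function.update y i s) = L y + (s - y i) • v i := fun s => by
    have : Function.update y i s = y + (s - y i) • Pi.single i (1 : ℝ) := by
      ext j
      rcases eq_or_ne j i with rfl | hj
      · simp
      · simp [hj]
    rw [this, map_add, map_smul]
    congr 2
    have : v.equivFun.symm (Pi.single i 1) = v i := by simp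
    exact this
  have hder : ∀ s, HasDerivAt (fun s => f (L (Function.update y i s)))
      (fderiv ℝ f (L (Function.update y i s)) (v i)) s := fun s => by
    have h1 : HasDerivAt (fun s : ℝ => L y + (s - y i) • v i) (v i) s := by
      simpa using (((hasDerivAt_id s).sub_const (y i)).smul_const (v i)).const_add (L y)
    simp_rw [hLs]
    exact ((hf.differentiable one_ne_zero _).hasFDerivAt.comp_hasDerivAt s h1)
  have hC : ContDiff ℝ 1 (fun s => f (L (Function.update y i s))) := by
    simp_rw [hLs]
    fun_prop
  have hS : HasCompactSupport (fun s => f (L (Function.update y i s))) :=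
    (hcs.comp_homeomorph L.toHomeomorph).comp_isClosedEmbedding (isClosedEmbedding_update y i)
  have h0 := hS.enorm_le_lintegral_Ici_deriv hC (y i)
  rw [Function.update_eq_self] at h0
  refine h0.trans ((setLIntegral_mono' measurableSet_Iic fun s hs => ?_).trans
    (setLIntegral_le_lintegral _ _))
  rw [(hder s).deriv]
  by_cases hz : L (Function.update y i s) ∈ Metric.ball x₀ r
  · have hzΩ : L (Function.update y i s) ∈ Ω := by
      rw [hLs] at hz ⊢
      exact hv _ hyB i _ (sub_nonpos.2 hs) hz
    rw [Set.indicator_of_mem hzΩ, mul_comm]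
    refine ((fderiv ℝ f _).le_opENorm (v i)).trans ?_
    gcongr
    exact Finset.single_le_sum (f := fun j => ‖v j‖ₑ) (fun _ _ => zero_le) (Finset.mem_univ i)
  · have : fderiv ℝ f (L (Function.update y i s)) = 0 :=
      image_eq_zero_of_notMem_tsupport fun h => hz (hsub (tsupport_fderiv_subset ℝ h))
    simp [this]

/-- The Sobolev inequality in a domain with the cone property, for functions supported in a
small ball. -/
theorem exists_lintegral_rpow_le_of_cone (hΩ : MeasurableSet Ω) {P : ℝ}
    (hP : Real.HolderConjugate N P) {x₀ : Space N} {r : ℝ}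
    (v : Module.Basis (Fin N) ℝ (Space N))
    (hv : ∀ x ∈ Ω ∩ Metric.ball x₀ r, ∀ i, ∀ t : ℝ, t ≤ 0 →
      x + t • v i ∈ Metric.ball x₀ r → x + t • v i ∈ Ω) :
    ∃ C : ℝ≥0∞, C ≠ ⊤ ∧ ∀ f : Space N → ℝ, ContDiff ℝ 1 f → HasCompactSupport f →
      tsupport f ⊆ Metric.ball x₀ r →
      ∫⁻ x in Ω, ‖f x‖ₑ ^ P ≤ C * (∫⁻ x in Ω, ‖fderiv ℝ f x‖ₑ) ^ P := by
  obtain ⟨c, hc0, hc, hcL⟩ := exists_lintegral_comp_linearEquiv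
    (volume : Measure (Fin N → ℝ)) v.equivFunL.symm
  have hP0 : 0 < P := hP.symm.pos
  have hN1 : (1 : ℝ) < N := hP.lt
  set K : ℝ≥0∞ := ∑ j, ‖v j‖ₑ
  have hK : K ≠ ⊤ := ENNReal.sum_ne_top.2 fun j _ => enorm_ne_top
  refine ⟨c⁻¹ * (K * c) ^ P, ENNReal.mul_ne_top (ENNReal.inv_ne_top.2 hc0)
    (ENNReal.rpow_ne_top_of_nonneg hP0.le (ENNReal.mul_ne_top hK hc)), fun f hf hcs hsub => ?_⟩
  set g : Space N → ℝ≥0∞ := Ω.indicator (fun x => ‖fderiv ℝ f x‖ₑ) with hg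
  have hgm : Measurable g :=
    ((hf.continuous_fderiv one_ne_zero).enorm.measurable).indicator hΩ
  set h : Space N → ℝ≥0∞ := Ω.indicator (fun x => ‖f x‖ₑ) with hh
  have hhm : Measurable h := (hf.continuous.enorm.measurable).indicator hΩ
  -- Gagliardo–Nirenberg: the N bounds by line integrals are multiplied and integrated with the
  -- grid-lines inequality.
  have h1 : ∫⁻ y, h (v.equivFunL.symm y) ^ P ≤ (∫⁻ y, K * g (v.equivFunL.symm y)) ^ P := by
    have hP' : Real.HolderConjugate (Fintype.card (Fin N)) P := by simpa using hP
    have hgrid := lintegral_prod_lintegral_pow_le (fun _ : Fin N => (volume : Measure ℝ)) hP'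
      (f := fun y => K * g (v.equivFunL.symm y))
      ((hgm.comp v.equivFunL.symm.continuous.measurable).const_mul K)
    refine le_trans (lintegral_mono fun y => ?_) hgrid
    -- P = N/(N - 1), so h^P is a product of N equal factors h^(1/(N-1)), one for each coordinate
    -- direction.
    have e1 : h (v.equivFunL.symm y) ^ P
        = ∏ _i : Fin N, h (v.equivFunL.symm y) ^ ((1 : ℝ) / (Fintype.card (Fin N) - 1 : ℝ)) := by
      rw [Finset.prod_const, ← ENNReal.rpow_natCast, ← ENNReal.rpow_mul, hP.conjugate_eq]
      congr 1
      simp only [Fintype.card_fin, Finset.card_univ]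
      field_simp
    rw [e1]
    refine Finset.prod_le_prod' fun i _ => ?_
    refine ENNReal.rpow_le_rpow (enorm_le_lintegral_update f hf hcs hsub v hv y i) ?_
    simp only [Fintype.card_fin]
    have : (0 : ℝ) < N - 1 := by linarith
    positivity
  rw [hcL _ (hhm.pow_const P), lintegral_const_mul' _ _ hK, hcL _ hgm] at h1
  have e2 : ∫⁻ x, h x ^ P = ∫⁻ x in Ω, ‖f x‖ₑ ^ P := by
    rw [← lintegral_indicator hΩ]
    congr 1 with x
    by_cases hx : x ∈ Ω <;> simp [hh, hx, hP0]
  have e3 : ∫⁻ x, g x = ∫⁻ x in Ω, ‖fderiv ℝ f x‖ₑ := lintegral_indicator hΩ _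
  rw [e2, e3] at h1
  rw [mul_assoc, ← ENNReal.mul_rpow_of_nonneg _ _ hP0.le, mul_assoc]
  calc ∫⁻ x in Ω, ‖f x‖ₑ ^ P = c⁻¹ * (c * ∫⁻ x in Ω, ‖f x‖ₑ ^ P) := by
        rw [← mul_assoc, ENNReal.inv_mul_cancel hc0 hc, one_mul]
    _ ≤ _ := by gcongr

theorem lintegral_enorm_fderiv_mul_le {η φ : Space N → ℝ}
    (hη : ContDiff ℝ 1 η) (hφ : ContDiff ℝ 1 φ) {C : ℝ≥0} (hC : ∀ x, ‖η x‖ ≤ C)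
    (hC' : ∀ x, ‖fderiv ℝ η x‖ ≤ C) :
    ∫⁻ x in Ω, ‖fderiv ℝ (fun x => η x * φ x) x‖ₑ
      ≤ C * ((∫⁻ x in Ω, ‖φ x‖ₑ) + ∫⁻ x in Ω, ‖gradient φ x‖ₑ) := by
  rw [← lintegral_add_left hφ.continuous.enorm.measurable,
    ← lintegral_const_mul' _ _ ENNReal.coe_ne_top]
  refine lintegral_mono fun x => ?_
  have h1 : ‖fderiv ℝ (fun x => η x * φ x) x‖ ≤ C * (‖φ x‖ + ‖gradient φ x‖) := by
    rw [fderiv_fun_mul (hη.differentiable one_ne_zero x) (hφ.differentiable one_ne_zero x),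
      norm_gradient]
    refine (norm_add_le _ _).trans ?_
    rw [norm_smul, norm_smul, mul_add, add_comm, mul_comm]
    gcongr
    · exact hC' x
    · exact hC x
  rw [← ofReal_norm, ← ofReal_norm, ← ofReal_norm, ← ENNReal.ofReal_add (norm_nonneg _)
    (norm_nonneg _), ← ENNReal.ofReal_coe_nnreal, ← ENNReal.ofReal_mul C.coe_nonneg]
  exact ENNReal.ofReal_le_ofReal h1

theorem ContDiffBump.exists_bound {x₀ : Space N} (η : ContDiffBump x₀) :
    ∃ C : ℝ≥0, (∀ x, ‖η x‖ ≤ C) ∧ ∀ x, ‖fderiv ℝ η x‖ ≤ C := by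
  obtain ⟨C, hC⟩ := η.hasCompactSupport.exists_bound_of_continuous η.continuous
  have hη1 : ContDiff ℝ 1 η := η.contDiff
  obtain ⟨C', hC'⟩ := (η.hasCompactSupport.fderiv ℝ).exists_bound_of_continuous
    (hη1.continuous_fderiv one_ne_zero)
  have h0 : 0 ≤ C := (norm_nonneg _).trans (hC 0)
  refine ⟨⟨max C C', le_max_of_le_left h0⟩, fun x => (hC x).trans (le_max_left _ _),
    fun x => (hC' x).trans (le_max_right _ _)⟩

/-- The Sobolev inequality `W^{1,1}(Ω) ⊆ L^{N/(N-1)}(Ω)` on bounded Lipschitz domains. -/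
theorem exists_sobolev_contDiff (hΩ : IsOpen Ω) (hb : Bornology.IsBounded Ω)
    (hL : HasLipschitzBoundary Ω) {P : ℝ} (hP : Real.HolderConjugate N P) :
    ∃ C : ℝ≥0∞, C ≠ ⊤ ∧ ∀ φ : Space N → ℝ, ContDiff ℝ 1 φ →
      ∫⁻ x in Ω, ‖φ x‖ₑ ^ P
        ≤ C * ((∫⁻ x in Ω, ‖φ x‖ₑ) + ∫⁻ x in Ω, ‖gradient φ x‖ₑ) ^ P := by
  have hP0 : 0 < P := hP.symm.pos
  -- Compactness of the closure reduces the claim to small balls; under unions the constants add.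
  have key : ∃ C : ℝ≥0∞, C ≠ ⊤ ∧ ∀ φ : Space N → ℝ, ContDiff ℝ 1 φ →
      ∫⁻ x in closure Ω, ‖φ x‖ₑ ^ P ∂(volume.restrict Ω)
        ≤ C * ((∫⁻ x in Ω, ‖φ x‖ₑ) + ∫⁻ x in Ω, ‖gradient φ x‖ₑ) ^ P := by
    refine hb.isCompact_closure.induction_on (p := fun s => ∃ C : ℝ≥0∞, C ≠ ⊤ ∧
      ∀ φ : Space N → ℝ, ContDiff ℝ 1 φ →
      ∫⁻ x in s, ‖φ x‖ₑ ^ P ∂(volume.restrict Ω)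
        ≤ C * ((∫⁻ x in Ω, ‖φ x‖ₑ) + ∫⁻ x in Ω, ‖gradient φ x‖ₑ) ^ P) ?_ ?_ ?_ ?_
    · exact ⟨0, ENNReal.zero_ne_top, by simp⟩
    · rintro s t hst ⟨C, hC, h⟩
      exact ⟨C, hC, fun φ hφ => (lintegral_mono_set hst).trans (h φ hφ)⟩
    · rintro s t ⟨C, hC, h⟩ ⟨C', hC', h'⟩
      refine ⟨C + C', ENNReal.add_ne_top.2 ⟨hC, hC'⟩, fun φ hφ => ?_⟩
      rw [add_mul]
      exact (lintegral_union_le _ _ _).trans (add_le_add (h φ hφ) (h' φ hφ))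
    · intro x₀ hx₀
      obtain ⟨r, hr, v, hv⟩ := exists_cone_basis hΩ hL hx₀
      obtain ⟨C, hC, h⟩ := exists_lintegral_rpow_le_of_cone hΩ.measurableSet hP v hv
      -- Equal to 1 on the ball of radius r/4 where the estimate is wanted, and supported well
      -- inside the ball of radius r where the cone property holds.
      let η : ContDiffBump x₀ := ⟨r / 4, r / 2, by positivity, by linarith⟩
      obtain ⟨C', hC1, hC2⟩ := ContDiffBump.exists_bound η
      refine ⟨Metric.ball x₀ (r / 4), mem_nhdsWithin_of_mem_nhds (Metric.ball_mem_nhds _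
        (by positivity)), C * C' ^ P, ENNReal.mul_ne_top hC
        (ENNReal.rpow_ne_top_of_nonneg hP0.le ENNReal.coe_ne_top), fun φ hφ => ?_⟩
      have hη1 : ContDiff ℝ 1 η := η.contDiff
      have hts : tsupport (fun x => η x * φ x) ⊆ Metric.ball x₀ r := by
        refine (tsupport_mul_subset_left (f := η) (g := φ)).trans ?_
        rw [η.tsupport_eq]
        exact Metric.closedBall_subset_ball (by show r / 2 < r; linarith)
      have h1 := h (fun x => η x * φ x) (hη1.mul hφ) (η.hasCompactSupport.mul_right) hts
      have h2 := lintegral_enorm_fderiv_mul_le (Ω := Ω) hη1 hφ hC1 hC2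
      calc ∫⁻ x in Metric.ball x₀ (r / 4), ‖φ x‖ₑ ^ P ∂(volume.restrict Ω)
          = ∫⁻ x in Metric.ball x₀ (r / 4), ‖η x * φ x‖ₑ ^ P ∂(volume.restrict Ω) := by
            refine setLIntegral_congr_fun measurableSet_ball fun x hx => ?_
            show ‖φ x‖ₑ ^ P = ‖η x * φ x‖ₑ ^ P
            rw [η.one_of_mem_closedBall (Metric.ball_subset_closedBall hx), one_mul]
        _ ≤ ∫⁻ x in Ω, ‖η x * φ x‖ₑ ^ P := setLIntegral_le_lintegral _ _
        _ ≤ _ := h1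
        _ ≤ C * (C' * ((∫⁻ x in Ω, ‖φ x‖ₑ) + ∫⁻ x in Ω, ‖gradient φ x‖ₑ)) ^ P := by gcongr
        _ = _ := by rw [ENNReal.mul_rpow_of_nonneg _ _ hP0.le, mul_assoc]
  obtain ⟨C, hC, h⟩ := key
  refine ⟨C, hC, fun φ hφ => le_of_eq_of_le ?_ (h φ hφ)⟩
  rw [Measure.restrict_restrict isClosed_closure.measurableSet,
    Set.inter_eq_right.2 subset_closure]

theorem lintegral_enorm_le_add_eLpNorm_sub {X E : Type*} [MeasurableSpace X] {μ : Measure X}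
    [NormedAddCommGroup E] {F f : X → E} (hF : AEStronglyMeasurable F μ)
    (hf : AEStronglyMeasurable f μ) :
    ∫⁻ x, ‖F x‖ₑ ∂μ ≤ ∫⁻ x, ‖f x‖ₑ ∂μ + eLpNorm (fun x => F x - f x) 1 μ := by
  rw [← eLpNorm_one_eq_lintegral_enorm, ← eLpNorm_one_eq_lintegral_enorm]
  refine le_trans (le_of_eq ?_) (eLpNorm_add_le hf (hF.sub hf) le_rfl)
  congr 1
  ext x
  simp

/-- Fatou's lemma along a subsequence of the C¹ approximants that converges almost everywhere; the
right side passes to the limit by L¹ convergence. -/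
theorem exists_sobolev_triple (hΩ : IsOpen Ω) (hb : Bornology.IsBounded Ω)
    (hL : HasLipschitzBoundary Ω) {P : ℝ} (hP : Real.HolderConjugate N P) {q : ℝ≥0∞}
    (hq : 1 ≤ q) :
    ∃ C : ℝ≥0∞, C ≠ ⊤ ∧ ∀ w G g, SobolevTriple Ω q w G g →
      ∫⁻ x in Ω, ‖w x‖ₑ ^ P
        ≤ C * ((∫⁻ x in Ω, ‖w x‖ₑ) + ∫⁻ x in Ω, ‖G x‖ₑ) ^ P := by
  have := isFiniteMeasure_restrict hb
  have hP0 : 0 < P := hP.symm.pos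
  obtain ⟨C, hC, h⟩ := exists_sobolev_contDiff hΩ hb hL hP
  refine ⟨C, hC, fun w G g hw => ?_⟩
  obtain ⟨φ, hφ, h1, h2, -⟩ := hw.approx
  have mφ := fun k => (hφ k).continuous.aestronglyMeasurable (μ := volume.restrict Ω)
  have mg := fun k => (continuous_gradient (hφ k)).aestronglyMeasurable (μ := volume.restrict Ω)
  have h1' := tendsto_eLpNorm_one_of_tendsto hq (fun k => (mφ k).sub hw.memLp.1) h1
  have h2' := tendsto_eLpNorm_one_of_tendsto hq (fun k => (mg k).sub hw.memLp_grad.1) h2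
  obtain ⟨i, hi, hia⟩ := (tendstoInMeasure_of_tendsto_eLpNorm one_ne_zero mφ hw.memLp.1
    h1').exists_seq_tendsto_ae
  have hlim : Tendsto (fun k => C * (((∫⁻ x in Ω, ‖w x‖ₑ)
      + eLpNorm (fun x => φ (i k) x - w x) 1 (volume.restrict Ω))
      + ((∫⁻ x in Ω, ‖G x‖ₑ)
      + eLpNorm (fun x => gradient (φ (i k)) x - G x) 1 (volume.restrict Ω))) ^ P) atTop
      (𝓝 (C * ((∫⁻ x in Ω, ‖w x‖ₑ) + ∫⁻ x in Ω, ‖G x‖ₑ) ^ P)) := by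
    refine ENNReal.Tendsto.const_mul ?_ (Or.inr hC)
    refine ((ENNReal.continuous_rpow_const (y := P)).tendsto _).comp ?_
    have l1 := (h1'.comp hi.tendsto_atTop).const_add (∫⁻ x in Ω, ‖w x‖ₑ)
    have l2 := (h2'.comp hi.tendsto_atTop).const_add (∫⁻ x in Ω, ‖G x‖ₑ)
    have l3 := l1.add l2
    rw [add_zero, add_zero] at l3
    exact l3
  calc ∫⁻ x in Ω, ‖w x‖ₑ ^ P
      = ∫⁻ x in Ω, liminf (fun k => ‖φ (i k) x‖ₑ ^ P) atTop := by
        refine lintegral_congr_ae ?_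
        filter_upwards [hia] with x hx
        exact (((ENNReal.continuous_rpow_const (y := P)).tendsto _).comp hx.enorm).liminf_eq.symm
    _ ≤ liminf (fun k => ∫⁻ x in Ω, ‖φ (i k) x‖ₑ ^ P) atTop :=
        lintegral_liminf_le fun k => (hφ (i k)).continuous.enorm.measurable.pow_const P
    _ ≤ liminf (fun k => C * (((∫⁻ x in Ω, ‖w x‖ₑ)
      + eLpNorm (fun x => φ (i k) x - w x) 1 (volume.restrict Ω))
      + ((∫⁻ x in Ω, ‖G x‖ₑ)
      + eLpNorm (fun x => gradient (φ (i k)) x - G x) 1 (volume.restrict Ω))) ^ P) atTop := by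
        refine liminf_le_liminf (.of_forall fun k => (h _ (hφ (i k))).trans ?_)
        gcongr
        · exact lintegral_enorm_le_add_eLpNorm_sub (mφ _) hw.memLp.1
        · exact lintegral_enorm_le_add_eLpNorm_sub (mg _) hw.memLp_grad.1
    _ = _ := hlim.liminf_eq

end Sobolev

/-! ### The local trace inequality -/

section Trace

variable {N : ℕ} {Ω : Set (Space N)}

/-- Inside a chart the strict epigraph belongs to the open set Ω, and the strict subgraph is open
and misses Ω; neither contains boundary points, so the boundary is the graph. -/
theorem inner_eq_of_mem_frontier (hΩ : IsOpen Ω) {x₀ e : Space N} {r : ℝ} {K : ℝ≥0}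
    {ψ : Space N → ℝ} (hψ : LipschitzWith K ψ)
    (heq : Ω ∩ Metric.ball x₀ r =
      {x ∈ Metric.ball x₀ r | ψ (x - (inner ℝ e x) • e) < inner ℝ e x})
    {x : Space N} (hx : x ∈ frontier Ω) (hxr : x ∈ Metric.ball x₀ r) :
    ψ (x - (inner ℝ e x) • e) = inner ℝ e x := by
  have hxΩ : x ∉ Ω := by
    rw [frontier, hΩ.interior_eq] at hx
    exact hx.2
  refine le_antisymm ?_ ?_
  · by_contra! hlt
    have hc : Continuous fun x => ψ (x - (inner ℝ e x) • e) :=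
      hψ.continuous.comp (by fun_prop)
    have hopen : IsOpen ({x | inner ℝ e x < ψ (x - (inner ℝ e x) • e)} ∩ Metric.ball x₀ r) :=
      (isOpen_lt (by fun_prop) hc).inter Metric.isOpen_ball
    obtain ⟨y, ⟨hy1, hy2⟩, hyΩ⟩ := mem_closure_iff.1 hx.1 _ hopen ⟨hlt, hxr⟩
    have : y ∈ Ω ∩ Metric.ball x₀ r := ⟨hyΩ, hy2⟩
    rw [heq] at this
    exact lt_asymm hy1 this.2
  · by_contra! hlt
    have : x ∈ Ω ∩ Metric.ball x₀ r := by rw [heq]; exact ⟨hxr, hlt⟩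
    exact hxΩ this.1

/-- The local trace inequality `W^{1,1}(Ω) → L¹(∂Ω)`. -/
theorem exists_local_trace (hΩ : IsOpen Ω) (hL : HasLipschitzBoundary Ω) {x₀ : Space N}
    (hx₀ : x₀ ∈ frontier Ω) :
    ∃ r > 0, ∃ C : ℝ≥0∞, C ≠ ⊤ ∧ ∀ φ : Space N → ℝ, ContDiff ℝ 1 φ →
      ∫⁻ x in Metric.ball x₀ r, ‖φ x‖ₑ ∂(surfaceMeasure Ω)
        ≤ C * ((∫⁻ x in Ω, ‖φ x‖ₑ) + ∫⁻ x in Ω, ‖gradient φ x‖ₑ) := by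
  obtain ⟨r, e, K, ψ, hr, he, hψ, heq⟩ := hL x₀ hx₀
  have hee : inner ℝ e e = (1 : ℝ) := by rw [real_inner_self_eq_norm_sq, he]; norm_num
  have he0 : e ≠ 0 := by rintro rfl; simp at he
  let V : Submodule ℝ (Space N) := (Submodule.span ℝ {e})ᗮ
  let n : ℕ := Module.finrank ℝ V
  have hn : 1 + n = N := by
    have := Submodule.finrank_add_finrank_orthogonal (Submodule.span ℝ {e})
    rwa [finrank_span_singleton he0, finrank_euclideanSpace, Fintype.card_fin] at this
  let bV := Module.finBasis ℝ V
  let ι : (Fin n → ℝ) →L[ℝ] Space N :=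
    LinearMap.toContinuousLinearMap (V.subtype ∘ₗ bV.equivFun.symm.toLinearMap)
  have hιe : ∀ y, inner ℝ e (ι y) = (0 : ℝ) := fun y =>
    Submodule.mem_orthogonal_singleton_iff_inner_right.1 (bV.equivFun.symm y).2
  have hι0 : ∀ y, ι y = 0 → y = 0 := fun y hy => by
    have : bV.equivFun.symm y = 0 := Subtype.ext hy
    exact (LinearEquiv.map_eq_zero_iff _).1 this
  have hιs : ∀ x : Space N, inner ℝ e x = (0 : ℝ) → ∃ y, ι y = x := fun x hx => by
    refine ⟨bV.equivFun ⟨x, Submodule.mem_orthogonal_singleton_iff_inner_right.2 hx⟩, ?_⟩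
    show ((bV.equivFun.symm (bV.equivFun _) : V) : Space N) = x
    rw [LinearEquiv.symm_apply_apply]
  -- Graph coordinates: y ranges over the hyperplane orthogonal to e and t is minus the height, so
  -- that decreasing t goes upwards, into Ω.
  let L₀ : ℝ × (Fin n → ℝ) →ₗ[ℝ] Space N :=
    (LinearMap.toSpanSingleton ℝ (Space N) (-e)).coprod ι.toLinearMap
  have hL₀ : ∀ z, L₀ z = z.1 • (-e) + ι z.2 := fun z => rfl
  have hinj : Function.Injective L₀ := by
    rw [← LinearMap.ker_eq_bot, LinearMap.ker_eq_bot']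
    rintro ⟨t, y⟩ hz
    rw [hL₀] at hz
    have ht : t = 0 := by
      have := congrArg (fun w => inner ℝ e w) hz
      simpa only [inner_add_right, hιe, real_inner_smul_right, inner_neg_right, hee,
        inner_zero_right, add_zero, mul_neg, mul_one, neg_eq_zero] using this
    subst ht
    rw [hι0 y (by simpa using hz)]
    rfl
  have hdim : Module.finrank ℝ (ℝ × (Fin n → ℝ)) = Module.finrank ℝ (Space N) := by
    rw [Module.finrank_prod, Module.finrank_self, Module.finrank_fin_fun,
      finrank_euclideanSpace, Fintype.card_fin, hn]
  let L : (ℝ × (Fin n → ℝ)) ≃L[ℝ] Space N :=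
    (LinearEquiv.ofInjectiveOfFinrankEq L₀ hinj hdim).toContinuousLinearEquiv
  have hLa : ∀ s y, L (s, y) = s • (-e) + ι y := fun s y => rfl
  obtain ⟨c, hc0, hc, hcL⟩ := exists_lintegral_comp_linearEquiv
    ((volume : Measure ℝ).prod (volume : Measure (Fin n → ℝ))) L
  let Gr : (Fin n → ℝ) → Space N := fun y => ι y + ψ (ι y) • e
  have hGr : LipschitzWith (‖ι‖₊ + ‖ContinuousLinearMap.toSpanSingleton ℝ e‖₊ * (K * ‖ι‖₊)) Gr :=
    ι.lipschitz.add ((ContinuousLinearMap.toSpanSingleton ℝ e).lipschitz.comp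
      (hψ.comp ι.lipschitz))
  set KG := ‖ι‖₊ + ‖ContinuousLinearMap.toSpanSingleton ℝ e‖₊ * (K * ‖ι‖₊)
  have hsurj : ∀ x ∈ frontier Ω, x ∈ Metric.ball x₀ r → ∃ y, Gr y = x := fun x hx hxr => by
    have h1 := inner_eq_of_mem_frontier hΩ hψ heq hx hxr
    obtain ⟨y, hy⟩ := hιs (x - (inner ℝ e x) • e) (by
      rw [inner_sub_right, real_inner_smul_right, hee, mul_one, sub_self])
    exact ⟨y, by simp only [Gr, hy, h1, sub_add_cancel]⟩
  have hNn : (N : ℝ) - 1 = n := by rw [← hn]; push_cast; ring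
  -- The boundary piece is covered by the Lipschitz image of ℝⁿ under the graph map, and in ℝⁿ with
  -- the sup metric the n-dimensional Hausdorff measure is Lebesgue measure.
  have hle : (surfaceMeasure Ω).restrict (Metric.ball x₀ r)
      ≤ ((KG : ℝ≥0∞) ^ (n : ℝ)) • Measure.map Gr volume := by
    refine Measure.le_iff.2 fun s hs => ?_
    rw [Measure.smul_apply, Measure.map_apply hGr.continuous.measurable hs, surfaceMeasure,
      Measure.restrict_restrict measurableSet_ball, Measure.restrict_apply hs, hNn, smul_eq_mul]
    have hvol : (volume : Measure (Fin n → ℝ)) = Measure.hausdorffMeasure (n : ℝ) := by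
      rw [← hausdorffMeasure_pi_real, Fintype.card_fin]
    rw [hvol]
    refine le_trans (measure_mono ?_) (hGr.hausdorffMeasure_image_le n.cast_nonneg _)
    rintro x ⟨hxs, hxr, hxf⟩
    obtain ⟨y, rfl⟩ := hsurj x hxf hxr
    exact ⟨y, hxs, rfl⟩
  let η : ContDiffBump x₀ := ⟨r / 4, r / 2, by positivity, by linarith⟩
  obtain ⟨C', hC1, hC2⟩ := ContDiffBump.exists_bound η
  have hη1 : ContDiff ℝ 1 η := η.contDiff
  refine ⟨r / 4, by positivity, (KG : ℝ≥0∞) ^ (n : ℝ) * (c * C'), ENNReal.mul_ne_top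
    (ENNReal.rpow_ne_top_of_nonneg n.cast_nonneg ENNReal.coe_ne_top)
    (ENNReal.mul_ne_top hc ENNReal.coe_ne_top), fun φ hφ => ?_⟩
  set f : Space N → ℝ := fun x => η x * φ x with hfdef
  have hf : ContDiff ℝ 1 f := hη1.mul hφ
  have hcs : HasCompactSupport f := η.hasCompactSupport.mul_right
  have hts : tsupport f ⊆ Metric.ball x₀ r := by
    refine (tsupport_mul_subset_left (f := η) (g := φ)).trans ?_
    rw [η.tsupport_eq]
    exact Metric.closedBall_subset_ball (by show r / 2 < r; linarith)
  set g : Space N → ℝ≥0∞ := Ω.indicator (fun x => ‖fderiv ℝ f x‖ₑ) with hg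
  have hgm : Measurable g :=
    ((hf.continuous_fderiv one_ne_zero).enorm.measurable).indicator hΩ.measurableSet
  -- The value at a graph point is controlled by the gradient along the vertical half-line above it,
  -- which lies in Ω within the ball.
  have hpt : ∀ y, ‖f (Gr y)‖ₑ ≤ ∫⁻ s, g (L (s, y)) := fun y => by
    have hder : ∀ s, HasDerivAt (fun s => f (L (s, y))) (fderiv ℝ f (L (s, y)) (-e)) s :=
      fun s => by
      have h1 : HasDerivAt (fun s : ℝ => L (s, y)) (-e) s := by
        simp_rw [hLa]
        simpa using ((hasDerivAt_id s).smul_const (-e)).add_const (ι y)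
      exact (hf.differentiable one_ne_zero _).hasFDerivAt.comp_hasDerivAt s h1
    have hC : ContDiff ℝ 1 (fun s => f (L (s, y))) := by
      simp_rw [hLa]
      fun_prop
    have hS : HasCompactSupport (fun s => f (L (s, y))) :=
      (hcs.comp_homeomorph L.toHomeomorph).comp_isClosedEmbedding 
        (.of_continuous_injective_isClosedMap (by fun_prop) (fun s t h => congrArg Prod.fst h)
          (isClosedMap_prodMk_right y))
    have h0 := hS.enorm_le_lintegral_Ici_deriv hC (-ψ (ι y))
    have e0 : L (-ψ (ι y), y) = Gr y := by
      rw [hLa, neg_smul_neg, add_comm]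
    simp only [e0] at h0
    -- The endpoint is on the graph and not in Ω, so it has to be left out before the pointwise
    -- comparison.
    rw [← setLIntegral_congr Iio_ae_eq_Iic] at h0
    refine h0.trans ((setLIntegral_mono' measurableSet_Iio fun s hs => ?_).trans
      (setLIntegral_le_lintegral _ _))
    rw [(hder s).deriv]
    by_cases hz : L (s, y) ∈ Metric.ball x₀ r
    · have hin : inner ℝ e (L (s, y)) = -s := by
        rw [hLa, inner_add_right, real_inner_smul_right, inner_neg_right, hee, hιe]
        ring
      have hzΩ : L (s, y) ∈ Ω ∩ Metric.ball x₀ r := by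
        rw [heq]
        refine ⟨hz, ?_⟩
        show ψ (L (s, y) - (inner ℝ e (L (s, y))) • e) < inner ℝ e (L (s, y))
        have : L (s, y) - (-s) • e = ι y := by rw [hLa]; module
        rw [hin, this]
        have : s < -ψ (ι y) := hs
        linarith
      rw [hg, Set.indicator_of_mem hzΩ.1]
      refine ((fderiv ℝ f _).le_opENorm (-e)).trans ?_
      rw [enorm_neg, ← ofReal_norm e, he, ENNReal.ofReal_one, mul_one]
    · have : fderiv ℝ f (L (s, y)) = 0 :=
        image_eq_zero_of_notMem_tsupport fun h => hz (hts (tsupport_fderiv_subset ℝ h))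
      simp [this]
  calc ∫⁻ x in Metric.ball x₀ (r / 4), ‖φ x‖ₑ ∂(surfaceMeasure Ω)
      = ∫⁻ x in Metric.ball x₀ (r / 4), ‖f x‖ₑ ∂(surfaceMeasure Ω) := by
        refine setLIntegral_congr_fun measurableSet_ball fun x hx => ?_
        show ‖φ x‖ₑ = ‖η x * φ x‖ₑ
        rw [η.one_of_mem_closedBall (Metric.ball_subset_closedBall hx), one_mul]
    _ ≤ ∫⁻ x in Metric.ball x₀ r, ‖f x‖ₑ ∂(surfaceMeasure Ω) :=
        lintegral_mono_set (Metric.ball_subset_ball (by linarith))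
    _ ≤ ∫⁻ x, ‖f x‖ₑ ∂(((KG : ℝ≥0∞) ^ (n : ℝ)) • Measure.map Gr volume) :=
        lintegral_mono' hle le_rfl
    _ = (KG : ℝ≥0∞) ^ (n : ℝ) * ∫⁻ y, ‖f (Gr y)‖ₑ := by
        rw [lintegral_smul_measure, lintegral_map hf.continuous.enorm.measurable
          hGr.continuous.measurable, smul_eq_mul]
    _ ≤ (KG : ℝ≥0∞) ^ (n : ℝ) * ∫⁻ y, ∫⁻ s, g (L (s, y)) := by
        gcongr with y
        exact hpt y
    _ = (KG : ℝ≥0∞) ^ (n : ℝ) * ∫⁻ z, g (L z) ∂(volume.prod volume) := by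
        rw [lintegral_prod_symm' (fun z => g (L z))
          (hgm.comp L.continuous.measurable)]
    _ = (KG : ℝ≥0∞) ^ (n : ℝ) * (c * ∫⁻ x in Ω, ‖fderiv ℝ f x‖ₑ) := by
        rw [hcL g hgm, hg, lintegral_indicator hΩ.measurableSet]
    _ ≤ (KG : ℝ≥0∞) ^ (n : ℝ) * (c * (C' * ((∫⁻ x in Ω, ‖φ x‖ₑ)
          + ∫⁻ x in Ω, ‖gradient φ x‖ₑ))) := by
        gcongr
        exact lintegral_enorm_fderiv_mul_le hη1 hφ hC1 hC2
    _ = _ := by rw [mul_assoc, mul_assoc]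

end Trace

/-! ### Zero gradient and null trace on Γd force the limit to vanish -/

section Constancy

variable {N : ℕ} {Ω : Set (Space N)}

theorem enorm_sub_le_lintegral_fderiv {φ : Space N → ℝ} (hφ : ContDiff ℝ 1 φ) (x h : Space N) :
    ‖φ (x + h) - φ x‖ₑ ≤ ‖h‖ₑ * ∫⁻ t in Set.Ioc (0 : ℝ) 1, ‖gradient φ (x + t • h)‖ₑ := by
  have hder : ∀ t, HasDerivAt (fun t : ℝ => φ (x + t • h)) (fderiv ℝ φ (x + t • h) h) t :=
    fun t => by
    have h1 : HasDerivAt (fun t : ℝ => x + t • h) h t := by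
      simpa using ((hasDerivAt_id t).smul_const h).const_add x
    exact (hφ.differentiable one_ne_zero _).hasFDerivAt.comp_hasDerivAt t h1
  have hc : Continuous fun t : ℝ => fderiv ℝ φ (x + t • h) h :=
    ((hφ.continuous_fderiv one_ne_zero).comp (by fun_prop)).clm_apply continuous_const
  have hftc := intervalIntegral.integral_eq_sub_of_hasDerivAt (a := 0) (b := 1)
    (fun t _ => hder t) (hc.intervalIntegrable _ _)
  rw [one_smul, zero_smul, add_zero, intervalIntegral.integral_of_le zero_le_one] at hftc
  rw [← hftc, ← lintegral_const_mul' _ _ enorm_ne_top]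
  refine (enorm_integral_le_lintegral_enorm _).trans (lintegral_mono fun t => ?_)
  refine ((fderiv ℝ φ _).le_opENorm h).trans_eq ?_
  have : ‖gradient φ (x + t • h)‖ₑ = ‖fderiv ℝ φ (x + t • h)‖ₑ := by
    rw [← ofReal_norm, norm_gradient, ofReal_norm]
  rw [mul_comm, this]

theorem lintegral_enorm_translate_sub_le (hΩ : MeasurableSet Ω) {φ : Space N → ℝ}
    (hφ : ContDiff ℝ 1 φ) {s : Set (Space N)} (hs : MeasurableSet s) {h : Space N}
    (hsub : ∀ x ∈ s, ∀ t ∈ Set.Ioc (0 : ℝ) 1, x + t • h ∈ Ω) :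
    ∫⁻ x in s, ‖φ (x + h) - φ x‖ₑ ≤ ‖h‖ₑ * ∫⁻ x in Ω, ‖gradient φ x‖ₑ := by
  have hgc : Continuous fun z : Space N × ℝ => ‖gradient φ (z.1 + z.2 • h)‖ₑ :=
    ((continuous_gradient hφ).comp (by fun_prop)).enorm
  calc ∫⁻ x in s, ‖φ (x + h) - φ x‖ₑ
      ≤ ∫⁻ x in s, ‖h‖ₑ * ∫⁻ t in Set.Ioc (0 : ℝ) 1, ‖gradient φ (x + t • h)‖ₑ :=
        lintegral_mono fun x => enorm_sub_le_lintegral_fderiv hφ x h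
    _ = ‖h‖ₑ * ∫⁻ t in Set.Ioc (0 : ℝ) 1, ∫⁻ x in s, ‖gradient φ (x + t • h)‖ₑ := by
        rw [lintegral_const_mul' _ _ enorm_ne_top, lintegral_lintegral_swap]
        exact hgc.measurable.aemeasurable
    _ ≤ ‖h‖ₑ * ∫⁻ _ in Set.Ioc (0 : ℝ) 1, ∫⁻ x in Ω, ‖gradient φ x‖ₑ := by
        refine mul_le_mul_right ?_ _
        refine setLIntegral_mono' measurableSet_Ioc fun t ht => ?_
        calc ∫⁻ x in s, ‖gradient φ (x + t • h)‖ₑ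
            ≤ ∫⁻ x in s, Ω.indicator (fun x => ‖gradient φ x‖ₑ) (x + t • h) := by
              refine setLIntegral_mono' hs fun x hx => ?_
              rw [Set.indicator_of_mem (hsub x hx t ht)]
          _ ≤ ∫⁻ x, Ω.indicator (fun x => ‖gradient φ x‖ₑ) (x + t • h) :=
              setLIntegral_le_lintegral _ _
          _ = ∫⁻ x in Ω, ‖gradient φ x‖ₑ := by
              rw [lintegral_add_right_eq_self (fun x => Ω.indicator (fun x => ‖gradient φ x‖ₑ) x),
                lintegral_indicator hΩ]
    _ = _ := by simp

/-- A limit in `L¹(Ω)` of functions whose gradients tend to zero is locally constant. -/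
theorem exists_ae_eq_const_ball (hΩ : IsOpen Ω) {φ : ℕ → Space N → ℝ}
    (hφ : ∀ j, ContDiff ℝ 1 (φ j)) {w : Space N → ℝ} (hw : Measurable w)
    (h1 : Tendsto (fun j => ∫⁻ x in Ω, ‖φ j x - w x‖ₑ) atTop (𝓝 0))
    (h2 : Tendsto (fun j => ∫⁻ x in Ω, ‖gradient (φ j) x‖ₑ) atTop (𝓝 0))
    {z : Space N} (hz : z ∈ Ω) :
    ∃ r > 0, ∃ c, ∀ᵐ x ∂(volume.restrict (Metric.ball z r)), w x = c := by
  obtain ⟨δ, hδ, hsub⟩ := Metric.isOpen_iff.1 hΩ z hz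
  set ρ := δ / 2 with hρdef
  have hρ : 0 < ρ := by positivity
  have hin : ∀ x ∈ Metric.ball z ρ, ∀ h ∈ Metric.ball (0 : Space N) ρ, ∀ t ∈ Set.Icc (0 : ℝ) 1,
      x + t • h ∈ Ω := fun x hx h hh t ht => by
    refine hsub ?_
    rw [Metric.mem_ball, dist_eq_norm] at hx ⊢
    rw [mem_ball_zero_iff] at hh
    calc ‖x + t • h - z‖ = ‖(x - z) + t • h‖ := by congr 1; abel
      _ ≤ ‖x - z‖ + ‖t • h‖ := norm_add_le _ _
      _ < ρ + ρ := by
          refine add_lt_add_of_lt_of_le hx ?_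
          rw [norm_smul, Real.norm_of_nonneg ht.1]
          calc t * ‖h‖ ≤ 1 * ‖h‖ := by gcongr; exact ht.2
            _ ≤ ρ := by rw [one_mul]; exact hh.le
      _ = δ := by rw [hρdef]; ring
  -- The translate of w is compared with w through φ_j: two L¹ errors that vanish, and the increment
  -- of φ_j, bounded by ‖h‖ times the L¹ norm of its gradient.
  have step1 : ∀ h ∈ Metric.ball (0 : Space N) ρ,
      ∀ᵐ x ∂(volume.restrict (Metric.ball z ρ)), w (x + h) = w x := by
    intro h hh
    have hle : ∀ j, ∫⁻ x in Metric.ball z ρ, ‖w (x + h) - w x‖ₑ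
        ≤ (∫⁻ x in Ω, ‖φ j x - w x‖ₑ) + ‖h‖ₑ * (∫⁻ x in Ω, ‖gradient (φ j) x‖ₑ)
          + ∫⁻ x in Ω, ‖φ j x - w x‖ₑ := by
      intro j
      have m1 : Measurable fun x => ‖φ j x - w x‖ₑ := ((hφ j).continuous.measurable.sub hw).enorm
      have t1 : ∫⁻ x in Metric.ball z ρ, ‖φ j (x + h) - w (x + h)‖ₑ
          ≤ ∫⁻ x in Ω, ‖φ j x - w x‖ₑ := by
        calc _ ≤ ∫⁻ x in Metric.ball z ρ, Ω.indicator (fun x => ‖φ j x - w x‖ₑ) (x + h) := by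
              refine setLIntegral_mono' measurableSet_ball fun x hx => ?_
              have := hin x hx h hh 1 (by simp)
              rw [one_smul] at this
              rw [Set.indicator_of_mem this]
          _ ≤ ∫⁻ x, Ω.indicator (fun x => ‖φ j x - w x‖ₑ) (x + h) :=
              setLIntegral_le_lintegral _ _
          _ = ∫⁻ x in Ω, ‖φ j x - w x‖ₑ := by
              rw [lintegral_add_right_eq_self (fun x => Ω.indicator (fun x => ‖φ j x - w x‖ₑ) x),
                lintegral_indicator hΩ.measurableSet]
      have t2 := lintegral_enorm_translate_sub_le hΩ.measurableSet (hφ j) measurableSet_ball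
        (fun x hx t ht => hin x hx h hh t ⟨ht.1.le, ht.2⟩)
      have t3 : ∫⁻ x in Metric.ball z ρ, ‖φ j x - w x‖ₑ ≤ ∫⁻ x in Ω, ‖φ j x - w x‖ₑ := by
        refine lintegral_mono_set fun x hx => ?_
        simpa using hin x hx h hh 0 (by simp)
      have m2 : Measurable fun x => ‖φ j (x + h) - w (x + h)‖ₑ :=
        m1.comp (measurable_add_const h)
      have m3 : Measurable fun x => ‖φ j (x + h) - φ j x‖ₑ :=
        (((hφ j).continuous.comp (continuous_add_const h)).sub (hφ j).continuous).enorm.measurable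
      refine le_trans ?_ (add_le_add (add_le_add t1 t2) t3)
      rw [← lintegral_add_left m2, ← lintegral_add_left (by exact m2.add m3)]
      refine lintegral_mono fun x => ?_
      have e : w (x + h) - w x
          = -(φ j (x + h) - w (x + h)) + (φ j (x + h) - φ j x) + (φ j x - w x) := by ring
      rw [e]
      refine (enorm_add_le _ _).trans ?_
      gcongr
      refine (enorm_add_le _ _).trans ?_
      rw [enorm_neg]
    have hlim : Tendsto (fun j => (∫⁻ x in Ω, ‖φ j x - w x‖ₑ)
        + ‖h‖ₑ * (∫⁻ x in Ω, ‖gradient (φ j) x‖ₑ) + ∫⁻ x in Ω, ‖φ j x - w x‖ₑ) atTop (𝓝 0) := by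
      have := (h1.add (ENNReal.Tendsto.const_mul (a := ‖h‖ₑ) h2 (Or.inr enorm_ne_top))).add h1
      simpa using this
    have h0 : ∫⁻ x in Metric.ball z ρ, ‖w (x + h) - w x‖ₑ = 0 :=
      le_antisymm (ge_of_tendsto' hlim hle) zero_le
    rw [lintegral_eq_zero_iff (by exact ((hw.comp (measurable_add_const h)).sub hw).enorm)] at h0
    filter_upwards [h0] with x hx
    simpa [sub_eq_zero] using hx
  have step2 : ∀ᵐ h ∂(volume.restrict (Metric.ball (0 : Space N) ρ)),
      ∀ᵐ x ∂(volume.restrict (Metric.ball z ρ)), w (x + h) = w x :=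
    (ae_restrict_iff' measurableSet_ball).2 (.of_forall step1)
  have hmeas : MeasurableSet {p : Space N × Space N | w (p.2 + p.1) = w p.2} :=
    measurableSet_eq_fun (hw.comp (measurable_snd.add measurable_fst)) (hw.comp measurable_snd)
  -- Fubini exchanges the quantifiers, so one point x can be fixed with w(x + h) = w(x) for almost
  -- every small h.
  have step3 := (Measure.ae_ae_comm hmeas).1 step2
  -- The radius is halved so that the difference of two points of the smaller ball is an admissible
  -- translation h.
  have step4 : ∀ᵐ x ∂(volume.restrict (Metric.ball z (ρ / 2))),
      ∀ᵐ h ∂(volume.restrict (Metric.ball (0 : Space N) ρ)), w (x + h) = w x :=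
    ae_restrict_of_ae_restrict_of_subset (Metric.ball_subset_ball (by linarith)) step3
  have hne : NeBot (ae (volume.restrict (Metric.ball z (ρ / 2)))) := by
    rw [ae_neBot, Ne, Measure.restrict_eq_zero]
    exact (Metric.measure_ball_pos _ _ (by positivity)).ne'
  obtain ⟨x, hx, hxb⟩ := (step4.and (ae_restrict_mem measurableSet_ball)).exists
  refine ⟨ρ / 2, by positivity, w x, ?_⟩
  have hq := ((measurePreserving_add_left (volume : Measure (Space N)) (-x)).quasiMeasurePreserving)
  rw [ae_restrict_iff' measurableSet_ball] at hx ⊢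
  filter_upwards [hq.ae hx] with y hy hyb
  have : -x + y ∈ Metric.ball (0 : Space N) ρ := by
    rw [mem_ball_zero_iff]
    rw [Metric.mem_ball] at hxb hyb
    calc ‖-x + y‖ = dist y x := by rw [dist_eq_norm]; congr 1; abel
      _ ≤ dist y z + dist x z := dist_triangle_right _ _ _
      _ < ρ / 2 + ρ / 2 := add_lt_add hyb hxb
      _ = ρ := by ring
  simpa using hy this

/-- Two overlapping balls meet in a set of positive measure, so their constants agree; the constant
is then a locally constant function on the connected set Ω. -/
theorem exists_ae_eq_const (hΩ : IsOpen Ω) (hconn : IsConnected Ω) {φ : ℕ → Space N → ℝ}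
    (hφ : ∀ j, ContDiff ℝ 1 (φ j)) {w : Space N → ℝ}
    (hw : AEMeasurable w (volume.restrict Ω))
    (h1 : Tendsto (fun j => ∫⁻ x in Ω, ‖φ j x - w x‖ₑ) atTop (𝓝 0))
    (h2 : Tendsto (fun j => ∫⁻ x in Ω, ‖gradient (φ j) x‖ₑ) atTop (𝓝 0)) :
    ∃ c, ∀ᵐ x ∂(volume.restrict Ω), w x = c := by
  have h1' : Tendsto (fun j => ∫⁻ x in Ω, ‖φ j x - hw.mk w x‖ₑ) atTop (𝓝 0) := by
    refine h1.congr fun j => lintegral_congr_ae ?_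
    filter_upwards [hw.ae_eq_mk] with x hx
    rw [hx]
  have hloc : ∀ z : Ω, ∃ r > 0, ∃ c, ∀ᵐ x ∂(volume.restrict (Metric.ball (z : Space N) r)),
      hw.mk w x = c := fun z => exists_ae_eq_const_ball hΩ hφ hw.measurable_mk h1' h2 z.2
  choose r hr c hc using hloc
  have hcl : IsLocallyConstant c := by
    rw [IsLocallyConstant.iff_eventually_eq]
    intro z
    have : ∀ᶠ y : Ω in 𝓝 z, (y : Space N) ∈ Metric.ball (z : Space N) (r z) :=
      continuous_subtype_val.continuousAt.eventually (Metric.ball_mem_nhds _ (hr z))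
    filter_upwards [this] with y hy
    have hne : (volume.restrict (Metric.ball (z : Space N) (r z) ∩ Metric.ball (y : Space N) (r y)))
        ≠ 0 := by
      rw [Ne, Measure.restrict_eq_zero]
      exact ((Metric.isOpen_ball.inter Metric.isOpen_ball).measure_pos volume
        ⟨(y : Space N), hy, Metric.mem_ball_self (hr y)⟩).ne'
    have := ae_neBot.2 hne
    have a1 := ae_restrict_of_ae_restrict_of_subset
      (Set.inter_subset_left (t := Metric.ball (y : Space N) (r y))) (hc z)
    have a2 := ae_restrict_of_ae_restrict_of_subset
      (Set.inter_subset_right (s := Metric.ball (z : Space N) (r z))) (hc y)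
    obtain ⟨x, hx1, hx2⟩ := (a1.and a2).exists
    exact hx2.symm.trans hx1
  have : PreconnectedSpace Ω := isPreconnected_iff_preconnectedSpace.1 hconn.isPreconnected
  obtain ⟨z₀, hz₀⟩ := hconn.nonempty
  have hall : ∀ z : Ω, c z = c ⟨z₀, hz₀⟩ := fun z => hcl.apply_eq_of_preconnectedSpace _ _
  refine ⟨c ⟨z₀, hz₀⟩, ?_⟩
  have hmk : ∀ᵐ x ∂(volume.restrict Ω), hw.mk w x = c ⟨z₀, hz₀⟩ := by
    rw [ae_restrict_iff' hΩ.measurableSet, ae_iff]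
    refine measure_null_of_locally_null _ fun x hx => ?_
    have hxΩ : x ∈ Ω := by
      by_contra hcon
      exact hx fun h => absurd h hcon
    refine ⟨Metric.ball x (r ⟨x, hxΩ⟩) ∩ {y | ¬(y ∈ Ω → hw.mk w y = c ⟨z₀, hz₀⟩)},
      inter_mem (mem_nhdsWithin_of_mem_nhds (Metric.ball_mem_nhds _ (hr _))) self_mem_nhdsWithin, ?_⟩
    have := hc ⟨x, hxΩ⟩
    rw [hall, ae_restrict_iff' measurableSet_ball, ae_iff] at this
    refine measure_mono_null ?_ this
    rintro y ⟨hy1, hy2⟩ hcon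
    exact hy2 fun _ => hcon hy1
  filter_upwards [hmk, hw.ae_eq_mk] with x hx hx'
  rw [hx', hx]

/-- If `C¹` functions tend to `w` in `W^{1,1}(Ω)`, `w` has zero gradient, and their restrictions
tend to zero on a part of the boundary of positive measure, then `w = 0`. -/
theorem ae_eq_zero_of_tendsto_trace {Γn Γd : Set (Space N)} (hΩ : IsAdmissibleDomain Ω Γn Γd)
    {φ : ℕ → Space N → ℝ} (hφ : ∀ j, ContDiff ℝ 1 (φ j)) {w : Space N → ℝ}
    (hw : AEMeasurable w (volume.restrict Ω))
    (h1 : Tendsto (fun j => ∫⁻ x in Ω, ‖φ j x - w x‖ₑ) atTop (𝓝 0))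
    (h2 : Tendsto (fun j => ∫⁻ x in Ω, ‖gradient (φ j) x‖ₑ) atTop (𝓝 0))
    (h3 : ∀ A : Set (Space N), MeasurableSet A → surfaceMeasure Ω A ≠ ⊤ →
      Tendsto (fun j => ∫⁻ x in Γd ∩ A, ‖φ j x‖ₑ ∂(surfaceMeasure Ω)) atTop (𝓝 0)) :
    ∀ᵐ x ∂(volume.restrict Ω), w x = 0 := by
  obtain ⟨c, hc⟩ := exists_ae_eq_const hΩ.isOpen hΩ.isConnected hφ hw h1 h2
  suffices c = 0 by simpa [this] using hc
  -- A point of Γd all of whose neighbourhoods in Γd have positive surface measure; only the trace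
  -- inequality near this point is needed.
  obtain ⟨x₀, hx₀, hpos⟩ := exists_mem_forall_mem_nhdsWithin_pos_measure hΩ.dirichlet_pos.ne'
  have hx₀f : x₀ ∈ frontier Ω := hΩ.union_eq ▸ Set.mem_union_right _ hx₀
  obtain ⟨r, hr, C, hC, htr⟩ := exists_local_trace hΩ.isOpen hΩ.lipschitz_boundary hx₀f
  have hfin : IsFiniteMeasure (volume.restrict Ω) := isFiniteMeasure_restrict hΩ.isBounded
  -- The trace inequality for the constant 1 shows that this piece of boundary has finite measure.
  have hball : surfaceMeasure Ω (Metric.ball x₀ r) ≠ ⊤ := by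
    have := htr (fun _ => 1) contDiff_const
    refine ne_top_of_le_ne_top ?_ (le_trans (by simp) this)
    have h0 : gradient (fun _ : Space N => (1 : ℝ)) = 0 := by ext x; simp [gradient]
    rw [h0]
    refine ENNReal.mul_ne_top hC ?_
    simpa using measure_ne_top (volume.restrict Ω) Set.univ
  have hb : Tendsto (fun j => ∫⁻ x in Metric.ball x₀ r, ‖φ j x - c‖ₑ ∂(surfaceMeasure Ω)) atTop
      (𝓝 0) := by
    have hlim := ENNReal.Tendsto.const_mul (a := C) (h1.add h2) (Or.inr hC)
    rw [add_zero, mul_zero] at hlim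
    refine tendsto_of_tendsto_of_tendsto_of_le_of_le tendsto_const_nhds hlim
      (fun _ => zero_le) fun j => ?_
    refine (htr (fun x => φ j x - c) ((hφ j).sub contDiff_const)).trans (le_of_eq ?_)
    congr 2
    · refine lintegral_congr_ae ?_
      filter_upwards [hc] with x hx
      rw [hx]
    · refine lintegral_congr fun x => ?_
      congr 1
      simp [gradient, fderiv_sub_const]
  have hsum := hb.add (h3 _ measurableSet_ball hball)
  rw [add_zero] at hsum
  -- On Γd near x₀ the approximants tend both to c and to 0 in L¹.
  have hle : ∀ j, ‖c‖ₑ * surfaceMeasure Ω (Γd ∩ Metric.ball x₀ r)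
      ≤ (∫⁻ x in Metric.ball x₀ r, ‖φ j x - c‖ₑ ∂(surfaceMeasure Ω))
        + ∫⁻ x in Γd ∩ Metric.ball x₀ r, ‖φ j x‖ₑ ∂(surfaceMeasure Ω) := fun j => by
    calc ‖c‖ₑ * surfaceMeasure Ω (Γd ∩ Metric.ball x₀ r)
        = ∫⁻ _ in Γd ∩ Metric.ball x₀ r, ‖c‖ₑ ∂(surfaceMeasure Ω) := by simp
      _ ≤ ∫⁻ x in Γd ∩ Metric.ball x₀ r, (‖φ j x - c‖ₑ + ‖φ j x‖ₑ) ∂(surfaceMeasure Ω) := by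
          refine lintegral_mono fun x => ?_
          have : c = -(φ j x - c) + φ j x := by ring
          conv_lhs => rw [this]
          refine (enorm_add_le _ _).trans ?_
          rw [enorm_neg]
      _ = (∫⁻ x in Γd ∩ Metric.ball x₀ r, ‖φ j x - c‖ₑ ∂(surfaceMeasure Ω))
          + ∫⁻ x in Γd ∩ Metric.ball x₀ r, ‖φ j x‖ₑ ∂(surfaceMeasure Ω) :=
          lintegral_add_left ((hφ j).continuous.sub continuous_const).enorm.measurable _
      _ ≤ _ := by
          gcongr
          exact Set.inter_subset_right
  have hzero : ‖c‖ₑ * surfaceMeasure Ω (Γd ∩ Metric.ball x₀ r) = 0 :=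
    le_antisymm (ge_of_tendsto' hsum hle) zero_le
  have hp := hpos _ (inter_mem_nhdsWithin Γd (Metric.ball_mem_nhds x₀ hr))
  simpa [hp.ne'] using hzero

end Constancy

/-! ### Smooth cutoffs and a smooth sign function -/

section Cutoff

/-- A smooth cutoff function: `1` on `[-1, 1]` and `0` off `(-2, 2)`. -/
noncomputable def cutoff : ContDiffBump (0 : ℝ) := ⟨1, 2, one_pos, one_lt_two⟩

/-- A smooth bump function supported in `[-1, 1]`. -/
noncomputable def bump : ContDiffBump (0 : ℝ) := ⟨1 / 2, 1, by norm_num, by norm_num⟩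

/-- A smooth nondecreasing bounded function with derivative `bump`. -/
noncomputable def smoothSign (s : ℝ) : ℝ := ∫ t in (0 : ℝ)..s, bump t

theorem cutoff_contDiff {n : ℕ∞} : ContDiff ℝ n cutoff := cutoff.contDiff

theorem cutoff_nonneg (s : ℝ) : 0 ≤ cutoff s := cutoff.nonneg

theorem cutoff_le_one (s : ℝ) : cutoff s ≤ 1 := cutoff.le_one

theorem cutoff_eq_one {s : ℝ} (hs : |s| ≤ 1) : cutoff s = 1 :=
  cutoff.one_of_mem_closedBall (by simpa [cutoff] using hs)

theorem cutoff_eq_zero {s : ℝ} (hs : 2 ≤ |s|) : cutoff s = 0 :=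
  cutoff.zero_of_le_dist (by simpa [cutoff] using hs)

theorem continuous_deriv_cutoff : Continuous (deriv cutoff) :=
  (cutoff_contDiff (n := 1)).continuous_deriv le_rfl

theorem exists_deriv_cutoff_bound : ∃ C : ℝ, 0 < C ∧ ∀ s, |deriv cutoff s| ≤ C := by
  have h : HasCompactSupport (deriv cutoff) := cutoff.hasCompactSupport.deriv
  obtain ⟨C, hC⟩ := h.exists_bound_of_continuous continuous_deriv_cutoff
  exact ⟨max C 1, by positivity, fun s => (hC s).trans (le_max_left _ _)⟩

theorem deriv_cutoff_eq_zero_of_lt {s : ℝ} (hs : |s| < 1) : deriv cutoff s = 0 := by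
  have : cutoff =ᶠ[𝓝 s] fun _ => (1 : ℝ) := by
    filter_upwards [(isOpen_lt continuous_abs continuous_const).mem_nhds hs] with t ht
    exact cutoff_eq_one (le_of_lt ht)
  rw [this.deriv_eq, deriv_const]

theorem deriv_cutoff_eq_zero_of_le {s : ℝ} (hs : 2 ≤ |s|) : deriv cutoff s = 0 := by
  refine IsLocalMin.deriv_eq_zero (.of_forall fun t => ?_)
  rw [cutoff_eq_zero hs]
  exact cutoff_nonneg t

theorem hasDerivAt_cutoff (s : ℝ) : HasDerivAt cutoff (deriv cutoff s) s :=
  ((cutoff_contDiff (n := 1)).differentiable one_ne_zero s).hasDerivAt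

theorem hasDerivAt_cutoff_div {m : ℝ} (s : ℝ) :
    HasDerivAt (fun s => cutoff (s / m)) (deriv cutoff (s / m) / m) s := by
  simpa [div_eq_mul_inv, Function.comp_def] using
    (hasDerivAt_cutoff (s / m)).comp s ((hasDerivAt_id s).div_const m)

theorem abs_cutoff_sub_le {C : ℝ} (hC : ∀ s, |deriv cutoff s| ≤ C) {m : ℝ} (hm : 0 < m)
    (s t : ℝ) : |cutoff (s / m) - cutoff (t / m)| ≤ C / m * |s - t| := by
  have := Convex.norm_image_sub_le_of_norm_hasDerivWithin_le (f := fun s => cutoff (s / m))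
    (f' := fun s => deriv cutoff (s / m) / m) (s := Set.univ) (C := C / m)
    (fun x _ => (hasDerivAt_cutoff_div x).hasDerivWithinAt) (fun x _ => by
      rw [norm_div, Real.norm_of_nonneg hm.le]
      gcongr
      exact hC _) convex_univ (Set.mem_univ t) (Set.mem_univ s)
  simpa using this

theorem bump_nonneg (s : ℝ) : 0 ≤ bump s := bump.nonneg

theorem bump_le_one (s : ℝ) : bump s ≤ 1 := bump.le_one

theorem bump_eq_zero {s : ℝ} (hs : 1 ≤ |s|) : bump s = 0 :=
  bump.zero_of_le_dist (by simpa [bump] using hs)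

theorem hasDerivAt_smoothSign (s : ℝ) : HasDerivAt smoothSign (bump s) s :=
  intervalIntegral.integral_hasDerivAt_right (bump.continuous.intervalIntegrable _ _)
    (bump.continuous.stronglyMeasurableAtFilter _ _) bump.continuous.continuousAt

theorem continuous_smoothSign : Continuous smoothSign :=
  continuous_iff_continuousAt.2 fun s => (hasDerivAt_smoothSign s).continuousAt

theorem smoothSign_zero : smoothSign 0 = 0 := by simp [smoothSign]

theorem monotone_smoothSign : Monotone smoothSign :=
  monotone_of_deriv_nonneg (fun s => (hasDerivAt_smoothSign s).differentiableAt) fun s => by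
    rw [(hasDerivAt_smoothSign s).deriv]
    exact bump_nonneg s

theorem smoothSign_of_one_le {s : ℝ} (hs : 1 ≤ s) : smoothSign s = smoothSign 1 := by
  have h : ∫ t in (1 : ℝ)..s, bump t = 0 := by
    refine intervalIntegral.integral_zero_ae (.of_forall fun t ht => ?_)
    rw [Set.uIoc_of_le hs] at ht
    exact bump_eq_zero (ht.1.le.trans (le_abs_self t))
  have := intervalIntegral.integral_add_adjacent_intervals
    (bump.continuous.intervalIntegrable (μ := volume) 0 1)
    (bump.continuous.intervalIntegrable (μ := volume) 1 s)
  rw [h, add_zero] at this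
  exact this.symm

theorem smoothSign_of_le_neg_one {s : ℝ} (hs : s ≤ -1) : smoothSign s = smoothSign (-1) := by
  have h : ∫ t in (-1 : ℝ)..s, bump t = 0 := by
    refine intervalIntegral.integral_zero_ae (.of_forall fun t ht => ?_)
    rw [Set.uIoc_of_ge hs] at ht
    exact bump_eq_zero (by rw [le_abs]; right; linarith [ht.2])
  have := intervalIntegral.integral_add_adjacent_intervals
    (bump.continuous.intervalIntegrable (μ := volume) 0 (-1))
    (bump.continuous.intervalIntegrable (μ := volume) (-1) s)
  rw [h, add_zero] at this
  exact this.symm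

theorem smoothSign_one_pos : 0 < smoothSign 1 := by
  refine intervalIntegral.intervalIntegral_pos_of_pos_on
    (bump.continuous.intervalIntegrable _ _) (fun t ht => bump.pos_of_mem_ball ?_) one_pos
  simp only [bump, mem_ball_zero_iff, Real.norm_eq_abs, abs_lt]
  exact ⟨by linarith [ht.1], ht.2⟩

theorem smoothSign_neg_one_neg : smoothSign (-1) < 0 := by
  rw [smoothSign, intervalIntegral.integral_symm, neg_lt_zero]
  refine intervalIntegral.intervalIntegral_pos_of_pos_on
    (bump.continuous.intervalIntegrable _ _) (fun t ht => bump.pos_of_mem_ball ?_) (by norm_num)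
  simp only [bump, mem_ball_zero_iff, Real.norm_eq_abs, abs_lt]
  exact ⟨ht.1, by linarith [ht.2]⟩

theorem abs_smoothSign_le (s : ℝ) : |smoothSign s| ≤ 1 := by
  have hb : ∀ s : ℝ, |s| = 1 → |smoothSign s| ≤ 1 := fun s hs => by
    have := intervalIntegral.norm_integral_le_of_norm_le_const (f := bump) (a := 0) (b := s)
      (C := 1) (fun t _ => by rw [Real.norm_of_nonneg (bump_nonneg t)]; exact bump_le_one t)
    simpa [hs, smoothSign] using this
  have h1 := abs_le.1 (hb 1 (by simp))
  have h2 := abs_le.1 (hb (-1) (by simp))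
  refine abs_le.2 ⟨?_, ?_⟩
  · rcases le_total s (-1) with h | h
    · rw [smoothSign_of_le_neg_one h]; exact h2.1
    · exact h2.1.trans (monotone_smoothSign h)
  · rcases le_total 1 s with h | h
    · rw [smoothSign_of_one_le h]; exact h1.2
    · exact (monotone_smoothSign h).trans h1.2

/-- The limit of `smoothSign (s / k)` as `k → 0+`. -/
noncomputable def limitSign (s : ℝ) : ℝ :=
  if 0 < s then smoothSign 1 else if s < 0 then smoothSign (-1) else 0

theorem limitSign_eq_zero_iff {s : ℝ} : limitSign s = 0 ↔ s = 0 := by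
  have h1 := smoothSign_one_pos
  have h2 := smoothSign_neg_one_neg
  unfold limitSign
  split_ifs with h h'
  · exact ⟨fun h0 => absurd h0 h1.ne', fun h0 => absurd h0 h.ne'⟩
  · exact ⟨fun h0 => absurd h0 h2.ne, fun h0 => absurd h0 h'.ne⟩
  · exact ⟨fun _ => le_antisymm (not_lt.1 h) (not_lt.1 h'), fun _ => rfl⟩

theorem measurable_limitSign : Measurable limitSign :=
  Measurable.ite measurableSet_Ioi measurable_const
    (Measurable.ite measurableSet_Iio measurable_const measurable_const)

/-- For each fixed s the limit k → 0 is attained as soon as k ≤ |s|, so pointwise convergence is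
eventual equality. -/
theorem smoothSign_div_eq_limitSign {s k : ℝ} (hk : 0 < k) (h : s = 0 ∨ k ≤ |s|) :
    smoothSign (s / k) = limitSign s := by
  rcases h with rfl | h
  · simp [limitSign, smoothSign_zero]
  · rcases le_or_gt s 0 with hs | hs
    · have hs' : s < 0 := lt_of_le_of_ne hs (by rintro rfl; simp at h; linarith)
      rw [abs_of_neg hs'] at h
      have : s / k ≤ -1 := by rw [div_le_iff₀ hk]; linarith
      simp [limitSign, hs', hs.not_gt, smoothSign_of_le_neg_one this]
    · rw [abs_of_pos hs] at h
      have : 1 ≤ s / k := by rw [le_div_iff₀ hk]; linarith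
      simp [limitSign, hs, smoothSign_of_one_le this]

end Cutoff

/-! ### Decay from a recursion, and weighted mean inequalities -/

section RealInequalities

/-- A superlinear recursion along doublings forces polynomial decay. -/
theorem exists_decay_of_recursion {M : ℝ → ℝ} (hM : Antitone M) (hM0 : ∀ t, 0 ≤ M t)
    {K θ m₀ : ℝ} (hK : 0 ≤ K) (hθ0 : 0 < θ) (hθ1 : θ < 1) (hm₀ : 1 ≤ m₀)
    (hrec : ∀ m, m₀ ≤ m → M (2 * m) ≤ K * (M m / m) ^ θ) :
    ∃ A, 0 ≤ A ∧ ∀ t, 1 ≤ t → M t ≤ A * t ^ (-(θ / (1 - θ))) := by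
  -- The exponent for which t^(-q) is invariant under the recursion: q = θ(1 + q).
  set q := θ / (1 - θ) with hq
  have h1θ : 0 < 1 - θ := by linarith
  have hq0 : 0 < q := by positivity
  have hfix : θ * (1 + q) = q := by rw [hq]; field_simp; ring
  have hm0 : 0 < m₀ := by linarith
  -- The first entry starts the induction at m₀; the second gives K 2^q A^θ ≤ A, which makes the
  -- bound pass from m to 2m.
  set A := max (M 0 * m₀ ^ q) ((K * 2 ^ q) ^ (1 / (1 - θ))) with hA
  have hA0 : 0 ≤ A := le_max_of_le_left (mul_nonneg (hM0 0) (by positivity))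
  have hAK : K * 2 ^ q * A ^ θ ≤ A := by
    have h1 : K * 2 ^ q ≤ A ^ (1 - θ) := by
      calc K * 2 ^ q = ((K * 2 ^ q) ^ (1 / (1 - θ))) ^ (1 - θ) := by
            rw [← Real.rpow_mul (by positivity), one_div_mul_cancel h1θ.ne', Real.rpow_one]
        _ ≤ A ^ (1 - θ) := Real.rpow_le_rpow (by positivity) (le_max_right _ _) h1θ.le
    calc K * 2 ^ q * A ^ θ ≤ A ^ (1 - θ) * A ^ θ := by gcongr
      _ = A := by
          rcases hA0.eq_or_lt with h | h
          · rw [← h, Real.zero_rpow hθ0.ne', mul_zero]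
          · rw [← Real.rpow_add h]; simp
  have hdy : ∀ j : ℕ, M (m₀ * 2 ^ j) ≤ A * (m₀ * 2 ^ j) ^ (-q) := by
    intro j
    induction j with
    | zero =>
      simp only [pow_zero, mul_one]
      calc M m₀ ≤ M 0 := hM hm0.le
        _ = M 0 * m₀ ^ q * m₀ ^ (-q) := by
            rw [mul_assoc, ← Real.rpow_add hm0]; simp
        _ ≤ A * m₀ ^ (-q) := by gcongr; exact le_max_left _ _
    | succ j ih =>
      set m := m₀ * 2 ^ j with hm
      have hmm : m₀ ≤ m := le_mul_of_one_le_right hm0.le (one_le_pow₀ one_le_two)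
      have hmp : 0 < m := hm0.trans_le hmm
      have e : m₀ * 2 ^ (j + 1) = 2 * m := by rw [hm]; ring
      rw [e]
      calc M (2 * m) ≤ K * (M m / m) ^ θ := hrec m hmm
        _ ≤ K * (A * m ^ (-q) / m) ^ θ := by
            have := hM0 m
            gcongr
        _ = K * 2 ^ q * A ^ θ * (2 * m) ^ (-q) := by
            have e1 : A * m ^ (-q) / m = A * m ^ (-(1 + q)) := by
              rw [mul_div_assoc, neg_add, add_comm, Real.rpow_add hmp, Real.rpow_neg_one,
                div_eq_mul_inv]
            rw [e1, Real.mul_rpow hA0 (by positivity), ← Real.rpow_mul hmp.le, neg_mul,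
              mul_comm (1 + q) θ, hfix, Real.mul_rpow two_pos.le hmp.le,
              Real.rpow_neg two_pos.le]
            field_simp
        _ ≤ A * (2 * m) ^ (-q) := by gcongr
  refine ⟨A * (2 * m₀) ^ q, by positivity, fun t ht => ?_⟩
  have ht0 : 0 < t := by linarith
  rcases lt_or_ge t m₀ with h | h
  · calc M t ≤ M 0 := hM ht0.le
      _ = M 0 * m₀ ^ q * m₀ ^ (-q) := by rw [mul_assoc, ← Real.rpow_add hm0]; simp
      _ ≤ A * m₀ ^ (-q) := by gcongr; exact le_max_left _ _
      _ ≤ A * t ^ (-q) := by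
          gcongr A * ?_
          exact Real.rpow_le_rpow_of_nonpos ht0 h.le (by linarith)
      _ ≤ A * (2 * m₀) ^ q * t ^ (-q) := by
          gcongr
          exact le_mul_of_one_le_right hA0 (Real.one_le_rpow (by linarith) hq0.le)
  · obtain ⟨j, hj1, hj2⟩ := exists_nat_pow_near (x := t / m₀) (y := (2 : ℝ))
      ((one_le_div hm0).2 h) one_lt_two
    rw [le_div_iff₀ hm0] at hj1
    rw [div_lt_iff₀ hm0] at hj2
    have hmp : 0 < m₀ * 2 ^ j := by positivity
    calc M t ≤ M (m₀ * 2 ^ j) := hM (by linarith)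
      _ ≤ A * (m₀ * 2 ^ j) ^ (-q) := hdy j
      _ = A * 2 ^ q * (2 * (m₀ * 2 ^ j)) ^ (-q) := by
          rw [Real.mul_rpow two_pos.le hmp.le, Real.rpow_neg two_pos.le]
          field_simp
      _ ≤ A * 2 ^ q * t ^ (-q) := by
          gcongr A * 2 ^ q * ?_
          refine Real.rpow_le_rpow_of_nonpos ht0 ?_ (by linarith)
          rw [pow_succ] at hj2
          linarith
      _ ≤ A * (2 * m₀) ^ q * t ^ (-q) := by
          gcongr
          linarith

variable {N p : ℝ}

/-- Weighted arithmetic–geometric mean with weights 1/p, (p-1)/N, (p-1)(N-p)/(pN), which sum to 1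
and match g^p, b^(N/(p-1)) and the reciprocal of the decay rate of the level sets. The powers of Λ
cancel in the product; Λ is later taken large to make the last term small. -/
theorem convection_le (hp1 : 1 < p) (hpN : p < N) {b g n Λ : ℝ} (hb : 0 ≤ b) (hg : 0 ≤ g)
    (hn : 0 < n) (hΛ : 0 < Λ) :
    n ^ (p - 1) * b * g ≤ n * (Λ * (g ^ p / n) + b ^ (N / (p - 1))
      + Λ ^ (-(N / ((p - 1) * (N - p)))) * n ^ (N * (p - 1) / (N - p))) := by
  have hp0 : 0 < p := by linarith
  have hN0 : 0 < N := by linarith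
  have hq1 : 0 < p - 1 := by linarith
  have hNp : 0 < N - p := by linarith
  have hw2 : 0 ≤ (p - 1) / N := by positivity
  have hw3 : 0 ≤ (p - 1) * (N - p) / (p * N) := by positivity
  have key := Real.geom_mean_le_arith_mean3_weighted (w₁ := 1 / p) (w₂ := (p - 1) / N)
    (w₃ := (p - 1) * (N - p) / (p * N)) (p₁ := Λ * (g ^ p / n)) (p₂ := b ^ (N / (p - 1)))
    (p₃ := Λ ^ (-(N / ((p - 1) * (N - p)))) * n ^ (N * (p - 1) / (N - p)))
    (by positivity) hw2 hw3 (by positivity) (by positivity) (by positivity) (by field_simp; ring)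
  have e1 : (Λ * (g ^ p / n)) ^ (1 / p) = Λ ^ (1 / p) * (g * n ^ (-(1 / p))) := by
    rw [Real.mul_rpow hΛ.le (by positivity), Real.div_rpow (by positivity) hn.le,
      ← Real.rpow_mul hg, mul_one_div_cancel hp0.ne', Real.rpow_one, Real.rpow_neg hn.le, ← div_eq_mul_inv]
  have e2 : (b ^ (N / (p - 1))) ^ ((p - 1) / N) = b := by
    rw [← Real.rpow_mul hb]
    have : N / (p - 1) * ((p - 1) / N) = 1 := by field_simp
    rw [this, Real.rpow_one]
  have e3 : (Λ ^ (-(N / ((p - 1) * (N - p)))) * n ^ (N * (p - 1) / (N - p)))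
      ^ ((p - 1) * (N - p) / (p * N)) = Λ ^ (-(1 / p)) * n ^ ((p - 1) ^ 2 / p) := by
    rw [Real.mul_rpow (by positivity) (by positivity), ← Real.rpow_mul hΛ.le,
      ← Real.rpow_mul hn.le]
    congr 2 <;> field_simp
  rw [e1, e2, e3] at key
  have e4 : n ^ (p - 1) * b * g = n * (Λ ^ (1 / p) * (g * n ^ (-(1 / p))) * b
      * (Λ ^ (-(1 / p)) * n ^ ((p - 1) ^ 2 / p))) := by
    have h1 : Λ ^ (1 / p) * Λ ^ (-(1 / p)) = 1 := by rw [← Real.rpow_add hΛ]; simp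
    have h2 : n ^ (p - 1) = n * n ^ (-(1 / p)) * n ^ ((p - 1) ^ 2 / p) := by
      nth_rw 2 [← Real.rpow_one n]
      rw [← Real.rpow_add hn, ← Real.rpow_add hn]
      congr 1
      field_simp
      ring
    rw [h2]
    linear_combination (-(n * n ^ (-(1 / p)) * n ^ ((p - 1) ^ 2 / p) * b * g)) * h1
  rw [e4]
  refine mul_le_mul_of_nonneg_left (key.trans ?_) hn.le
  have hl1 : 1 / p ≤ 1 := by rw [div_le_one hp0]; exact hp1.le
  have hl2 : (p - 1) / N ≤ 1 := by rw [div_le_one hN0]; linarith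
  have hl3 : (p - 1) * (N - p) / (p * N) ≤ 1 := by
    rw [div_le_one (by positivity)]
    nlinarith
  have n1 : 0 ≤ Λ * (g ^ p / n) := by positivity
  have n2 : 0 ≤ b ^ (N / (p - 1)) := by positivity
  have n3 : 0 ≤ Λ ^ (-(N / ((p - 1) * (N - p)))) * n ^ (N * (p - 1) / (N - p)) := by positivity
  exact add_le_add (add_le_add (mul_le_of_le_one_left n1 hl1) (mul_le_of_le_one_left n2 hl2))
    (mul_le_of_le_one_left n3 hl3)

/-- The same device with weights (2-p)/p, 2(p-1)/N, 2(p-1)(N-p)/(pN). The power of m left over is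
-(2p - 3 - 2γ), which is negative exactly when γ < p - 3/2; p ≤ 2 makes the first weight
nonnegative. -/
theorem weight_le (hp1 : 1 < p) (hp2 : p ≤ 2) (hpN : p < N) (hN : 2 ≤ N) {b g m γ : ℝ}
    (hb : 0 ≤ b) (hg : 0 ≤ g) (hm : 0 < m) :
    b ^ 2 * m ^ (2 * γ) * g ^ (2 - p) ≤ m ^ (-(2 * p - 3 - 2 * γ)) * (g ^ p / m
      + b ^ (N / (p - 1)) + m ^ (N * (p - 1) / (N - p))) := by
  have hp0 : 0 < p := by linarith
  have hN0 : 0 < N := by linarith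
  have hq1 : 0 < p - 1 := by linarith
  have hNp : 0 < N - p := by linarith
  have hw1 : 0 ≤ (2 - p) / p := div_nonneg (by linarith) hp0.le
  have hw2 : 0 ≤ 2 * (p - 1) / N := by positivity
  have hw3 : 0 ≤ 2 * (p - 1) * (N - p) / (p * N) := by positivity
  have key := Real.geom_mean_le_arith_mean3_weighted (w₁ := (2 - p) / p) (w₂ := 2 * (p - 1) / N)
    (w₃ := 2 * (p - 1) * (N - p) / (p * N)) (p₁ := g ^ p / m) (p₂ := b ^ (N / (p - 1)))
    (p₃ := m ^ (N * (p - 1) / (N - p)))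
    hw1 hw2 hw3 (by positivity) (by positivity) (by positivity) (by field_simp; ring)
  have e1 : (g ^ p / m) ^ ((2 - p) / p) = g ^ (2 - p) * m ^ (-((2 - p) / p)) := by
    rw [Real.div_rpow (by positivity) hm.le, ← Real.rpow_mul hg, mul_div_cancel₀ _ hp0.ne',
      Real.rpow_neg hm.le, div_eq_mul_inv]
  have e2 : (b ^ (N / (p - 1))) ^ (2 * (p - 1) / N) = b ^ 2 := by
    rw [← Real.rpow_mul hb]
    have : N / (p - 1) * (2 * (p - 1) / N) = (2 : ℕ) := by push_cast; field_simp
    rw [this, Real.rpow_natCast]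
  have e3 : (m ^ (N * (p - 1) / (N - p))) ^ (2 * (p - 1) * (N - p) / (p * N))
      = m ^ (2 * (p - 1) ^ 2 / p) := by
    rw [← Real.rpow_mul hm.le]
    congr 1
    field_simp
  rw [e1, e2, e3] at key
  have e4 : b ^ 2 * m ^ (2 * γ) * g ^ (2 - p) = m ^ (-(2 * p - 3 - 2 * γ))
      * (g ^ (2 - p) * m ^ (-((2 - p) / p)) * b ^ 2 * m ^ (2 * (p - 1) ^ 2 / p)) := by
    have h2 : m ^ (2 * γ)
        = m ^ (-(2 * p - 3 - 2 * γ)) * m ^ (-((2 - p) / p)) * m ^ (2 * (p - 1) ^ 2 / p) := by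
      rw [← Real.rpow_add hm, ← Real.rpow_add hm]
      congr 1
      field_simp
      ring
    rw [h2]
    ring
  rw [e4]
  refine mul_le_mul_of_nonneg_left (key.trans ?_) (by positivity)
  have hl1 : (2 - p) / p ≤ 1 := by rw [div_le_one hp0]; linarith
  have hl2 : 2 * (p - 1) / N ≤ 1 := by rw [div_le_one hN0]; linarith
  have hl3 : 2 * (p - 1) * (N - p) / (p * N) ≤ 1 := by
    rw [div_le_one (by positivity)]
    nlinarith
  have n1 : 0 ≤ g ^ p / m := by positivity
  have n2 : 0 ≤ b ^ (N / (p - 1)) := by positivity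
  have n3 : 0 ≤ m ^ (N * (p - 1) / (N - p)) := by positivity
  exact add_le_add (add_le_add (mul_le_of_le_one_left n1 hl1) (mul_le_of_le_one_left n2 hl2))
    (mul_le_of_le_one_left n3 hl3)

end RealInequalities

/-! ### Chain rules in terms of partial derivatives -/

section Composition

variable {N : ℕ} {Ω : Set (Space N)} {q : ℝ≥0∞}

/-- The two-variable chain rule in terms of partial derivatives. -/
theorem SobolevTriple.comp₂ (hq : 1 ≤ q) (hq' : q ≠ ⊤)
    {w₁ w₂ : Space N → ℝ} {G₁ G₂ : Space N → Space N} {g₁ g₂ : Space N → ℝ}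
    (h₁ : SobolevTriple Ω q w₁ G₁ g₁) (h₂ : SobolevTriple Ω q w₂ G₂ g₂)
    {F F₁ F₂ : ℝ × ℝ → ℝ} (hF₁ : Continuous F₁) (hF₂ : Continuous F₂)
    (hF : ∀ z, HasFDerivAt F (F₁ z • ContinuousLinearMap.fst ℝ ℝ ℝ
      + F₂ z • ContinuousLinearMap.snd ℝ ℝ ℝ) z) (hF0 : F 0 = 0) {C : ℝ}
    (hC₁ : ∀ z, |F₁ z| ≤ C) (hC₂ : ∀ z, |F₂ z| ≤ C) :
    SobolevTriple Ω q (fun x => F (w₁ x, w₂ x))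
      (fun x => F₁ (w₁ x, w₂ x) • G₁ x + F₂ (w₁ x, w₂ x) • G₂ x)
      (fun x => F (g₁ x, g₂ x)) := by
  have hF1 : ContDiff ℝ 1 F := by
    rw [contDiff_one_iff_hasFDerivAt]
    exact ⟨_, by fun_prop, hF⟩
  have hb : ∀ z, ‖fderiv ℝ F z‖ ≤ C + C := fun z => by
    rw [(hF z).fderiv]
    refine (norm_add_le _ _).trans (add_le_add ?_ ?_)
    · rw [norm_smul]
      exact (mul_le_of_le_one_right (norm_nonneg _)
        (ContinuousLinearMap.norm_fst_le ℝ ℝ ℝ)).trans (hC₁ z)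
    · rw [norm_smul]
      exact (mul_le_of_le_one_right (norm_nonneg _)
        (ContinuousLinearMap.norm_snd_le ℝ ℝ ℝ)).trans (hC₂ z)
  have h := h₁.comp_prodMk hq hq' h₂ hF1 hF0 hb
  simp_rw [(hF _).fderiv] at h
  simpa using h

theorem SobolevTriple.comp (hq : 1 ≤ q) (hq' : q ≠ ⊤)
    {w : Space N → ℝ} {G : Space N → Space N} {g : Space N → ℝ} (h : SobolevTriple Ω q w G g)
    {f f' : ℝ → ℝ} (hf' : Continuous f') (hf : ∀ s, HasDerivAt f (f' s) s) (hf0 : f 0 = 0)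
    {C : ℝ} (hC : ∀ s, |f' s| ≤ C) :
    SobolevTriple Ω q (fun x => f (w x)) (fun x => f' (w x) • G x) (fun x => f (g x)) := by
  have := h.comp₂ hq hq' h (F := fun z => f z.1) (F₁ := fun z => f' z.1) (F₂ := fun _ => 0)
    (by fun_prop) continuous_const (fun z => by
      have h1 := (hf z.1).hasFDerivAt.comp z (hasFDerivAt_fst (𝕜 := ℝ) (p := z))
      refine h1.congr_fderiv ?_
      ext <;> simp) hf0 (C := C) (fun z => hC z.1)
    (fun z => by simpa using (abs_nonneg _).trans (hC 0))
  simpa using this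

end Composition

/-! ### Truncations -/

section Trunc

theorem trunc_of_abs_le {k s : ℝ} (h : |s| ≤ k) : trunc k s = s := by
  rw [abs_le] at h
  simp [trunc, h.1, h.2]

theorem abs_trunc_le {k s : ℝ} (hk : 0 ≤ k) : |trunc k s| ≤ k := by
  rw [abs_le, trunc]
  exact ⟨le_max_left _ _, max_le (by linarith) (min_le_right _ _)⟩

theorem abs_trunc_of_le {k s : ℝ} (hk : 0 ≤ k) (h : k ≤ |s|) : |trunc k s| = k := by
  rw [trunc]
  rcases le_total 0 s with hs | hs
  · rw [abs_of_nonneg hs] at h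
    rw [min_eq_right h, max_eq_right (by linarith), abs_of_nonneg hk]
  · rw [abs_of_nonpos hs] at h
    rw [min_eq_left (by linarith), max_eq_left (by linarith), abs_neg, abs_of_nonneg hk]

theorem trunc_mono (k : ℝ) : Monotone (trunc k) := fun _ _ h =>
  max_le_max le_rfl (min_le_min h le_rfl)

theorem continuous_trunc (k : ℝ) : Continuous (trunc k) := by
  unfold trunc
  fun_prop

theorem cutoff_trunc_div {k m s : ℝ} (hm : 0 < m) (hk : 2 * m ≤ k) :
    cutoff (trunc k s / m) = cutoff (s / m) := by
  rcases le_total |s| k with h | h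
  · rw [trunc_of_abs_le h]
  · rw [cutoff_eq_zero (s := s / m), cutoff_eq_zero]
    · rw [abs_div, abs_of_pos hm, le_div_iff₀ hm, abs_trunc_of_le (by linarith) h]
      exact hk
    · rw [abs_div, abs_of_pos hm, le_div_iff₀ hm]
      linarith

end Trunc

/-- The truncations of `u` lie in `W^{1,p}_{Γd}(Ω)`, `Du` is its generalized gradient, and
`∫_{|u| < n} |Du|^p = o(n)`. -/
structure HasRegularTruncations {N : ℕ} (Ω Γd : Set (Space N)) (p : ℝ) (u : Space N → ℝ)
    (Du : Space N → Space N) : Prop where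
  aemeasurable : AEMeasurable u (volume.restrict Ω)
  aemeasurable_grad : AEMeasurable Du (volume.restrict Ω)
  triple : ∀ k, 0 < k → ∃ g, SobolevTriple Ω (ENNReal.ofReal p) (fun x => trunc k (u x))
    ({x | |u x| < k}.indicator Du) g ∧ ∀ᵐ x ∂(surfaceMeasure Ω), x ∈ Γd → g x = 0
  decay : Tendsto (fun n : ℕ => (1 / (n : ℝ)) *
    ∫ x in Ω, {x | |u x| < (n : ℝ)}.indicator (fun x => ‖Du x‖ ^ p) x) atTop (𝓝 0)

/-! ### Energy growth and the recursion for the level sets -/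

namespace HasRegularTruncations

variable {N : ℕ} {Ω Γd : Set (Space N)} {p : ℝ} {u : Space N → ℝ} {Du : Space N → Space N}

theorem nullMeasurableSet_lt (h : HasRegularTruncations Ω Γd p u Du) (t : ℝ) :
    NullMeasurableSet {x | |u x| < t} (volume.restrict Ω) :=
  _root_.nullMeasurableSet_lt h.aemeasurable.abs aemeasurable_const

theorem nullMeasurableSet_le (h : HasRegularTruncations Ω Γd p u Du) (t : ℝ) :
    NullMeasurableSet {x | t ≤ |u x|} (volume.restrict Ω) :=
  _root_.nullMeasurableSet_le aemeasurable_const h.aemeasurable.abs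

theorem memLp_indicator (h : HasRegularTruncations Ω Γd p u Du) {t : ℝ} (ht : 0 < t) :
    MemLp ({x | |u x| < t}.indicator Du) (ENNReal.ofReal p) (volume.restrict Ω) := by
  obtain ⟨g, hg, -⟩ := h.triple t ht
  exact hg.memLp_grad

theorem integrable_indicator (hp : 0 < p) (h : HasRegularTruncations Ω Γd p u Du) {t : ℝ}
    (ht : 0 < t) :
    Integrable ({x | |u x| < t}.indicator fun x => ‖Du x‖ ^ p) (volume.restrict Ω) := by
  have := (h.memLp_indicator ht).integrable_norm_rpow (by simpa using hp) ENNReal.ofReal_ne_top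
  rw [ENNReal.toReal_ofReal hp.le] at this
  refine this.congr (.of_forall fun x => ?_)
  by_cases hx : |u x| < t <;> simp [hx, hp.ne']

/-- A convergent sequence is bounded; the factor 2 pays for rounding t ≥ 1 up to an integer. -/
theorem exists_energy_bound (hp : 0 < p) (h : HasRegularTruncations Ω Γd p u Du) :
    ∃ K, 0 ≤ K ∧ ∀ t, 1 ≤ t →
      ∫ x in Ω, {x | |u x| < t}.indicator (fun x => ‖Du x‖ ^ p) x ≤ K * t := by
  obtain ⟨K, hK⟩ := h.decay.bddAbove_range
  have hK' : ∀ n : ℕ, (1 / (n : ℝ)) *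
      ∫ x in Ω, {x | |u x| < (n : ℝ)}.indicator (fun x => ‖Du x‖ ^ p) x ≤ K :=
    fun n => hK (Set.mem_range_self n)
  have hK0 : 0 ≤ K := by simpa using hK' 0
  refine ⟨2 * K, by positivity, fun t ht => ?_⟩
  have hn : t ≤ (⌈t⌉₊ : ℝ) := Nat.le_ceil t
  have hn2 : (⌈t⌉₊ : ℝ) ≤ 2 * t := by linarith [(Nat.ceil_lt_add_one (by linarith : 0 ≤ t)).le]
  have hn0 : (0 : ℝ) < ⌈t⌉₊ := by linarith
  calc ∫ x in Ω, {x | |u x| < t}.indicator (fun x => ‖Du x‖ ^ p) x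
      ≤ ∫ x in Ω, {x | |u x| < (⌈t⌉₊ : ℝ)}.indicator (fun x => ‖Du x‖ ^ p) x := by
        refine integral_mono (h.integrable_indicator hp (by linarith))
          (h.integrable_indicator hp hn0) fun x => ?_
        exact Set.indicator_le_indicator_of_subset (fun y (hy : |u y| < t) => hy.trans_le hn)
          (fun y => by positivity) x
    _ ≤ K * ⌈t⌉₊ := by
        have := hK' ⌈t⌉₊
        rwa [one_div, inv_mul_le_iff₀ hn0, mul_comm] at this
    _ ≤ 2 * K * t := by nlinarith

theorem tendsto_measure_level [IsFiniteMeasure (volume.restrict Ω)]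
    (h : HasRegularTruncations Ω Γd p u Du) :
    Tendsto (fun n : ℕ => (volume.restrict Ω).real {x | (n : ℝ) ≤ |u x|}) atTop (𝓝 0) := by
  have h1 := tendsto_measure_iInter_atTop (μ := volume.restrict Ω)
    (s := fun n : ℕ => {x | (n : ℝ) ≤ |u x|}) (fun n => h.nullMeasurableSet_le n)
    (fun m n hmn x (hx : (n : ℝ) ≤ |u x|) => show (m : ℝ) ≤ |u x| from
      (Nat.cast_le.2 hmn).trans hx) ⟨0, measure_ne_top _ _⟩
  have h2 : ⋂ n : ℕ, {x | (n : ℝ) ≤ |u x|} = ∅ := by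
    rw [Set.eq_empty_iff_forall_notMem]
    intro x hx
    obtain ⟨n, hn⟩ := exists_nat_gt |u x|
    exact absurd (Set.mem_iInter.1 hx n) (not_le.2 hn)
  rw [h2, measure_empty] at h1
  exact (ENNReal.tendsto_toReal ENNReal.zero_ne_top).comp h1

/-- The Sobolev inequality applied to `1 - cutoff (u / m)`. -/
theorem exists_level_recursion (hΩ : IsOpen Ω) (hb : Bornology.IsBounded Ω)
    (hL : HasLipschitzBoundary Ω) (hN : 2 < N) (hp1 : 1 < p)
    (h : HasRegularTruncations Ω Γd p u Du) :
    ∃ K m₀ : ℝ, 0 ≤ K ∧ 1 ≤ m₀ ∧ ∀ m, m₀ ≤ m →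
      (volume.restrict Ω).real {x | 2 * m ≤ |u x|} ≤
        K * ((volume.restrict Ω).real {x | m ≤ |u x|} / m)
          ^ ((N : ℝ) * (p - 1) / ((N - 1) * p)) := by
  have hfin := isFiniteMeasure_restrict hb
  have hp0 : 0 < p := by linarith
  have hN1 : (1 : ℝ) < N := by exact_mod_cast (by omega : 1 < N)
  have hN10 : (0 : ℝ) < (N : ℝ) - 1 := by linarith
  set P : ℝ := (N : ℝ) / (N - 1) with hPdef
  have hP : Real.HolderConjugate N P := Real.HolderConjugate.conjExponent hN1
  have hP0 : 0 < P := hP.symm.pos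
  have hpq : Real.HolderConjugate p (p / (p - 1)) := Real.HolderConjugate.conjExponent hp1
  have hq1 : 1 ≤ ENNReal.ofReal p := by simpa using ENNReal.ofReal_le_ofReal hp1.le
  obtain ⟨C, hC, hsob⟩ := exists_sobolev_triple hΩ hb hL hP hq1
  obtain ⟨Cζ, hCζ, hζ⟩ := exists_deriv_cutoff_bound
  obtain ⟨K, hK0, hK⟩ := h.exists_energy_bound hp0
  set C1 : ℝ := (C ^ (1 / P)).toReal with hC1
  have hCt : C ^ (1 / P) ≠ ⊤ := ENNReal.rpow_ne_top_of_nonneg (by positivity) hC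
  set M : ℝ → ℝ := fun t => (volume.restrict Ω).real {x | t ≤ |u x|} with hM
  have hMa : Antitone M := fun s t hst => measureReal_mono fun x hx => hst.trans hx
  have hM0 : ∀ t, 0 ≤ M t := fun t => measureReal_nonneg
  -- the measure of the level sets is eventually small enough to absorb the lower order term
  have hsmall : Tendsto (fun n : ℕ => C1 * M n ^ (1 / (N : ℝ))) atTop (𝓝 0) := by
    have h1 := (Real.continuousAt_rpow_const 0 (1 / (N : ℝ)) (Or.inr (by positivity))).tendsto.comp
      h.tendsto_measure_level
    have := h1.const_mul C1
    rwa [Real.zero_rpow (by positivity), mul_zero] at this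
  obtain ⟨n₀, hn₀⟩ := ((hsmall.eventually (gt_mem_nhds (show (0 : ℝ) < 1 / 2 by norm_num))).and
    (eventually_ge_atTop 1)).exists
  refine ⟨(2 * C1 * Cζ * (2 * K) ^ (1 / p)) ^ P, n₀, by positivity, by exact_mod_cast hn₀.2,
    fun m hm => ?_⟩
  have hm1 : 1 ≤ m := le_trans (by exact_mod_cast hn₀.2) hm
  have hm0 : 0 < m := by linarith
  have hMm : C1 * M m ^ (1 / (N : ℝ)) ≤ 1 / 2 := by
    refine le_trans ?_ hn₀.1.le
    have := hMa hm
    have := hM0 m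
    gcongr
  -- Height 2m suffices: `cutoff` (· / m) vanishes beyond 2m, so truncating there does not change 1
  -- - `cutoff` (u / m).
  obtain ⟨g, hg, -⟩ := h.triple (2 * m) (by positivity)
  have hcomp := hg.comp hq1 ENNReal.ofReal_ne_top (f := fun s => 1 - cutoff (s / m))
    (f' := fun s => -(deriv cutoff (s / m) / m))
    ((continuous_deriv_cutoff.comp (continuous_id.div_const m)).div_const m).neg
    (fun s => (hasDerivAt_cutoff_div s).const_sub 1) (by simp [cutoff_eq_one]) (C := Cζ / m)
    (fun s => by
      rw [abs_neg, abs_div, abs_of_pos hm0]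
      gcongr
      exact hζ _)
  have hS := hsob _ _ _ hcomp
  have hwm := hcomp.memLp.1
  have hGm := hg.memLp_grad.1
  set w : Space N → ℝ := fun x => 1 - cutoff (trunc (2 * m) (u x) / m) with hw
  set Gd : Space N → Space N := {x | |u x| < 2 * m}.indicator Du with hGd
  set G : Space N → Space N := fun x => -(deriv cutoff (trunc (2 * m) (u x) / m) / m) • Gd x
    with hG
  have hw1 : ∀ x, ‖w x‖ ≤ 1 := fun x => by
    rw [hw, Real.norm_of_nonneg (by simpa using cutoff_le_one _)]
    simpa using cutoff_nonneg _
  have hEm := h.nullMeasurableSet_le m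
  set E : Set (Space N) := {x | m ≤ |u x|} with hE
  have hwE : ∀ x, x ∉ E → w x = 0 := fun x hx => by
    have hx' : |u x| < m := not_le.1 hx
    rw [hw]
    simp only
    rw [cutoff_trunc_div hm0 le_rfl, cutoff_eq_one, sub_self]
    rw [abs_div, abs_of_pos hm0, div_le_one hm0]
    exact hx'.le
  have hGE : ∀ x, ‖G x‖ ≤ Cζ / m * ‖Gd x‖ * E.indicator (fun _ => (1 : ℝ)) x := fun x => by
    by_cases hx : x ∈ E
    · rw [Set.indicator_of_mem hx, mul_one, hG, norm_smul, norm_neg, norm_div,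
        Real.norm_of_nonneg hm0.le]
      gcongr
      exact hζ _
    · have hx' : |u x| < m := not_le.1 hx
      rw [Set.indicator_of_notMem hx, mul_zero, hG]
      simp only
      rw [trunc_of_abs_le (by linarith), deriv_cutoff_eq_zero_of_lt]
      · simp
      · rw [abs_div, abs_of_pos hm0, div_lt_one hm0]
        exact hx'
  have hind : ∀ r : ℝ, 0 < r →
      (∫⁻ x in Ω, (E.indicator (fun _ => (1 : ℝ≥0∞)) x) ^ r) = ENNReal.ofReal (M m) := by
    intro r hr
    have : ∀ x, (E.indicator (fun _ => (1 : ℝ≥0∞)) x) ^ r = E.indicator 1 x := fun x => by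
      by_cases hx : x ∈ E <;> simp [hx, hr]
    simp_rw [this]
    rw [lintegral_indicator_one₀ hEm, hM, ofReal_measureReal]
  have hindm : AEMeasurable (E.indicator (fun _ => (1 : ℝ≥0∞))) (volume.restrict Ω) :=
    (aemeasurable_const (b := (1 : ℝ≥0∞))).indicator₀ hEm
  set a : ℝ≥0∞ := (∫⁻ x in Ω, ‖w x‖ₑ ^ P) ^ (1 / P) with ha
  -- Finiteness of the Sobolev norm, clear from 0 ≤ w ≤ 1, is needed for the absorption below.
  have hafin : a ≠ ⊤ := by
    refine ENNReal.rpow_ne_top_of_nonneg (by positivity) ?_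
    refine ne_top_of_le_ne_top (measure_ne_top (volume.restrict Ω) Set.univ) ?_
    rw [← lintegral_one]
    refine lintegral_mono fun x => ENNReal.rpow_le_one ?_ hP0.le
    have := enorm_le_iff_norm_le.2 ((hw1 x).trans_eq (norm_one (α := ℝ)).symm)
    rwa [enorm_one] at this
  -- No trace condition is used, so the Sobolev inequality carries the lower order term ∫ |w|. As w
  -- lives on {m ≤ |u|}, Hölder's inequality bounds it by the Sobolev norm times a small power of
  -- the measure of that set; 1/N is 1 - 1/P.
  have hI1 : ∫⁻ x in Ω, ‖w x‖ₑ ≤ a * ENNReal.ofReal (M m) ^ (1 / (N : ℝ)) := by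
    have := ENNReal.lintegral_mul_le_Lp_mul_Lq (volume.restrict Ω) hP.symm hwm.enorm hindm
    rw [hind _ (by linarith)] at this
    refine le_trans (le_of_eq (lintegral_congr fun x => ?_)) this
    by_cases hx : x ∈ E
    · simp [hx]
    · simp [hwE x hx]
  have hI2 : ∫⁻ x in Ω, ‖G x‖ₑ ≤ ENNReal.ofReal (Cζ / m) *
      (ENNReal.ofReal (K * (2 * m)) ^ (1 / p)
        * ENNReal.ofReal (M m) ^ (1 / (p / (p - 1)))) := by
    have hH := ENNReal.lintegral_mul_le_Lp_mul_Lq (volume.restrict Ω) hpq hGm.enorm hindm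
    rw [hind _ hpq.symm.pos] at hH
    have hD : ∫⁻ x in Ω, ‖Gd x‖ₑ ^ p ≤ ENNReal.ofReal (K * (2 * m)) := by
      have e1 : ∫⁻ x in Ω, ‖Gd x‖ₑ ^ p = ENNReal.ofReal
          (∫ x in Ω, {x | |u x| < 2 * m}.indicator (fun x => ‖Du x‖ ^ p) x) := by
        rw [ofReal_integral_eq_lintegral_ofReal (h.integrable_indicator hp0 (by positivity))
          (.of_forall fun x => Set.indicator_nonneg (fun y _ => by positivity) x)]
        refine lintegral_congr fun x => ?_
        by_cases hx : |u x| < 2 * m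
        · simp [hGd, hx, ENNReal.ofReal_rpow_of_nonneg, ← ofReal_norm, hp0.le]
        · simp [hGd, hx, hp0]
      rw [e1]
      exact ENNReal.ofReal_le_ofReal (hK _ (by linarith))
    calc ∫⁻ x in Ω, ‖G x‖ₑ
        ≤ ∫⁻ x in Ω, ENNReal.ofReal (Cζ / m) *
            ((fun x => ‖Gd x‖ₑ) * E.indicator (fun _ => (1 : ℝ≥0∞))) x := by
          refine lintegral_mono fun x => ?_
          have h1 := ENNReal.ofReal_le_ofReal (hGE x)
          rw [ofReal_norm, ENNReal.ofReal_mul (by positivity), ENNReal.ofReal_mul (by positivity),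
            ofReal_norm, mul_assoc] at h1
          refine h1.trans (le_of_eq ?_)
          by_cases hx : x ∈ E <;> simp [hx]
      _ = ENNReal.ofReal (Cζ / m) *
            ∫⁻ x in Ω, ((fun x => ‖Gd x‖ₑ) * E.indicator (fun _ => (1 : ℝ≥0∞))) x :=
          lintegral_const_mul' _ _ ENNReal.ofReal_ne_top
      _ ≤ _ := by
          refine mul_le_mul_right (hH.trans (mul_le_mul_left ?_ _)) _
          exact ENNReal.rpow_le_rpow hD (by positivity)
  have hmain : a ≤ C ^ (1 / P) * (a * ENNReal.ofReal (M m) ^ (1 / (N : ℝ))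
      + ENNReal.ofReal (Cζ / m) * (ENNReal.ofReal (K * (2 * m)) ^ (1 / p)
        * ENNReal.ofReal (M m) ^ (1 / (p / (p - 1))))) := by
    calc a ≤ (C * ((∫⁻ x in Ω, ‖w x‖ₑ) + ∫⁻ x in Ω, ‖G x‖ₑ) ^ P) ^ (1 / P) :=
          ENNReal.rpow_le_rpow hS (by positivity)
      _ = C ^ (1 / P) * ((∫⁻ x in Ω, ‖w x‖ₑ) + ∫⁻ x in Ω, ‖G x‖ₑ) := by
          rw [ENNReal.mul_rpow_of_nonneg _ _ (by positivity), ← ENNReal.rpow_mul,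
            mul_one_div_cancel hP0.ne', ENNReal.rpow_one]
      _ ≤ _ := by gcongr
  have hMr : ∀ r : ℝ, 0 ≤ r → ENNReal.ofReal (M m) ^ r = ENNReal.ofReal (M m ^ r) :=
    fun r hr => ENNReal.ofReal_rpow_of_nonneg (hM0 m) hr
  have hpp : 1 / (p / (p - 1)) = (p - 1) / p := by rw [one_div_div]
  have hp1' : 0 ≤ (p - 1) / p := div_nonneg (by linarith) hp0.le
  rw [hpp, hMr _ (by positivity), hMr _ hp1', ENNReal.ofReal_rpow_of_nonneg (by positivity)
    (by positivity)] at hmain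
  set R : ℝ := Cζ / m * ((K * (2 * m)) ^ (1 / p) * M m ^ ((p - 1) / p)) with hR
  have hR0 : 0 ≤ R := by
    have := hM0 m
    positivity
  have hreal : a.toReal ≤ C1 * (a.toReal * M m ^ (1 / (N : ℝ)) + R) := by
    have h1 : a ≤ ENNReal.ofReal (C1 * (a.toReal * M m ^ (1 / (N : ℝ)) + R)) := by
      have hMN : 0 ≤ M m ^ (1 / (N : ℝ)) := Real.rpow_nonneg (hM0 m) _
      rw [ENNReal.ofReal_mul ENNReal.toReal_nonneg, ENNReal.ofReal_add (by positivity) hR0,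
        ENNReal.ofReal_mul ENNReal.toReal_nonneg, ENNReal.ofReal_toReal hafin,
        ENNReal.ofReal_toReal hCt, hR, ENNReal.ofReal_mul (by positivity),
        ENNReal.ofReal_mul (by positivity)]
      exact hmain
    have hMN : 0 ≤ M m ^ (1 / (N : ℝ)) := Real.rpow_nonneg (hM0 m) _
    have := ENNReal.toReal_mono ENNReal.ofReal_ne_top h1
    rwa [ENNReal.toReal_ofReal (by positivity)] at this
  have hC10 : 0 ≤ C1 := ENNReal.toReal_nonneg
  -- For m ≥ m₀ the lower order term is at most half of the left side and is absorbed.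
  have ha2 : a.toReal ≤ 2 * C1 * R := by
    have ha0 : 0 ≤ a.toReal := ENNReal.toReal_nonneg
    have : C1 * (a.toReal * M m ^ (1 / (N : ℝ))) ≤ 1 / 2 * a.toReal := by
      calc C1 * (a.toReal * M m ^ (1 / (N : ℝ))) = C1 * M m ^ (1 / (N : ℝ)) * a.toReal := by ring
        _ ≤ 1 / 2 * a.toReal := by gcongr
    linarith
  have hM2 : M (2 * m) ≤ a.toReal ^ P := by
    have h1 : ENNReal.ofReal (M (2 * m)) ≤ a ^ P := by
      rw [ha, ← ENNReal.rpow_mul, one_div_mul_cancel hP0.ne', ENNReal.rpow_one, hM,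
        ofReal_measureReal, ← lintegral_indicator_one₀ (h.nullMeasurableSet_le _)]
      refine lintegral_mono fun x => ?_
      by_cases hx : 2 * m ≤ |u x|
      · have : w x = 1 := by
          rw [hw]
          simp only
          rw [cutoff_trunc_div hm0 le_rfl, cutoff_eq_zero, sub_zero]
          rw [abs_div, abs_of_pos hm0, le_div_iff₀ hm0]
          exact hx
        rw [Set.indicator_of_mem (show x ∈ {x | 2 * m ≤ |u x|} from hx), this]
        simp
      · simp [hx]
    rw [ENNReal.ofReal_le_iff_le_toReal (ENNReal.rpow_ne_top_of_nonneg hP0.le hafin),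
      ← ENNReal.toReal_rpow] at h1
    exact h1
  calc M (2 * m) ≤ (2 * C1 * R) ^ P := hM2.trans (Real.rpow_le_rpow ENNReal.toReal_nonneg ha2 hP0.le)
    _ = (2 * C1 * Cζ * (2 * K) ^ (1 / p)) ^ P * (M m / m)
          ^ ((N : ℝ) * (p - 1) / ((N - 1) * p)) := by
      -- The factor 1/m from the cutoff and m^(1/p) from the energy combine to m^(-(p-1)/p), so the
      -- measure enters only through M(m)/m. Raising to the power P gives θ.
      have e1 : 2 * C1 * R = 2 * C1 * Cζ * (2 * K) ^ (1 / p) * (M m / m) ^ ((p - 1) / p) := by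
        have e2 : K * (2 * m) = 2 * K * m := by ring
        have e3 : m⁻¹ * m ^ (1 / p) = (m ^ ((p - 1) / p))⁻¹ := by
          rw [← Real.rpow_neg_one, ← Real.rpow_add hm0, ← Real.rpow_neg hm0.le]
          congr 1
          field_simp
          ring
        rw [hR, e2, Real.mul_rpow (by positivity) hm0.le, Real.div_rpow (hM0 m) hm0.le]
        calc _ = 2 * C1 * Cζ * (2 * K) ^ (1 / p) * M m ^ ((p - 1) / p)
              * (m⁻¹ * m ^ (1 / p)) := by ring
          _ = _ := by rw [e3]; ring
      have hMd : 0 ≤ M m / m := div_nonneg (hM0 m) hm0.le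
      rw [e1, Real.mul_rpow (by positivity) (by positivity), ← Real.rpow_mul hMd]
      congr 2
      rw [hPdef]
      field_simp

end HasRegularTruncations

/-! ### Dyadic summation -/

section Dyadic

variable {X : Type*} [MeasurableSpace X] {μ : Measure X}

/-- On the shell 2^j ≤ g < 2^(j+1) a power of g is comparable with the same power of 2^j, whatever
its sign. The shells thus contribute at most a geometric series of ratio 2^(-δ). -/
theorem lintegral_lt_top_of_dyadic {F : X → ℝ≥0∞} {g : X → ℝ} (hg : AEMeasurable g μ)
    (hg1 : ∀ x, 1 ≤ g x) {κ δ C : ℝ} (hδ : 0 < δ) (hC : 0 ≤ C)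
    (h : ∀ j : ℕ, ∫⁻ x in {x | 2 ^ j ≤ g x ∧ g x < 2 ^ (j + 1)}, F x ∂μ
      ≤ ENNReal.ofReal (C * 2 ^ (κ * j))) :
    ∫⁻ x, F x * ENNReal.ofReal (g x ^ (-κ - δ)) ∂μ < ⊤ := by
  set e := -κ - δ with he
  set E : ℕ → Set X := fun j => {x | 2 ^ j ≤ g x ∧ g x < 2 ^ (j + 1)} with hE
  have hEm : ∀ j, NullMeasurableSet (E j) μ := fun j =>
    (nullMeasurableSet_le aemeasurable_const hg).inter (nullMeasurableSet_lt hg aemeasurable_const)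
  have hU : ⋃ j, E j = Set.univ := by
    refine Set.eq_univ_of_forall fun x => Set.mem_iUnion.2 ?_
    obtain ⟨j, h1, h2⟩ := exists_nat_pow_near (hg1 x) one_lt_two
    exact ⟨j, h1, h2⟩
  have hpt : ∀ j, ∀ x ∈ E j, g x ^ e ≤ 2 ^ |e| * 2 ^ (e * j) := by
    intro j x hx
    have hgx : 0 < g x := by linarith [hg1 x]
    have e1 : (2 : ℝ) ^ (e * j) = (2 ^ j) ^ e := by
      rw [mul_comm, Real.rpow_mul two_pos.le, Real.rpow_natCast]
    rw [e1]
    rcases le_total 0 e with h0 | h0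
    · calc g x ^ e ≤ (2 ^ (j + 1)) ^ e := Real.rpow_le_rpow hgx.le hx.2.le h0
        _ = 2 ^ |e| * (2 ^ j) ^ e := by
            rw [pow_succ', Real.mul_rpow (by positivity) (by positivity), abs_of_nonneg h0]
    · calc g x ^ e ≤ (2 ^ j) ^ e := Real.rpow_le_rpow_of_nonpos (by positivity) hx.1 h0
        _ ≤ 2 ^ |e| * (2 ^ j) ^ e :=
            le_mul_of_one_le_left (by positivity)
              (Real.one_le_rpow one_le_two (abs_nonneg e))
  have hj : ∀ j, ∫⁻ x in E j, F x * ENNReal.ofReal (g x ^ e) ∂μ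
      ≤ ENNReal.ofReal (2 ^ |e| * C * (2 ^ (-δ)) ^ j) := by
    intro j
    calc ∫⁻ x in E j, F x * ENNReal.ofReal (g x ^ e) ∂μ
        ≤ ∫⁻ x in E j, ENNReal.ofReal (2 ^ |e| * 2 ^ (e * j)) * F x ∂μ := by
          refine lintegral_mono_ae ?_
          filter_upwards [ae_restrict_mem₀ (hEm j)] with x hx
          rw [mul_comm]
          gcongr
          exact hpt j x hx
      _ = ENNReal.ofReal (2 ^ |e| * 2 ^ (e * j)) * ∫⁻ x in E j, F x ∂μ :=
          lintegral_const_mul' _ _ ENNReal.ofReal_ne_top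
      _ ≤ ENNReal.ofReal (2 ^ |e| * 2 ^ (e * j)) * ENNReal.ofReal (C * 2 ^ (κ * j)) := by
          gcongr
          exact h j
      _ = _ := by
          rw [← ENNReal.ofReal_mul (by positivity)]
          congr 1
          have : ((2 : ℝ) ^ (-δ)) ^ j = 2 ^ (e * j) * 2 ^ (κ * j) := by
            rw [← Real.rpow_add two_pos, ← Real.rpow_natCast, ← Real.rpow_mul two_pos.le]
            congr 1
            rw [he]
            ring
          rw [this]
          ring
  have hr : (2 : ℝ) ^ (-δ) < 1 := Real.rpow_lt_one_of_one_lt_of_neg one_lt_two (by linarith)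
  have hsum : Summable fun j : ℕ => 2 ^ |e| * C * ((2 : ℝ) ^ (-δ)) ^ j :=
    (summable_geometric_of_lt_one (by positivity) hr).mul_left _
  calc ∫⁻ x, F x * ENNReal.ofReal (g x ^ e) ∂μ
      = ∫⁻ x in ⋃ j, E j, F x * ENNReal.ofReal (g x ^ e) ∂μ := by rw [hU, setLIntegral_univ]
    _ ≤ ∑' j, ∫⁻ x in E j, F x * ENNReal.ofReal (g x ^ e) ∂μ := lintegral_iUnion_le _ _
    _ ≤ ∑' j : ℕ, ENNReal.ofReal (2 ^ |e| * C * (2 ^ (-δ)) ^ j) := ENNReal.tsum_le_tsum hj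
    _ < ⊤ := by
        rw [← ENNReal.ofReal_tsum_of_nonneg (fun j => by positivity) hsum]
        exact ENNReal.ofReal_lt_top

end Dyadic

/-! ### Decay of the level sets, the convection weight and the convection flux -/

namespace HasRegularTruncations

variable {N : ℕ} {Ω Γd : Set (Space N)} {p : ℝ} {u : Space N → ℝ} {Du : Space N → Space N}

/-- In the recursion θ = N(p-1)/((N-1)p), which is less than 1 because p < N, and θ/(1 - θ) =
N(p-1)/(N-p). Passing from |u| to 1 + |u| costs a factor 2^q, and for t ≤ 2 the total measure is a
sufficient bound. -/
theorem exists_level_decay (hΩ : IsOpen Ω) (hb : Bornology.IsBounded Ω)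
    (hL : HasLipschitzBoundary Ω) (hN : 2 < N) (hp1 : 1 < p) (hp2 : p ≤ 2)
    (h : HasRegularTruncations Ω Γd p u Du) :
    ∃ A, 0 ≤ A ∧ ∀ t, 1 ≤ t → (volume.restrict Ω).real {x | t ≤ 1 + |u x|}
      ≤ A * t ^ (-((N : ℝ) * (p - 1) / (N - p))) := by
  have hfin := isFiniteMeasure_restrict hb
  have hN2 : (2 : ℝ) < N := by exact_mod_cast hN
  have hNp : (0 : ℝ) < N - p := by linarith
  have hp0 : 0 < p := by linarith
  have hq1 : 0 < p - 1 := by linarith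
  have hN1 : (0 : ℝ) < N - 1 := by linarith
  obtain ⟨K, m₀, hK, hm₀, hrec⟩ := h.exists_level_recursion hΩ hb hL hN hp1
  set θ : ℝ := (N : ℝ) * (p - 1) / ((N - 1) * p) with hθ
  have hθ0 : 0 < θ := by positivity
  have h1θ : 1 - θ = (N - p) / ((N - 1) * p) := by
    rw [hθ]
    field_simp
    ring
  have hθ1 : θ < 1 := by
    have : 0 < 1 - θ := by rw [h1θ]; positivity
    linarith
  have hq : θ / (1 - θ) = (N : ℝ) * (p - 1) / (N - p) := by
    rw [h1θ, hθ]
    field_simp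
  obtain ⟨A, hA0, hA⟩ := exists_decay_of_recursion
    (M := fun t => (volume.restrict Ω).real {x | t ≤ |u x|})
    (fun s t hst => measureReal_mono fun x hx => hst.trans hx) (fun t => measureReal_nonneg)
    hK hθ0 hθ1 hm₀ hrec
  rw [hq] at hA
  set q : ℝ := (N : ℝ) * (p - 1) / (N - p) with hqdef
  have hq0 : 0 < q := by positivity
  refine ⟨(A + (volume.restrict Ω).real Set.univ) * 2 ^ q, by positivity, fun t ht => ?_⟩
  have ht0 : 0 < t := by linarith
  have e : (2 : ℝ) ^ q * t ^ (-q) = (t / 2) ^ (-q) := by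
    rw [Real.div_rpow ht0.le two_pos.le, Real.rpow_neg two_pos.le]
    field_simp
  rw [mul_assoc, e, add_mul]
  have hU : 0 ≤ (volume.restrict Ω).real Set.univ := measureReal_nonneg
  rcases le_total 2 t with h2 | h2
  · calc (volume.restrict Ω).real {x | t ≤ 1 + |u x|}
        ≤ (volume.restrict Ω).real {x | t / 2 ≤ |u x|} :=
          measureReal_mono fun x (hx : t ≤ 1 + |u x|) => show t / 2 ≤ |u x| by linarith
      _ ≤ A * (t / 2) ^ (-q) := hA _ (by linarith)
      _ ≤ _ := le_add_of_nonneg_right (by positivity)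
  · calc (volume.restrict Ω).real {x | t ≤ 1 + |u x|}
        ≤ (volume.restrict Ω).real Set.univ := measureReal_mono (Set.subset_univ _)
      _ ≤ (volume.restrict Ω).real Set.univ * (t / 2) ^ (-q) :=
          le_mul_of_one_le_right hU (Real.one_le_rpow_of_pos_of_le_one_of_nonpos (by positivity)
            (by linarith) (by linarith))
      _ ≤ _ := le_add_of_nonneg_left (by positivity)

/-- `weight_le` with m = 1 + |u| leaves three terms. The first sums dyadically because the energy
below level 2^j is O(2^j), the last because the measure above it is O(2^(-qj)), each with a margin δ
> 0; the middle one is dominated by |b|^(N/(p-1)). -/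
theorem integrable_weight (hΩ : IsOpen Ω) (hb : Bornology.IsBounded Ω)
    (hL : HasLipschitzBoundary Ω) (hN : 2 < N) (hp1 : 1 < p) (hp2 : p ≤ 2)
    (h : HasRegularTruncations Ω Γd p u Du) {b : Space N → ℝ}
    (hbm : AEMeasurable b (volume.restrict Ω))
    (hbi : Integrable (fun x => |b x| ^ ((N : ℝ) / (p - 1))) (volume.restrict Ω)) {γ : ℝ}
    (hγ : γ < p - 3 / 2) :
    Integrable (fun x => |b x| ^ 2 * (1 + |u x|) ^ (2 * γ) * ‖Du x‖ ^ (2 - p))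
      (volume.restrict Ω) := by
  have hN2 : (2 : ℝ) < N := by exact_mod_cast hN
  have hp0 : 0 < p := by linarith
  have hfin := isFiniteMeasure_restrict hb
  set δ : ℝ := 2 * p - 3 - 2 * γ with hδdef
  have hδ : 0 < δ := by rw [hδdef]; linarith
  set q : ℝ := (N : ℝ) * (p - 1) / (N - p) with hq
  have hum := h.aemeasurable
  have hDm := h.aemeasurable_grad
  have hgm : AEMeasurable (fun x => 1 + |u x|) (volume.restrict Ω) := hum.abs.const_add 1
  have hg1 : ∀ x, 1 ≤ 1 + |u x| := fun x => by linarith [abs_nonneg (u x)]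
  have hg0 : ∀ x, 0 < 1 + |u x| := fun x => by linarith [abs_nonneg (u x)]
  obtain ⟨K, hK0, hK⟩ := h.exists_energy_bound hp0
  obtain ⟨A, hA0, hA⟩ := h.exists_level_decay hΩ hb hL hN hp1 hp2
  have I1 : Integrable (fun x => ‖Du x‖ ^ p * (1 + |u x|) ^ (-1 - δ)) (volume.restrict Ω) := by
    refine ⟨((hDm.norm.pow_const p).mul (hgm.pow_const _)).aestronglyMeasurable, ?_⟩
    rw [hasFiniteIntegral_iff_ofReal (.of_forall fun x =>
      mul_nonneg (by positivity) (Real.rpow_nonneg (hg0 x).le _))]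
    have := lintegral_lt_top_of_dyadic (F := fun x => ENNReal.ofReal (‖Du x‖ ^ p)) hgm hg1
      (κ := 1) hδ (C := 2 * K) (by positivity) fun j => ?_
    · refine lt_of_le_of_lt (le_of_eq (lintegral_congr fun x => ?_)) this
      rw [ENNReal.ofReal_mul (by positivity)]
    · have hpos : (0 : ℝ) < 2 ^ (j + 1) := by positivity
      have e1 := ofReal_integral_eq_lintegral_ofReal (h.integrable_indicator hp0 hpos)
        (.of_forall fun x => Set.indicator_nonneg (fun y _ => by positivity) x)
      have hKj := ENNReal.ofReal_le_ofReal (hK (2 ^ (j + 1)) (one_le_pow₀ one_le_two))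
      rw [e1] at hKj
      have e2 : K * 2 ^ (j + 1) = 2 * K * 2 ^ ((1 : ℝ) * j) := by
        rw [one_mul, Real.rpow_natCast]; ring
      rw [e2] at hKj
      refine le_trans ?_ ((setLIntegral_le_lintegral
        {x | 2 ^ j ≤ 1 + |u x| ∧ 1 + |u x| < 2 ^ (j + 1)} _).trans hKj)
      refine lintegral_mono_ae ?_
      filter_upwards [ae_restrict_mem₀ ((_root_.nullMeasurableSet_le aemeasurable_const hgm).inter
        (_root_.nullMeasurableSet_lt hgm aemeasurable_const))] with x hx
      have : x ∈ {x | |u x| < (2 : ℝ) ^ (j + 1)} := by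
        have h2 : 1 + |u x| < 2 ^ (j + 1) := hx.2
        show |u x| < 2 ^ (j + 1)
        linarith
      rw [Set.indicator_of_mem this]
  have I2 : Integrable (fun x => (1 + |u x|) ^ (-δ) * |b x| ^ ((N : ℝ) / (p - 1)))
      (volume.restrict Ω) := by
    refine hbi.mono' ((hgm.pow_const _).mul (hbm.abs.pow_const _)).aestronglyMeasurable
      (.of_forall fun x => ?_)
    have h1 : (1 + |u x|) ^ (-δ) ≤ 1 := Real.rpow_le_one_of_one_le_of_nonpos (hg1 x) (by linarith)
    have h2 : 0 ≤ |b x| ^ ((N : ℝ) / (p - 1)) := by positivity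
    have h3 : 0 ≤ (1 + |u x|) ^ (-δ) := Real.rpow_nonneg (hg0 x).le _
    rw [Real.norm_of_nonneg (by positivity)]
    exact mul_le_of_le_one_left h2 h1
  have I3 : Integrable (fun x => (1 + |u x|) ^ (q - δ)) (volume.restrict Ω) := by
    refine ⟨(hgm.pow_const _).aestronglyMeasurable, ?_⟩
    rw [hasFiniteIntegral_iff_ofReal (.of_forall fun x => Real.rpow_nonneg (hg0 x).le _)]
    have := lintegral_lt_top_of_dyadic (F := fun _ => 1) hgm hg1 (κ := -q) hδ hA0 fun j => ?_
    · simpa using this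
    · rw [setLIntegral_one]
      have h1 := hA (2 ^ j) (one_le_pow₀ one_le_two)
      have e2 : ((2 : ℝ) ^ j) ^ (-q) = 2 ^ (-q * j) := by
        rw [mul_comm, Real.rpow_mul two_pos.le, Real.rpow_natCast]
      rw [e2] at h1
      refine le_trans ?_ (ENNReal.ofReal_le_ofReal h1)
      rw [ofReal_measureReal]
      exact measure_mono fun x hx => hx.1
  refine ((I1.add I2).add I3).mono' (((hbm.abs.pow_const 2).mul (hgm.pow_const _)).mul
    (hDm.norm.pow_const _)).aestronglyMeasurable (.of_forall fun x => ?_)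
  have hnn : 0 ≤ |b x| ^ 2 * (1 + |u x|) ^ (2 * γ) * ‖Du x‖ ^ (2 - p) := by
    have := Real.rpow_nonneg (hg0 x).le (2 * γ)
    positivity
  rw [Real.norm_of_nonneg hnn]
  refine (weight_le hp1 hp2 (by linarith) hN2.le (abs_nonneg (b x)) (norm_nonneg (Du x))
    (hg0 x)).trans (le_of_eq ?_)
  simp only [Pi.add_apply]
  rw [← hδdef, ← hq]
  have e1 : (1 + |u x|) ^ (-1 - δ) = (1 + |u x|) ^ (-δ) / (1 + |u x|) := by
    rw [sub_eq_add_neg, add_comm (-1 : ℝ), Real.rpow_add (hg0 x), Real.rpow_neg_one, div_eq_mul_inv]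
  have e2 : (1 + |u x|) ^ (q - δ) = (1 + |u x|) ^ (-δ) * (1 + |u x|) ^ q := by
    rw [sub_eq_add_neg, add_comm q, Real.rpow_add (hg0 x)]
  rw [e1, e2]
  ring

/-- The convection terms on the region `n ≤ 1 + |u|` are negligible. -/
theorem tendsto_convection (hΩ : IsOpen Ω) (hb : Bornology.IsBounded Ω)
    (hL : HasLipschitzBoundary Ω) (hN : 2 < N) (hp1 : 1 < p) (hp2 : p ≤ 2)
    (h : HasRegularTruncations Ω Γd p u Du) {b : Space N → ℝ}
    (hbm : AEMeasurable b (volume.restrict Ω))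
    (hbi : Integrable (fun x => |b x| ^ ((N : ℝ) / (p - 1))) (volume.restrict Ω))
    {g : ℕ → Space N → ℝ} (hg0 : ∀ n x, 0 ≤ g n x)
    (hgm : ∀ n, AEMeasurable (g n) (volume.restrict Ω))
    (hgi : ∀ n, Integrable (fun x => g n x ^ p) (volume.restrict Ω))
    (hgt : Tendsto (fun n : ℕ => (1 / (n : ℝ)) * ∫ x in Ω, g n x ^ p) atTop (𝓝 0)) :
    (∀ n : ℕ, 0 < n → Integrable ({x | (n : ℝ) ≤ 1 + |u x|}.indicator
      fun x => (n : ℝ) ^ (p - 1) * |b x| * g n x) (volume.restrict Ω)) ∧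
    Tendsto (fun n : ℕ => (1 / (n : ℝ)) * ∫ x in Ω, {x | (n : ℝ) ≤ 1 + |u x|}.indicator
      (fun x => (n : ℝ) ^ (p - 1) * |b x| * g n x) x) atTop (𝓝 0) := by
  have hN2 : (2 : ℝ) < N := by exact_mod_cast hN
  have hp0 : 0 < p := by linarith
  have hpN : p < N := by linarith
  have hfin := isFiniteMeasure_restrict hb
  set q : ℝ := (N : ℝ) * (p - 1) / (N - p) with hq
  set s : ℝ := (N : ℝ) / ((p - 1) * (N - p)) with hs
  have hs0 : 0 < s := div_pos (by linarith) (mul_pos (by linarith) (by linarith))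
  obtain ⟨A, hA0, hA⟩ := h.exists_level_decay hΩ hb hL hN hp1 hp2
  set E : ℕ → Set (Space N) := fun n => {x | (n : ℝ) ≤ 1 + |u x|} with hE
  have hEm : ∀ n, NullMeasurableSet (E n) (volume.restrict Ω) := fun n =>
    _root_.nullMeasurableSet_le aemeasurable_const (h.aemeasurable.abs.const_add 1)
  set B : Space N → ℝ := fun x => |b x| ^ ((N : ℝ) / (p - 1)) with hB
  have hB0 : ∀ x, 0 ≤ B x := fun x => by positivity
  have hpt : ∀ n : ℕ, 0 < n → ∀ Λ : ℝ, 0 < Λ → ∀ x,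
      (E n).indicator (fun x => (n : ℝ) ^ (p - 1) * |b x| * g n x) x ≤
        Λ * g n x ^ p + n * (E n).indicator B x
          + n * (Λ ^ (-s) * (n : ℝ) ^ q) * (E n).indicator (fun _ => 1) x := by
    intro n hn Λ hΛ x
    have hn' : (0 : ℝ) < n := by exact_mod_cast hn
    by_cases hx : x ∈ E n
    · rw [Set.indicator_of_mem hx, Set.indicator_of_mem hx, Set.indicator_of_mem hx]
      refine (convection_le hp1 hpN (abs_nonneg (b x)) (hg0 n x) hn' hΛ).trans (le_of_eq ?_)
      simp only [hB, hs, hq]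
      field_simp
    · rw [Set.indicator_of_notMem hx, Set.indicator_of_notMem hx, Set.indicator_of_notMem hx]
      have := Real.rpow_nonneg (hg0 n x) p
      simp only [mul_zero, add_zero]
      positivity
  have hBn : ∀ n, Integrable ((E n).indicator B) (volume.restrict Ω) := fun n =>
    hbi.indicator₀ (hEm n)
  have h1n : ∀ n, Integrable ((E n).indicator fun _ => (1 : ℝ)) (volume.restrict Ω) := fun n =>
    (integrable_const (1 : ℝ)).indicator₀ (hEm n)
  have hR : ∀ (n : ℕ) (Λ : ℝ), Integrable (fun x => Λ * g n x ^ p + n * (E n).indicator B x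
      + n * (Λ ^ (-s) * (n : ℝ) ^ q) * (E n).indicator (fun _ => 1) x) (volume.restrict Ω) :=
    fun n Λ => (((hgi n).const_mul Λ).add ((hBn n).const_mul _)).add ((h1n n).const_mul _)
  have hnn : ∀ (n : ℕ) x, 0 ≤ (E n).indicator (fun x => (n : ℝ) ^ (p - 1) * |b x| * g n x) x :=
    fun n x => Set.indicator_nonneg (fun y _ => mul_nonneg (by positivity) (hg0 n y)) x
  have hInt : ∀ n : ℕ, 0 < n → Integrable ((E n).indicator
      fun x => (n : ℝ) ^ (p - 1) * |b x| * g n x) (volume.restrict Ω) := by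
    intro n hn
    refine (hR n 1).mono' (((hbm.abs.const_mul _).mul (hgm n)).indicator₀
      (hEm n)).aestronglyMeasurable (.of_forall fun x => ?_)
    rw [Real.norm_of_nonneg (hnn n x)]
    exact hpt n hn 1 one_pos x
  refine ⟨hInt, ?_⟩
  -- The sets {n ≤ 1 + |u|} shrink to the empty set, since u is finite, and |b|^(N/(p-1)) is
  -- integrable.
  have hBt : Tendsto (fun n : ℕ => ∫ x in Ω, (E n).indicator B x) atTop (𝓝 0) := by
    have := tendsto_integral_of_dominated_convergence (μ := volume.restrict Ω) (f := fun _ => 0) B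
      (F := fun n x => (E n).indicator B x) (fun n => (hBn n).1) hbi
      (fun n => .of_forall fun x => by
        rw [Real.norm_of_nonneg (Set.indicator_nonneg (fun y _ => hB0 y) x)]
        exact Set.indicator_le_self' (fun y _ => hB0 y) x)
      (.of_forall fun x => by
        refine tendsto_const_nhds.congr' ?_
        obtain ⟨n₀, hn₀⟩ := exists_nat_gt (1 + |u x|)
        filter_upwards [eventually_ge_atTop n₀] with n hn
        have hx : x ∉ E n := fun hx : (n : ℝ) ≤ 1 + |u x| => by
          have : (n₀ : ℝ) ≤ n := by exact_mod_cast hn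
          linarith
        exact (Set.indicator_of_notMem hx B).symm)
    simpa using this
  have hle : ∀ n : ℕ, 0 < n → ∀ Λ : ℝ, 0 < Λ → (1 / (n : ℝ)) * ∫ x in Ω, (E n).indicator
      (fun x => (n : ℝ) ^ (p - 1) * |b x| * g n x) x
      ≤ Λ * ((1 / (n : ℝ)) * ∫ x in Ω, g n x ^ p) + (∫ x in Ω, (E n).indicator B x)
        + Λ ^ (-s) * A := by
    intro n hn Λ hΛ
    have hn' : (0 : ℝ) < n := by exact_mod_cast hn
    have h1 := integral_mono (hInt n hn) (hR n Λ) (hpt n hn Λ hΛ)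
    have i1 : Integrable (fun x => Λ * g n x ^ p + n * (E n).indicator B x)
      (volume.restrict Ω) := ((hgi n).const_mul Λ).add ((hBn n).const_mul _)
    rw [integral_add i1 ((h1n n).const_mul _),
      integral_add ((hgi n).const_mul Λ) ((hBn n).const_mul _), integral_const_mul,
      integral_const_mul, integral_const_mul] at h1
    have e1 : ∫ x in Ω, (E n).indicator (fun _ => (1 : ℝ)) x = (volume.restrict Ω).real (E n) := by
      rw [integral_indicator₀ (hEm n), setIntegral_const, smul_eq_mul, mul_one]
    have h2 : (n : ℝ) ^ q * (volume.restrict Ω).real (E n) ≤ A := by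
      calc (n : ℝ) ^ q * (volume.restrict Ω).real (E n)
          ≤ (n : ℝ) ^ q * (A * (n : ℝ) ^ (-q)) := by
            gcongr
            exact hA n (by exact_mod_cast hn)
        _ = A := by
            rw [Real.rpow_neg hn'.le]
            field_simp
    rw [e1] at h1
    calc _ ≤ (1 / (n : ℝ)) * (Λ * (∫ x in Ω, g n x ^ p) + n * (∫ x in Ω, (E n).indicator B x)
          + n * (Λ ^ (-s) * (n : ℝ) ^ q) * (volume.restrict Ω).real (E n)) := by gcongr
      _ = Λ * ((1 / (n : ℝ)) * ∫ x in Ω, g n x ^ p) + (∫ x in Ω, (E n).indicator B x)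
          + Λ ^ (-s) * ((n : ℝ) ^ q * (volume.restrict Ω).real (E n)) := by
          field_simp
      _ ≤ _ := by gcongr
  rw [Metric.tendsto_atTop']
  intro ε hε
  -- Λ is chosen first, to make the term with A small uniformly in n; then n is large enough for the
  -- other two, with Λ fixed.
  have hΛt : Tendsto (fun Λ : ℝ => Λ ^ (-s) * A) atTop (𝓝 0) := by
    simpa using (tendsto_rpow_neg_atTop hs0).mul_const A
  obtain ⟨Λ, hΛ1, hΛ2⟩ := ((hΛt.eventually (gt_mem_nhds (half_pos hε))).and
    (eventually_gt_atTop 0)).exists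
  have ht := (hgt.const_mul Λ).add hBt
  rw [mul_zero, add_zero] at ht
  obtain ⟨n₀, hn₀⟩ := (ht.eventually (gt_mem_nhds (half_pos hε))).exists_forall_of_atTop
  refine ⟨n₀, fun n hn => ?_⟩
  have hn1 : 0 < n := by omega
  have h1 := hle n hn1 Λ hΛ2
  have h2 := hn₀ n hn.le
  have h3 : 0 ≤ (1 / (n : ℝ)) * ∫ x in Ω, (E n).indicator
      (fun x => (n : ℝ) ^ (p - 1) * |b x| * g n x) x :=
    mul_nonneg (by positivity) (integral_nonneg (hnn n))
  rw [Real.dist_eq, sub_zero, abs_of_nonneg h3]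
  linarith

end HasRegularTruncations

/-! ### Consequences of the structural assumptions; the equation as one integral -/

section Data

variable {N : ℕ} {Ω Γd : Set (Space N)}

/-- The superposition of a Carathéodory function with a measurable function is measurable. -/
theorem IsCaratheodory.aemeasurable_comp {X Y : Type*} [PseudoMetricSpace X]
    [SecondCountableTopology X] [MeasurableSpace X] [OpensMeasurableSpace X] [Nonempty X]
    [PseudoMetricSpace Y] [MeasurableSpace Y] [BorelSpace Y] {F : Space N → X → Y}
    (hF : IsCaratheodory Ω F) {w : Space N → X} (hw : AEMeasurable w (volume.restrict Ω)) :
    AEMeasurable (fun x => F x (w x)) (volume.restrict Ω) := by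
  obtain ⟨hF1, hF2⟩ := hF
  set w' := hw.mk w with hw'
  have hwm : Measurable w' := hw.measurable_mk
  obtain ⟨y₀⟩ := ‹Nonempty X›
  let s : ℕ → SimpleFunc (Space N) X := fun n =>
    SimpleFunc.approxOn w' hwm Set.univ y₀ (Set.mem_univ _) n
  have hs : ∀ n, AEMeasurable (fun x => F x (s n x)) (volume.restrict Ω) := by
    intro n
    refine ⟨fun x => (hF1 (s n x)).mk _ x,
      SimpleFunc.measurable_bind (s n) (fun ξ x => (hF1 ξ).mk _ x) fun ξ => (hF1 ξ).measurable_mk,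
      ?_⟩
    -- A simple function takes finitely many values, so the exceptional null sets of the
    -- corresponding sections can be united.
    have : ∀ᵐ x ∂(volume.restrict Ω), ∀ ξ ∈ (s n).range, F x ξ = (hF1 ξ).mk _ x :=
      (ae_ball_iff (s n).range.countable_toSet).2 fun ξ _ => (hF1 ξ).ae_eq_mk
    filter_upwards [this] with x hx
    exact hx _ (SimpleFunc.mem_range_self _ _)
  refine aemeasurable_of_tendsto_metrizable_ae atTop hs ?_
  filter_upwards [hF2, hw.ae_eq_mk] with x hx hx'
  rw [hx']
  refine (hx.tendsto _).comp (SimpleFunc.tendsto_approxOn hwm (Set.mem_univ _) ?_)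
  simp

theorem mul_le_rpow_add_rpow {p s t : ℝ} (hp : 1 < p) (hs : 0 ≤ s) (ht : 0 ≤ t) :
    s * t ≤ s ^ (p / (p - 1)) + t ^ p := by
  have hpq : Real.HolderConjugate p (p / (p - 1)) := Real.HolderConjugate.conjExponent hp
  have h := Real.young_inequality_of_nonneg hs ht hpq.symm
  have h1 := div_le_self (Real.rpow_nonneg hs (p / (p - 1))) hpq.symm.lt.le
  have h2 := div_le_self (Real.rpow_nonneg ht p) hp.le
  linarith

theorem rpow_sub_one_mul_le {p s t : ℝ} (hp : 1 < p) (hs : 0 ≤ s) (ht : 0 ≤ t) :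
    s ^ (p - 1) * t ≤ s ^ p + t ^ p := by
  have h := mul_le_rpow_add_rpow hp (Real.rpow_nonneg hs (p - 1)) ht
  rwa [← Real.rpow_mul hs, mul_div_cancel₀ _ (by linarith : p - 1 ≠ 0)] at h

variable {p α β : ℝ} {a : Space N → Space N → Space N} {lam : Space N → ℝ → ℝ}
  {Φ : Space N → ℝ → Space N} {d b f : Space N → ℝ}

namespace StructuralAssumptions

theorem integrable_d (hp1 : 1 < p) (hdata : StructuralAssumptions Ω p α β a lam Φ d b f) :
    Integrable (fun x => |d x| ^ (p / (p - 1))) (volume.restrict Ω) := by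
  have h0 : 0 < p / (p - 1) := div_pos (by linarith) (by linarith)
  have := hdata.d_mem.integrable_norm_rpow (by simpa using h0) ENNReal.ofReal_ne_top
  rwa [ENNReal.toReal_ofReal h0.le] at this

theorem integrable_b (hN : 2 < N) (hp1 : 1 < p)
    (hdata : StructuralAssumptions Ω p α β a lam Φ d b f) :
    Integrable (fun x => |b x| ^ ((N : ℝ) / (p - 1))) (volume.restrict Ω) := by
  have hN' : (2 : ℝ) < N := by exact_mod_cast hN
  have h0 : 0 < (N : ℝ) / (p - 1) := div_pos (by linarith) (by linarith)
  have := hdata.b_mem.integrable_norm_rpow (by simpa using h0) ENNReal.ofReal_ne_top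
  rwa [ENNReal.toReal_ofReal h0.le] at this

theorem aemeasurable_b (hdata : StructuralAssumptions Ω p α β a lam Φ d b f) :
    AEMeasurable b (volume.restrict Ω) := hdata.b_mem.1.aemeasurable

/-- The conjugate exponent p/(p-1) is below N/(p-1) because p ≤ N, and Ω has finite measure. -/
theorem integrable_b_conj [IsFiniteMeasure (volume.restrict Ω)] (hN : 2 < N) (hp1 : 1 < p)
    (hp2 : p ≤ 2) (hdata : StructuralAssumptions Ω p α β a lam Φ d b f) :
    Integrable (fun x => |b x| ^ (p / (p - 1))) (volume.restrict Ω) := by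
  have hN' : (2 : ℝ) < N := by exact_mod_cast hN
  have h0 : 0 < p / (p - 1) := div_pos (by linarith) (by linarith)
  refine ((integrable_const (1 : ℝ)).add (hdata.integrable_b hN hp1)).mono'
    (hdata.aemeasurable_b.abs.pow_const _).aestronglyMeasurable (.of_forall fun x => ?_)
  rw [Real.norm_of_nonneg (by positivity)]
  simp only [Pi.add_apply]
  rcases le_total |b x| 1 with h | h
  · have h1 := Real.rpow_le_one (abs_nonneg (b x)) h h0.le
    have h2 : 0 ≤ |b x| ^ ((N : ℝ) / (p - 1)) := by positivity
    linarith
  · have h1 := Real.rpow_le_rpow_of_exponent_le h (div_le_div_of_nonneg_right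
      (by linarith : p ≤ N) (by linarith : 0 ≤ p - 1))
    linarith

theorem aemeasurable_a (hdata : StructuralAssumptions Ω p α β a lam Φ d b f)
    {w : Space N → Space N} (hw : AEMeasurable w (volume.restrict Ω)) :
    AEMeasurable (fun x => a x (w x)) (volume.restrict Ω) :=
  hdata.caratheodory_a.aemeasurable_comp hw

theorem norm_a_mul_le (hp1 : 1 < p) (hdata : StructuralAssumptions Ω p α β a lam Φ d b f) :
    ∀ᵐ x ∂(volume.restrict Ω), ∀ ξ, ∀ t, 0 ≤ t →
      ‖a x ξ‖ * t ≤ |β| * (|d x| ^ (p / (p - 1)) + ‖ξ‖ ^ p + 2 * t ^ p) := by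
  filter_upwards [hdata.growth_a] with x hx ξ t ht
  have h1 := mul_le_rpow_add_rpow hp1 (abs_nonneg (d x)) ht
  have h2 := rpow_sub_one_mul_le hp1 (norm_nonneg ξ) ht
  have h3 : 0 ≤ |d x| + ‖ξ‖ ^ (p - 1) := by positivity
  calc ‖a x ξ‖ * t ≤ (|β| * (|d x| + ‖ξ‖ ^ (p - 1))) * t :=
        mul_le_mul_of_nonneg_right ((hx ξ).trans
          (mul_le_mul_of_nonneg_right (le_abs_self β) h3)) ht
    _ = |β| * (|d x| * t + ‖ξ‖ ^ (p - 1) * t) := by ring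
    _ ≤ _ := mul_le_mul_of_nonneg_left (by linarith) (abs_nonneg β)

end StructuralAssumptions

theorem setIntegral_inter_eq_integral_indicator {E : Set (Space N)} {F : Space N → ℝ}
    (hE : NullMeasurableSet E (volume.restrict Ω)) :
    ∫ x in Ω ∩ E, F x = ∫ x in Ω, E.indicator F x := by
  rw [integral_indicator₀ hE, Measure.restrict_restrict₀ hE, Set.inter_comm]

/-- Coercivity converts the decay of the a-energy into that of ∫ |Du|^p; the growth of a is used
only to make the a-energy integrable, so that the two integrals can be compared. -/
theorem IsRenormalizedSolution.hasRegularTruncations (hΩ : IsOpen Ω) (hp1 : 1 < p)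
    (hdata : StructuralAssumptions Ω p α β a lam Φ d b f) {u : Space N → ℝ}
    {Du : Space N → Space N} (hu : AEMeasurable u (volume.restrict Ω))
    (htr : ∀ k > 0, MemSobolevNullTrace Ω Γd (ENNReal.ofReal p) (fun x => trunc k (u x)))
    (hDu : IsGeneralizedGradient Ω u Du)
    (hdec : Tendsto (fun n : ℕ =>
      (1 / (n : ℝ)) * ∫ x in Ω ∩ {x | |u x| < (n : ℝ)}, inner ℝ (a x (Du x)) (Du x))
      atTop (𝓝 0)) : HasRegularTruncations Ω Γd p u Du := by
  have hp0 : 0 < p := by linarith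
  have htriple : ∀ k, 0 < k → ∃ g, SobolevTriple Ω (ENNReal.ofReal p) (fun x => trunc k (u x))
      ({x | |u x| < k}.indicator Du) g ∧ ∀ᵐ x ∂(surfaceMeasure Ω), x ∈ Γd → g x = 0 :=
    fun k hk => (htr k hk).exists_triple hΩ (hDu.2 k hk)
  refine ⟨hu, hDu.1, htriple, ?_⟩
  have hEm : ∀ t : ℝ, NullMeasurableSet {x | |u x| < t} (volume.restrict Ω) := fun t =>
    nullMeasurableSet_lt hu.abs aemeasurable_const
  have hDi : ∀ t : ℝ, 0 < t →
      Integrable ({x | |u x| < t}.indicator fun x => ‖Du x‖ ^ p) (volume.restrict Ω) := by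
    intro t ht
    obtain ⟨g, hg, -⟩ := htriple t ht
    have := hg.memLp_grad.integrable_norm_rpow (by simpa using hp0) ENNReal.ofReal_ne_top
    rw [ENNReal.toReal_ofReal hp0.le] at this
    refine this.congr (.of_forall fun x => ?_)
    by_cases hx : |u x| < t <;> simp [hx, hp0.ne']
  have hIi : ∀ t : ℝ, 0 < t → Integrable ({x | |u x| < t}.indicator
      fun x => inner ℝ (a x (Du x)) (Du x)) (volume.restrict Ω) := by
    intro t ht
    refine (((hdata.integrable_d hp1).add ((hDi t ht).const_mul 3)).const_mul |β|).mono'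
      (((hdata.aemeasurable_a hDu.1).inner hDu.1).indicator₀ (hEm t)).aestronglyMeasurable ?_
    filter_upwards [hdata.norm_a_mul_le hp1] with x hx
    simp only [Pi.add_apply]
    by_cases hxt : x ∈ {x | |u x| < t}
    · rw [Set.indicator_of_mem hxt, Set.indicator_of_mem hxt]
      refine (norm_inner_le_norm _ _).trans ((hx _ _ (norm_nonneg _)).trans (le_of_eq ?_))
      ring
    · rw [Set.indicator_of_notMem hxt, Set.indicator_of_notMem hxt]
      simp only [norm_zero, mul_zero, add_zero]
      positivity
  have hlim := hdec.const_mul α⁻¹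
  rw [mul_zero] at hlim
  refine tendsto_of_tendsto_of_tendsto_of_le_of_le' tendsto_const_nhds hlim
    (.of_forall fun n => mul_nonneg (by positivity)
      (integral_nonneg fun x => Set.indicator_nonneg (fun y _ => by positivity) x)) ?_
  filter_upwards [eventually_gt_atTop 0] with n hn
  have hn' : (0 : ℝ) < n := by exact_mod_cast hn
  have hα := hdata.α_pos
  rw [setIntegral_inter_eq_integral_indicator (hEm n), mul_left_comm α⁻¹,
    ← integral_const_mul α⁻¹]
  refine mul_le_mul_of_nonneg_left (integral_mono_ae (hDi n hn') ((hIi n hn').const_mul _) ?_)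
    (by positivity)
  filter_upwards [hdata.coercive] with x hx
  by_cases hxt : x ∈ {x | |u x| < (n : ℝ)}
  · simp only [Set.indicator_of_mem hxt]
    rw [← div_eq_inv_mul, le_div_iff₀ hα, mul_comm]
    exact hx _
  · simp only [Set.indicator_of_notMem hxt, mul_zero, le_refl]

/-- The integrand of the renormalized equation for the renormalization `cutoff (· / n)`. -/
noncomputable def residual (a : Space N → Space N → Space N) (lam : Space N → ℝ → ℝ)
    (Φ : Space N → ℝ → Space N) (f : Space N → ℝ) (u : Space N → ℝ) (Du : Space N → Space N)
    (n : ℕ) (φ : Space N → ℝ) (Dφ : Space N → Space N) (x : Space N) : ℝ :=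
  lam x (u x) * φ x * cutoff (u x / n) + cutoff (u x / n) * inner ℝ (a x (Du x)) (Dφ x)
    + cutoff (u x / n) * inner ℝ (Φ x (u x)) (Dφ x)
    + φ x * (deriv cutoff (u x / n) / n) * inner ℝ (a x (Du x)) (Du x)
    + φ x * (deriv cutoff (u x / n) / n) * inner ℝ (Φ x (u x)) (Du x)
    - f x * φ x * cutoff (u x / n)

/-- The equation satisfied by a renormalized solution, as a single integral. -/
def SatisfiesEquation (Ω Γd : Set (Space N)) (p : ℝ) (a : Space N → Space N → Space N)
    (lam : Space N → ℝ → ℝ) (Φ : Space N → ℝ → Space N) (f : Space N → ℝ) (u : Space N → ℝ)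
    (Du : Space N → Space N) : Prop :=
  ∀ (n : ℕ) (φ g : Space N → ℝ) (Dφ : Space N → Space N), 0 < n →
    SobolevTriple Ω (ENNReal.ofReal p) φ Dφ g →
    (∀ᵐ x ∂(surfaceMeasure Ω), x ∈ Γd → g x = 0) → (∀ x, |φ x| ≤ 1) →
    Integrable (residual a lam Φ f u Du n φ Dφ) (volume.restrict Ω) ∧
      ∫ x in Ω, residual a lam Φ f u Du n φ Dφ x = 0

theorem abs_div_natCast_lt {n : ℕ} (hn : 0 < n) {s c : ℝ} : |s / n| < c ↔ |s| < c * n := by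
  have hn' : (0 : ℝ) < n := by exact_mod_cast hn
  rw [abs_div, abs_of_pos hn', div_lt_iff₀ hn']

theorem cutoff_div_eq_zero {n : ℕ} (hn : 0 < n) {s : ℝ} (h : 2 * n ≤ |s|) :
    cutoff (s / n) = 0 :=
  cutoff_eq_zero (not_lt.1 fun h' => not_lt.2 h ((abs_div_natCast_lt hn).1 h'))

theorem deriv_cutoff_div_eq_zero {n : ℕ} (hn : 0 < n) {s : ℝ} (h : 2 * n ≤ |s|) :
    deriv cutoff (s / n) = 0 :=
  deriv_cutoff_eq_zero_of_le (not_lt.1 fun h' => not_lt.2 h ((abs_div_natCast_lt hn).1 h'))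

/-- The renormalization `cutoff` (· / n) confines every term except the source to {|u| < 2n}, where
Du is in L^p and the growth conditions bound `lam`, a and Φ. All six terms are then integrable, and
the separate integrals of the definition merge into a single one that can later be compared
pointwise. -/
theorem IsRenormalizedSolution.exists_satisfiesEquation (hΩ : IsOpen Ω)
    (hb : Bornology.IsBounded Ω) (hN : 2 < N) (hp1 : 1 < p) (hp2 : p ≤ 2)
    (hdata : StructuralAssumptions Ω p α β a lam Φ d b f) {u : Space N → ℝ}
    (hu : IsRenormalizedSolution Ω Γd p a lam Φ f u) :
    ∃ Du, HasRegularTruncations Ω Γd p u Du ∧ SatisfiesEquation Ω Γd p a lam Φ f u Du := by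
  have hfin := isFiniteMeasure_restrict hb
  have hp0 : 0 < p := by linarith
  have hq1 : 1 ≤ ENNReal.ofReal p := by simpa using ENNReal.ofReal_le_ofReal hp1.le
  obtain ⟨hum, htr, Du, hDu, hdec, heq⟩ := hu
  have hreg := IsRenormalizedSolution.hasRegularTruncations hΩ hp1 hdata hum htr hDu hdec
  refine ⟨Du, hreg, fun n φ g Dφ hn hφ hg hφ1 => ?_⟩
  have hn' : (0 : ℝ) < n := by exact_mod_cast hn
  have hn1 : (1 : ℝ) ≤ n := by exact_mod_cast hn
  obtain ⟨C, hC0, hC⟩ := exists_deriv_cutoff_bound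
  have hderiv : ∀ s : ℝ, deriv (fun s => cutoff (s / n)) s = deriv cutoff (s / n) / n :=
    fun s => (hasDerivAt_cutoff_div s).deriv
  have hφ_bdd : MemLp φ ⊤ (volume.restrict Ω) :=
    memLp_top_of_bound hφ.memLp.1 1 (.of_forall fun x => hφ1 x)
  have hE := heq (fun s => cutoff (s / n)) φ Dφ
    ⟨(C / n).toNNReal, LipschitzWith.of_dist_le_mul fun s t => by
      rw [Real.dist_eq, Real.dist_eq, Real.coe_toNNReal _ (by positivity)]
      exact abs_cutoff_sub_le hC hn' s t⟩
    (HasCompactSupport.intro (isCompact_Icc (a := -(2 * n : ℝ)) (b := 2 * n)) fun s hs => by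
      refine cutoff_div_eq_zero hn (not_lt.1 fun h => hs ?_)
      rw [abs_lt] at h
      exact ⟨h.1.le, h.2.le⟩)
    (hφ.memSobolevNullTrace hb hq1 hg) hφ_bdd (hφ.hasWeakGradient hb hq1)
  simp only [hderiv] at hE
  have hφm := hφ.memLp.1.aemeasurable
  have hDφm := hφ.memLp_grad.1.aemeasurable
  have hDum := hreg.aemeasurable_grad
  have hhm : AEMeasurable (fun x => cutoff (u x / n)) (volume.restrict Ω) :=
    cutoff.continuous.measurable.comp_aemeasurable (hum.div_const _)
  have hh'm : AEMeasurable (fun x => deriv cutoff (u x / n) / n) (volume.restrict Ω) :=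
    (continuous_deriv_cutoff.measurable.comp_aemeasurable (hum.div_const _)).div_const _
  have hlm : AEMeasurable (fun x => lam x (u x)) (volume.restrict Ω) :=
    hdata.caratheodory_lam.aemeasurable_comp hum
  have hΦm : AEMeasurable (fun x => Φ x (u x)) (volume.restrict Ω) :=
    hdata.caratheodory_Φ.aemeasurable_comp hum
  have ham := hdata.aemeasurable_a hDum
  have hDφi : Integrable (fun x => ‖Dφ x‖ ^ p) (volume.restrict Ω) := by
    have := hφ.memLp_grad.integrable_norm_rpow (by simpa using hp0) ENNReal.ofReal_ne_top
    rwa [ENNReal.toReal_ofReal hp0.le] at this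
  have hDui := hreg.integrable_indicator hp0 (t := 2 * n) (by positivity)
  have hdi := hdata.integrable_d hp1
  have hbi := hdata.integrable_b_conj hN hp1 hp2
  set G : Space N → ℝ := {x | |u x| < 2 * (n : ℝ)}.indicator fun x => ‖Du x‖ ^ p with hG
  have hG0 : ∀ x, 0 ≤ G x := fun x => Set.indicator_nonneg (fun y _ => by positivity) x
  obtain ⟨c, hc0, hc⟩ := hdata.bound_lam (2 * n) (by positivity)
  have habsφ : ∀ x, |φ x * (deriv cutoff (u x / n) / n)| ≤ C := fun x => by
    rw [abs_mul, abs_div, abs_of_pos hn']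
    calc |φ x| * (|deriv cutoff (u x / n)| / n) ≤ 1 * (C / 1) := by
          gcongr
          · exact hφ1 x
          · exact hC _
      _ = C := by ring
  have habsh : ∀ x, |cutoff (u x / n)| ≤ 1 := fun x => by
    rw [abs_of_nonneg (cutoff_nonneg _)]
    exact cutoff_le_one _
  -- bounds on the fluxes where the renormalization does not vanish
  have hflux : ∀ᵐ x ∂(volume.restrict Ω), |u x| < 2 * n → ∀ t, 0 ≤ t →
      ‖a x (Du x)‖ * t ≤ |β| * (|d x| ^ (p / (p - 1)) + G x + 2 * t ^ p) ∧
      ‖Φ x (u x)‖ * t ≤ (1 + 2 * n) ^ (p - 1) * (|b x| ^ (p / (p - 1)) + t ^ p) := by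
    filter_upwards [hdata.norm_a_mul_le hp1, hdata.growth_Φ] with x hx1 hx2 hxu t ht
    refine ⟨?_, ?_⟩
    · rw [hG, Set.indicator_of_mem (show x ∈ {x | |u x| < 2 * (n : ℝ)} from hxu)]
      exact hx1 _ t ht
    · have h1 := mul_le_rpow_add_rpow hp1 (abs_nonneg (b x)) ht
      have hp1' : 0 ≤ p - 1 := by linarith
      calc ‖Φ x (u x)‖ * t ≤ |b x| * (1 + 2 * n) ^ (p - 1) * t := by
            refine mul_le_mul_of_nonneg_right ((hx2 _).trans ?_) ht
            gcongr
        _ = (1 + 2 * n) ^ (p - 1) * (|b x| * t) := by ring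
        _ ≤ _ := by gcongr
  have I1 : Integrable (fun x => lam x (u x) * φ x * cutoff (u x / n)) (volume.restrict Ω) := by
    refine (integrable_const c).mono' ((hlm.mul hφm).mul hhm).aestronglyMeasurable ?_
    filter_upwards [hc] with x hx
    by_cases hxu : |u x| < 2 * n
    · rw [Real.norm_eq_abs, abs_mul, abs_mul]
      calc _ ≤ c * 1 * 1 := by
            gcongr
            · exact hx _ hxu.le
            · exact hφ1 x
            · exact habsh x
        _ = c := by ring
    · rw [cutoff_div_eq_zero hn (not_lt.1 hxu)]
      simpa using hc0.le
  have I2 : Integrable (fun x => cutoff (u x / n) * inner ℝ (a x (Du x)) (Dφ x))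
      (volume.restrict Ω) := by
    have i : Integrable (fun x => |β| * (|d x| ^ (p / (p - 1)) + G x + 2 * ‖Dφ x‖ ^ p))
      (volume.restrict Ω) := ((hdi.add hDui).add (hDφi.const_mul 2)).const_mul _
    refine i.mono' (hhm.mul (ham.inner hDφm)).aestronglyMeasurable ?_
    filter_upwards [hflux] with x hx
    by_cases hxu : |u x| < 2 * n
    · rw [norm_mul]
      refine (mul_le_of_le_one_left (norm_nonneg _) (habsh x)).trans
        ((norm_inner_le_norm _ _).trans (hx hxu _ (norm_nonneg _)).1)
    · rw [cutoff_div_eq_zero hn (not_lt.1 hxu)]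
      have := hG0 x
      simp only [zero_mul, norm_zero]
      positivity
  have I3 : Integrable (fun x => cutoff (u x / n) * inner ℝ (Φ x (u x)) (Dφ x))
      (volume.restrict Ω) := by
    have i : Integrable (fun x => (1 + 2 * (n : ℝ)) ^ (p - 1)
      * (|b x| ^ (p / (p - 1)) + ‖Dφ x‖ ^ p)) (volume.restrict Ω) :=
      (hbi.add hDφi).const_mul _
    refine i.mono' (hhm.mul (hΦm.inner hDφm)).aestronglyMeasurable ?_
    filter_upwards [hflux] with x hx
    by_cases hxu : |u x| < 2 * n
    · rw [norm_mul]
      refine (mul_le_of_le_one_left (norm_nonneg _) (habsh x)).trans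
        ((norm_inner_le_norm _ _).trans (hx hxu _ (norm_nonneg _)).2)
    · rw [cutoff_div_eq_zero hn (not_lt.1 hxu)]
      simp only [zero_mul, norm_zero]
      positivity
  have hGx : ∀ x, |u x| < 2 * n → ‖Du x‖ ^ p = G x := fun x hx => by
    rw [hG, Set.indicator_of_mem (show x ∈ {x | |u x| < 2 * (n : ℝ)} from hx)]
  have I4 : Integrable (fun x => φ x * (deriv cutoff (u x / n) / n)
      * inner ℝ (a x (Du x)) (Du x)) (volume.restrict Ω) := by
    have i : Integrable (fun x => C * (|β| * (|d x| ^ (p / (p - 1)) + G x + 2 * G x)))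
      (volume.restrict Ω) := (((hdi.add hDui).add (hDui.const_mul 2)).const_mul _).const_mul _
    refine i.mono' ((hφm.mul hh'm).mul (ham.inner hDum)).aestronglyMeasurable ?_
    filter_upwards [hflux] with x hx
    by_cases hxu : |u x| < 2 * n
    · rw [norm_mul]
      have h1 := (hx hxu _ (norm_nonneg (Du x))).1
      rw [hGx x hxu] at h1
      exact mul_le_mul (habsφ x) ((norm_inner_le_norm _ _).trans h1) (norm_nonneg _) hC0.le
    · rw [deriv_cutoff_div_eq_zero hn (not_lt.1 hxu)]
      have := hG0 x
      simp only [zero_div, mul_zero, zero_mul, norm_zero]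
      positivity
  have I5 : Integrable (fun x => φ x * (deriv cutoff (u x / n) / n)
      * inner ℝ (Φ x (u x)) (Du x)) (volume.restrict Ω) := by
    have i : Integrable (fun x => C * ((1 + 2 * (n : ℝ)) ^ (p - 1)
      * (|b x| ^ (p / (p - 1)) + G x))) (volume.restrict Ω) :=
      ((hbi.add hDui).const_mul _).const_mul _
    refine i.mono' ((hφm.mul hh'm).mul (hΦm.inner hDum)).aestronglyMeasurable ?_
    filter_upwards [hflux] with x hx
    by_cases hxu : |u x| < 2 * n
    · rw [norm_mul]
      have h1 := (hx hxu _ (norm_nonneg (Du x))).2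
      rw [hGx x hxu] at h1
      exact mul_le_mul (habsφ x) ((norm_inner_le_norm _ _).trans h1) (norm_nonneg _) hC0.le
    · rw [deriv_cutoff_div_eq_zero hn (not_lt.1 hxu)]
      have := hG0 x
      simp only [zero_div, mul_zero, zero_mul, norm_zero]
      positivity
  have hfi : Integrable f (volume.restrict Ω) := memLp_one_iff_integrable.1 hdata.f_mem
  have I6 : Integrable (fun x => f x * φ x * cutoff (u x / n)) (volume.restrict Ω) := by
    refine hfi.norm.mono' ((hfi.1.aemeasurable.mul hφm).mul hhm).aestronglyMeasurable
      (.of_forall fun x => ?_)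
    rw [norm_mul, norm_mul, mul_assoc]
    exact mul_le_of_le_one_right (norm_nonneg _)
      (mul_le_one₀ (hφ1 x) (norm_nonneg _) (habsh x))
  have J2 := I1.add I2
  have J3 := J2.add I3
  have J4 := J3.add I4
  have J5 := J4.add I5
  refine ⟨J5.sub I6, ?_⟩
  have e := integral_sub J5 I6
  rw [integral_add' J4 I5, integral_add' J3 I4, integral_add' J2 I3, integral_add' I1 I2, hE,
    sub_self] at e
  exact e

end Data

/-! ### Fluxes near high levels and integrability of the zero order term -/

section FluxError

variable {N : ℕ} {Ω Γd : Set (Space N)} {p α β : ℝ} {a : Space N → Space N → Space N}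
  {lam : Space N → ℝ → ℝ} {Φ : Space N → ℝ → Space N} {d b f : Space N → ℝ}
  {u v : Space N → ℝ} {Du Dv : Space N → Space N}

theorem add_rpow_le_four_mul {p s t : ℝ} (hp0 : 0 < p) (hp2 : p ≤ 2) (hs : 0 ≤ s) (ht : 0 ≤ t) :
    (s + t) ^ p ≤ 4 * (s ^ p + t ^ p) := by
  have h2 : (2 : ℝ) ^ p ≤ 4 := by
    calc (2 : ℝ) ^ p ≤ 2 ^ (2 : ℝ) := Real.rpow_le_rpow_of_exponent_le one_le_two hp2
      _ = 4 := by norm_num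
  have key : ∀ r : ℝ, 0 ≤ r → s + t ≤ 2 * r → (s + t) ^ p ≤ 4 * r ^ p := fun r hr h => by
    calc (s + t) ^ p ≤ (2 * r) ^ p := Real.rpow_le_rpow (by positivity) h hp0.le
      _ = 2 ^ p * r ^ p := Real.mul_rpow two_pos.le hr
      _ ≤ 4 * r ^ p := by gcongr
  have h3 := Real.rpow_nonneg hs p
  have h4 := Real.rpow_nonneg ht p
  rcases le_total s t with h | h
  · linarith [key t ht (by linarith)]
  · linarith [key s hs (by linarith)]

/-- The sum of the norms of the gradients of the truncations at height `2 n + 1`. -/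
noncomputable def jointNorm (u : Space N → ℝ) (Du : Space N → Space N) (v : Space N → ℝ)
    (Dv : Space N → Space N) (n : ℕ) (x : Space N) : ℝ :=
  {x | |u x| < 2 * (n : ℝ) + 1}.indicator (fun x => ‖Du x‖) x
    + {x | |v x| < 2 * (n : ℝ) + 1}.indicator (fun x => ‖Dv x‖) x

theorem jointNorm_nonneg (n : ℕ) (x : Space N) : 0 ≤ jointNorm u Du v Dv n x :=
  add_nonneg (Set.indicator_nonneg (fun _ _ => norm_nonneg _) _)
    (Set.indicator_nonneg (fun _ _ => norm_nonneg _) _)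

theorem norm_left_le_jointNorm {n : ℕ} {x : Space N} (h : |u x| < 2 * n + 1) :
    ‖Du x‖ ≤ jointNorm u Du v Dv n x := by
  rw [jointNorm, Set.indicator_of_mem (show x ∈ {x | |u x| < 2 * (n : ℝ) + 1} from h)]
  exact le_add_of_nonneg_right (Set.indicator_nonneg (fun _ _ => norm_nonneg _) _)

theorem norm_right_le_jointNorm {n : ℕ} {x : Space N} (h : |v x| < 2 * n + 1) :
    ‖Dv x‖ ≤ jointNorm u Du v Dv n x := by
  rw [jointNorm, Set.indicator_of_mem (s := {x | |v x| < 2 * (n : ℝ) + 1}) (a := x) h]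
  exact le_add_of_nonneg_left (Set.indicator_nonneg (fun _ _ => norm_nonneg _) _)

theorem jointNorm_eq {n : ℕ} {x : Space N} (h : |u x| < 2 * n + 1) (h' : |v x| < 2 * n + 1) :
    jointNorm u Du v Dv n x = ‖Du x‖ + ‖Dv x‖ := by
  rw [jointNorm, Set.indicator_of_mem (s := {x | |u x| < 2 * (n : ℝ) + 1}) (a := x) h,
    Set.indicator_of_mem (s := {x | |v x| < 2 * (n : ℝ) + 1}) (a := x) h']

theorem aemeasurable_jointNorm (hu : HasRegularTruncations Ω Γd p u Du)
    (hv : HasRegularTruncations Ω Γd p v Dv) (n : ℕ) :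
    AEMeasurable (jointNorm u Du v Dv n) (volume.restrict Ω) :=
  (hu.aemeasurable_grad.norm.indicator₀ (hu.nullMeasurableSet_lt _)).add
    (hv.aemeasurable_grad.norm.indicator₀ (hv.nullMeasurableSet_lt _))

theorem jointNorm_rpow_le (hp0 : 0 < p) (hp2 : p ≤ 2) (n : ℕ) (x : Space N) :
    jointNorm u Du v Dv n x ^ p ≤
      4 * ({x | |u x| < 2 * (n : ℝ) + 1}.indicator (fun x => ‖Du x‖ ^ p) x
        + {x | |v x| < 2 * (n : ℝ) + 1}.indicator (fun x => ‖Dv x‖ ^ p) x) := by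
  refine (add_rpow_le_four_mul hp0 hp2 (Set.indicator_nonneg (fun _ _ => norm_nonneg _) _)
    (Set.indicator_nonneg (fun _ _ => norm_nonneg _) _)).trans (le_of_eq ?_)
  by_cases h1 : |u x| < 2 * (n : ℝ) + 1 <;> by_cases h2 : |v x| < 2 * (n : ℝ) + 1 <;>
    simp [h1, h2, hp0.ne']

theorem integrable_jointNorm_rpow (hp0 : 0 < p) (hp2 : p ≤ 2)
    (hu : HasRegularTruncations Ω Γd p u Du) (hv : HasRegularTruncations Ω Γd p v Dv) (n : ℕ) :
    Integrable (fun x => jointNorm u Du v Dv n x ^ p) (volume.restrict Ω) := by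
  refine (((hu.integrable_indicator hp0 (t := 2 * n + 1) (by positivity)).add
    (hv.integrable_indicator hp0 (t := 2 * n + 1) (by positivity))).const_mul 4).mono'
    ((aemeasurable_jointNorm hu hv n).pow_const _).aestronglyMeasurable (.of_forall fun x => ?_)
  rw [Real.norm_of_nonneg (Real.rpow_nonneg (jointNorm_nonneg n x) p)]
  exact jointNorm_rpow_le hp0 hp2 n x

theorem HasRegularTruncations.tendsto_decay (hu : HasRegularTruncations Ω Γd p u Du) :
    Tendsto (fun n : ℕ => (1 / (n : ℝ)) *
      ∫ x in Ω, {x | |u x| < 2 * (n : ℝ) + 1}.indicator (fun x => ‖Du x‖ ^ p) x)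
      atTop (𝓝 0) := by
  have hφ : Tendsto (fun n : ℕ => 2 * n + 1) atTop atTop :=
    tendsto_atTop_mono (fun n => show n ≤ 2 * n + 1 by omega) tendsto_id
  -- Decay along the integers 2n + 1, and 2n + 1 ≤ 3n for n ≥ 1.
  have h := (hu.decay.comp hφ).const_mul 3
  rw [mul_zero] at h
  refine tendsto_of_tendsto_of_tendsto_of_le_of_le' tendsto_const_nhds h
    (.of_forall fun n => mul_nonneg (by positivity)
      (integral_nonneg fun x => Set.indicator_nonneg (fun y _ => by positivity) x)) ?_
  filter_upwards [eventually_gt_atTop 0] with n hn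
  have hn' : (1 : ℝ) ≤ n := by exact_mod_cast hn
  have hn0 : (0 : ℝ) < n := by linarith
  simp only [Function.comp_apply]
  push_cast
  rw [← mul_assoc]
  refine mul_le_mul_of_nonneg_right ?_
    (integral_nonneg fun x => Set.indicator_nonneg (fun y _ => by positivity) x)
  rw [mul_one_div, div_le_div_iff₀ hn0 (by positivity)]
  linarith

theorem tendsto_jointNorm (hp0 : 0 < p) (hp2 : p ≤ 2) (hu : HasRegularTruncations Ω Γd p u Du)
    (hv : HasRegularTruncations Ω Γd p v Dv) :
    Tendsto (fun n : ℕ => (1 / (n : ℝ)) * ∫ x in Ω, jointNorm u Du v Dv n x ^ p)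
      atTop (𝓝 0) := by
  have h := (hu.tendsto_decay.add hv.tendsto_decay).const_mul 4
  simp only [add_zero, mul_zero] at h
  refine squeeze_zero (fun n => mul_nonneg (by positivity)
    (integral_nonneg fun x => Real.rpow_nonneg (jointNorm_nonneg n x) p)) (fun n => ?_) h
  have i1 := hu.integrable_indicator hp0 (t := 2 * n + 1) (by positivity)
  have i2 := hv.integrable_indicator hp0 (t := 2 * n + 1) (by positivity)
  have := integral_mono (integrable_jointNorm_rpow hp0 hp2 hu hv n) ((i1.add i2).const_mul 4)
    (jointNorm_rpow_le hp0 hp2 n)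
  rw [integral_const_mul, integral_add' i1 i2] at this
  calc _ ≤ (1 / (n : ℝ)) * _ := mul_le_mul_of_nonneg_left this (by positivity)
    _ = _ := by ring

/-- A bound for the fluxes through the level sets of `w` between `n - 1` and `2 n + 1`. -/
noncomputable def fluxError (p : ℝ) (d b w : Space N → ℝ) (g : ℕ → Space N → ℝ) (n : ℕ)
    (x : Space N) : ℝ :=
  (1 / (n : ℝ)) * (|d x| ^ (p / (p - 1)) + g n x ^ p
    + {x | (n : ℝ) ≤ 1 + |w x|}.indicator (fun x => (n : ℝ) ^ (p - 1) * |b x| * g n x) x)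

theorem fluxError_nonneg {w : Space N → ℝ} {g : ℕ → Space N → ℝ} (hg0 : ∀ n x, 0 ≤ g n x)
    (n : ℕ) (x : Space N) : 0 ≤ fluxError p d b w g n x := by
  have h1 := Real.rpow_nonneg (hg0 n x) p
  have h2 : 0 ≤ {x | (n : ℝ) ≤ 1 + |w x|}.indicator
      (fun x => (n : ℝ) ^ (p - 1) * |b x| * g n x) x :=
    Set.indicator_nonneg (fun y _ => mul_nonneg (by positivity) (hg0 n y)) x
  unfold fluxError
  positivity

/-- The term with d is a fixed integral divided by n, the term with g^p vanishes by assumption, and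
the convection term by `tendsto_convection`. -/
theorem fluxError_tendsto (hΩ : IsOpen Ω) (hb : Bornology.IsBounded Ω)
    (hL : HasLipschitzBoundary Ω) (hN : 2 < N) (hp1 : 1 < p) (hp2 : p ≤ 2)
    (hdata : StructuralAssumptions Ω p α β a lam Φ d b f)
    {w : Space N → ℝ} {Dw : Space N → Space N} (hw : HasRegularTruncations Ω Γd p w Dw)
    {g : ℕ → Space N → ℝ} (hg0 : ∀ n x, 0 ≤ g n x)
    (hgm : ∀ n, AEMeasurable (g n) (volume.restrict Ω))
    (hgi : ∀ n, Integrable (fun x => g n x ^ p) (volume.restrict Ω))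
    (hgt : Tendsto (fun n : ℕ => (1 / (n : ℝ)) * ∫ x in Ω, g n x ^ p) atTop (𝓝 0)) :
    (∀ n : ℕ, 0 < n → Integrable (fluxError p d b w g n) (volume.restrict Ω)) ∧
    Tendsto (fun n : ℕ => ∫ x in Ω, fluxError p d b w g n x) atTop (𝓝 0) := by
  obtain ⟨h1, h2⟩ := hw.tendsto_convection hΩ hb hL hN hp1 hp2 hdata.aemeasurable_b
    (hdata.integrable_b hN hp1) hg0 hgm hgi hgt
  have hdi := hdata.integrable_d hp1
  have i1 : ∀ n, Integrable (fun x => |d x| ^ (p / (p - 1)) + g n x ^ p) (volume.restrict Ω) :=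
    fun n => hdi.add (hgi n)
  refine ⟨fun n hn => ((i1 n).add (h1 n hn)).const_mul _, ?_⟩
  have h3 := (tendsto_one_div_atTop_nhds_zero_nat (𝕜 := ℝ)).mul_const
    (∫ x in Ω, |d x| ^ (p / (p - 1)))
  rw [zero_mul] at h3
  have h4 := (h3.add hgt).add h2
  simp only [add_zero] at h4
  refine h4.congr' ?_
  filter_upwards [eventually_gt_atTop 0] with n hn
  unfold fluxError
  rw [integral_const_mul, integral_add (i1 n) (h1 n hn), integral_add hdi (hgi n)]
  ring

/-- On these levels 1 + |w| ≤ 2n + 2 ≤ 4n and 4^(p-1) ≤ 4, which gives the 4 for Φ. The growth of a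
and Young's inequality give |d|^(p/(p-1)) + 3 g^p, hence 3|β|. -/
theorem StructuralAssumptions.flux_le (hp1 : 1 < p) (hp2 : p ≤ 2)
    (hdata : StructuralAssumptions Ω p α β a lam Φ d b f) :
    ∀ᵐ x ∂(volume.restrict Ω), ∀ (n : ℕ) (w : Space N → ℝ) (g : ℕ → Space N → ℝ) (ξ : Space N),
      0 < n → |w x| < 2 * n + 1 → (n : ℝ) ≤ 1 + |w x| → ‖ξ‖ ≤ g n x →
      (‖a x ξ‖ + ‖Φ x (w x)‖) * g n x / n ≤ (3 * |β| + 4) * fluxError p d b w g n x := by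
  filter_upwards [hdata.norm_a_mul_le hp1, hdata.growth_Φ] with x hx1 hx2 n w g ξ hn hw hw' hξ
  have hn1 : (1 : ℝ) ≤ n := by exact_mod_cast hn
  have hn0 : (0 : ℝ) < n := by linarith
  have hg := (norm_nonneg ξ).trans hξ
  have hp1' : 0 ≤ p - 1 := by linarith
  rw [fluxError, Set.indicator_of_mem (s := {x | (n : ℝ) ≤ 1 + |w x|}) (a := x) hw',
    div_eq_inv_mul, one_div, mul_left_comm (3 * |β| + 4)]
  refine mul_le_mul_of_nonneg_left ?_ (inv_nonneg.2 hn0.le)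
  have h1 := hx1 ξ _ hg
  have h2 : ‖ξ‖ ^ p ≤ g n x ^ p := Real.rpow_le_rpow (norm_nonneg _) hξ (by linarith)
  have h4 : (4 : ℝ) ^ (p - 1) ≤ 4 := by
    calc (4 : ℝ) ^ (p - 1) ≤ 4 ^ (1 : ℝ) :=
          Real.rpow_le_rpow_of_exponent_le (by norm_num) (by linarith)
      _ = 4 := by norm_num
  have h3 : ‖Φ x (w x)‖ * g n x ≤ 4 * ((n : ℝ) ^ (p - 1) * |b x| * g n x) := by
    calc ‖Φ x (w x)‖ * g n x ≤ |b x| * (4 * n) ^ (p - 1) * g n x := by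
          refine mul_le_mul_of_nonneg_right ((hx2 _).trans ?_) hg
          gcongr
          linarith
      _ = 4 ^ (p - 1) * ((n : ℝ) ^ (p - 1) * |b x| * g n x) := by
          rw [Real.mul_rpow (by norm_num) hn0.le]
          ring
      _ ≤ _ := by gcongr
  have h5 : 0 ≤ |d x| ^ (p / (p - 1)) := by positivity
  have h6 : 0 ≤ g n x ^ p := by positivity
  have h7 : 0 ≤ (n : ℝ) ^ (p - 1) * |b x| * g n x := by positivity
  have hβ := abs_nonneg β
  rw [add_mul]
  calc ‖a x ξ‖ * g n x + ‖Φ x (w x)‖ * g n x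
      ≤ |β| * (3 * (|d x| ^ (p / (p - 1)) + g n x ^ p + (n : ℝ) ^ (p - 1) * |b x| * g n x))
        + 4 * (|d x| ^ (p / (p - 1)) + g n x ^ p + (n : ℝ) ^ (p - 1) * |b x| * g n x) := by
        refine add_le_add (h1.trans (mul_le_mul_of_nonneg_left ?_ hβ)) (h3.trans ?_)
        · linarith
        · linarith
    _ = _ := by ring

/-- The terms containing the derivative of the renormalization are negligible. -/
theorem StructuralAssumptions.deriv_term_le (hp1 : 1 < p) (hp2 : p ≤ 2)
    (hdata : StructuralAssumptions Ω p α β a lam Φ d b f) {C : ℝ}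
    (hC : ∀ s, |deriv cutoff s| ≤ C) :
    ∀ᵐ x ∂(volume.restrict Ω), ∀ (n : ℕ) (w : Space N → ℝ) (g : ℕ → Space N → ℝ) (ξ : Space N)
      (r : ℝ), 0 < n → (∀ n x, 0 ≤ g n x) → |r| ≤ 1 → (|w x| < 2 * n + 1 → ‖ξ‖ ≤ g n x) →
      |r * (deriv cutoff (w x / n) / n) * inner ℝ (a x ξ) ξ
        + r * (deriv cutoff (w x / n) / n) * inner ℝ (Φ x (w x)) ξ|
        ≤ C * (3 * |β| + 4) * fluxError p d b w g n x := by
  filter_upwards [hdata.flux_le hp1 hp2] with x hx n w g ξ r hn hg0 hr hξ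
  have hC0 : 0 ≤ C := (abs_nonneg _).trans (hC 0)
  have hn1 : (1 : ℝ) ≤ n := by exact_mod_cast hn
  have hn0 : (0 : ℝ) < n := by linarith
  have hz : deriv cutoff (w x / n) = 0 → |r * (deriv cutoff (w x / n) / n) * inner ℝ (a x ξ) ξ
        + r * (deriv cutoff (w x / n) / n) * inner ℝ (Φ x (w x)) ξ|
        ≤ C * (3 * |β| + 4) * fluxError p d b w g n x := fun h => by
    have := fluxError_nonneg (p := p) (d := d) (b := b) (w := w) hg0 n x
    rw [h]
    simp only [zero_div, mul_zero, zero_mul, add_zero, abs_zero]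
    positivity
  -- The derivative of the cutoff is nonzero only for n ≤ |w| < 2n, where the flux bound applies.
  by_cases h1 : 2 * (n : ℝ) ≤ |w x|
  · exact hz (deriv_cutoff_div_eq_zero hn h1)
  by_cases h2 : |w x| < n
  · exact hz (deriv_cutoff_eq_zero_of_lt ((abs_div_natCast_lt hn).2 (by linarith)))
  rw [not_le] at h1
  rw [not_lt] at h2
  have hξ' := hξ (by linarith)
  have h3 := hx n w g ξ hn (by linarith) (by linarith) hξ'
  have h4 : |inner ℝ (a x ξ) ξ + inner ℝ (Φ x (w x)) ξ|
      ≤ (‖a x ξ‖ + ‖Φ x (w x)‖) * g n x := by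
    calc _ ≤ |inner ℝ (a x ξ) ξ| + |inner ℝ (Φ x (w x)) ξ| := abs_add_le _ _
      _ ≤ ‖a x ξ‖ * ‖ξ‖ + ‖Φ x (w x)‖ * ‖ξ‖ :=
          add_le_add (abs_real_inner_le_norm _ _) (abs_real_inner_le_norm _ _)
      _ = (‖a x ξ‖ + ‖Φ x (w x)‖) * ‖ξ‖ := by ring
      _ ≤ _ := by gcongr
  rw [← mul_add, abs_mul, abs_mul, abs_div, abs_of_pos hn0]
  calc |r| * (|deriv cutoff (w x / n)| / n) * |inner ℝ (a x ξ) ξ + inner ℝ (Φ x (w x)) ξ|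
      ≤ 1 * (C / n) * ((‖a x ξ‖ + ‖Φ x (w x)‖) * g n x) := by
        gcongr
        exact hC _
    _ = C * ((‖a x ξ‖ + ‖Φ x (w x)‖) * g n x / n) := by ring
    _ ≤ C * ((3 * |β| + 4) * fluxError p d b w g n x) := by gcongr
    _ = _ := by ring

theorem mul_trunc_one_nonneg {r s : ℝ} (h : 0 ≤ r * s) : 0 ≤ r * trunc 1 s := by
  rcases le_total |s| 1 with hs | hs
  · rwa [trunc_of_abs_le hs]
  · rcases le_abs.1 hs with hs | hs
    · rw [trunc, min_eq_right hs, max_eq_right (by norm_num)]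
      nlinarith
    · rw [trunc, min_eq_left (by linarith), max_eq_left (by linarith)]
      nlinarith

/-- The zero order term of the equation is integrable. -/
theorem SatisfiesEquation.integrable_lam (hΩ : IsOpen Ω) (hb : Bornology.IsBounded Ω)
    (hL : HasLipschitzBoundary Ω) (hN : 2 < N) (hp1 : 1 < p) (hp2 : p ≤ 2)
    (hdata : StructuralAssumptions Ω p α β a lam Φ d b f)
    (hv : HasRegularTruncations Ω Γd p v Dv) (heq : SatisfiesEquation Ω Γd p a lam Φ f v Dv) :
    Integrable (fun x => lam x (v x)) (volume.restrict Ω) := by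
  have hfin := isFiniteMeasure_restrict hb
  have hp0 : 0 < p := by linarith
  have hp1' : 0 ≤ p - 1 := by linarith
  obtain ⟨C, hC0, hC⟩ := exists_deriv_cutoff_bound
  -- The test function is the truncation of v at height 1. It has the sign of v, so its product with
  -- the zero order term is nonnegative.
  obtain ⟨g, hg, hg0⟩ := hv.triple 1 one_pos
  set J := jointNorm v Dv v Dv with hJ
  have hJ0 : ∀ n x, 0 ≤ J n x := fun n x => jointNorm_nonneg n x
  obtain ⟨hEi, hEt⟩ := fluxError_tendsto hΩ hb hL hN hp1 hp2 hdata hv hJ0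
    (aemeasurable_jointNorm hv hv) (integrable_jointNorm_rpow hp0 hp2 hv hv)
    (tendsto_jointNorm hp0 hp2 hv hv)
  have hlm : AEMeasurable (fun x => lam x (v x)) (volume.restrict Ω) :=
    hdata.caratheodory_lam.aemeasurable_comp hv.aemeasurable
  have hTm : AEMeasurable (fun x => trunc 1 (v x)) (volume.restrict Ω) :=
    (continuous_trunc 1).measurable.comp_aemeasurable hv.aemeasurable
  have hhm : ∀ n : ℕ, AEMeasurable (fun x => cutoff (v x / n)) (volume.restrict Ω) := fun n =>
    cutoff.continuous.measurable.comp_aemeasurable (hv.aemeasurable.div_const _)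
  set S : Space N → ℝ := fun x => 2 * (|b x| ^ (p / (p - 1))
    + {x | |v x| < 1}.indicator (fun x => ‖Dv x‖ ^ p) x) + |f x| with hS
  have hfi : Integrable f (volume.restrict Ω) := memLp_one_iff_integrable.1 hdata.f_mem
  have hSi : Integrable S (volume.restrict Ω) :=
    (((hdata.integrable_b_conj hN hp1 hp2).add (hv.integrable_indicator hp0 one_pos)).const_mul
      2).add hfi.abs
  set F : ℕ → Space N → ℝ := fun n x => lam x (v x) * trunc 1 (v x) * cutoff (v x / n) with hF
  have hF0 : ∀ᵐ x ∂(volume.restrict Ω), ∀ n, 0 ≤ F n x := by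
    filter_upwards [hdata.sign_lam] with x hx n
    exact mul_nonneg (mul_trunc_one_nonneg (hx _)) (cutoff_nonneg _)
  -- In the residual the principal part is nonnegative. The convection term lives on {|v| < 1},
  -- where (1 + |v|)^(p-1) ≤ 2, and together with the source it is bounded by S, which does not
  -- depend on n.
  have hFle : ∀ n : ℕ, 0 < n → ∀ᵐ x ∂(volume.restrict Ω), F n x ≤
      residual a lam Φ f v Dv n (fun x => trunc 1 (v x)) ({x | |v x| < 1}.indicator Dv) x
        + S x + C * (3 * |β| + 4) * fluxError p d b v J n x := by
    intro n hn
    filter_upwards [hdata.deriv_term_le hp1 hp2 hC, hdata.coercive, hdata.growth_Φ]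
      with x hx1 hx2 hx3
    have hT : |trunc 1 (v x)| ≤ 1 := abs_trunc_le zero_le_one
    have h1 := neg_le_of_abs_le (hx1 n v J (Dv x) (trunc 1 (v x)) hn hJ0 hT
      fun h => norm_left_le_jointNorm h)
    have hh0 := cutoff_nonneg (v x / n)
    have hh1 := cutoff_le_one (v x / n)
    have h2 : 0 ≤ cutoff (v x / n) *
        inner ℝ (a x (Dv x)) ({x | |v x| < 1}.indicator Dv x) := by
      refine mul_nonneg hh0 ?_
      by_cases hx : x ∈ {x | |v x| < 1}
      · rw [Set.indicator_of_mem hx]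
        exact le_trans (mul_nonneg hdata.α_pos.le (by positivity)) (hx2 _)
      · rw [Set.indicator_of_notMem hx, inner_zero_right]
    have h3 : -(2 * (|b x| ^ (p / (p - 1))
        + {x | |v x| < 1}.indicator (fun x => ‖Dv x‖ ^ p) x)) ≤ cutoff (v x / n) *
        inner ℝ (Φ x (v x)) ({x | |v x| < 1}.indicator Dv x) := by
      refine neg_le_of_abs_le ?_
      rw [abs_mul, abs_of_nonneg hh0]
      refine (mul_le_of_le_one_left (abs_nonneg _) hh1).trans
        ((abs_real_inner_le_norm _ _).trans ?_)
      by_cases hx : x ∈ {x | |v x| < 1}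
      · rw [Set.indicator_of_mem hx, Set.indicator_of_mem hx]
        have hx' : |v x| < 1 := hx
        have h4 := mul_le_rpow_add_rpow hp1 (abs_nonneg (b x)) (norm_nonneg (Dv x))
        have h5 : (1 + |v x|) ^ (p - 1) ≤ 2 := by
          calc (1 + |v x|) ^ (p - 1) ≤ 2 ^ (p - 1) := by
                gcongr
                linarith
            _ ≤ 2 ^ (1 : ℝ) := Real.rpow_le_rpow_of_exponent_le one_le_two (by linarith)
            _ = 2 := by norm_num
        calc ‖Φ x (v x)‖ * ‖Dv x‖ ≤ |b x| * 2 * ‖Dv x‖ := by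
              gcongr
              exact (hx3 _).trans (by gcongr)
          _ = 2 * (|b x| * ‖Dv x‖) := by ring
          _ ≤ _ := by gcongr
      · rw [Set.indicator_of_notMem hx, Set.indicator_of_notMem hx, norm_zero, mul_zero]
        positivity
    have h6 : f x * trunc 1 (v x) * cutoff (v x / n) ≤ |f x| := by
      refine (le_abs_self _).trans ?_
      rw [abs_mul, abs_mul, mul_assoc, abs_of_nonneg hh0]
      exact mul_le_of_le_one_right (abs_nonneg _) (mul_le_one₀ hT hh0 hh1)
    simp only [hF, residual, hS]
    linarith
  obtain ⟨K, hK⟩ := hEt.bddAbove_range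
  have hK' : ∀ n, ∫ x in Ω, fluxError p d b v J n x ≤ K := fun n => hK (Set.mem_range_self n)
  set M : ℝ := (∫ x in Ω, S x) + C * (3 * |β| + 4) * K with hM
  have hFm : ∀ n, AEMeasurable (F n) (volume.restrict Ω) := fun n => (hlm.mul hTm).mul (hhm n)
  have hFi : ∀ n : ℕ, 0 < n → ∫⁻ x in Ω, ENNReal.ofReal (F n x) ≤ ENNReal.ofReal M := by
    intro n hn
    obtain ⟨hR, hR0⟩ := heq n _ g _ hn hg hg0 fun x => abs_trunc_le zero_le_one
    have i1 : Integrable (fun x => residual a lam Φ f v Dv n (fun x => trunc 1 (v x))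
      ({x | |v x| < 1}.indicator Dv) x + S x) (volume.restrict Ω) := hR.add hSi
    have i2 := (hEi n hn).const_mul (C * (3 * |β| + 4))
    have i3 : Integrable (fun x => residual a lam Φ f v Dv n (fun x => trunc 1 (v x))
        ({x | |v x| < 1}.indicator Dv) x + S x + C * (3 * |β| + 4) * fluxError p d b v J n x)
        (volume.restrict Ω) := i1.add i2
    have hFin : Integrable (F n) (volume.restrict Ω) := by
      refine i3.mono' (hFm n).aestronglyMeasurable ?_
      filter_upwards [hF0, hFle n hn] with x h1 h2
      rwa [Real.norm_of_nonneg (h1 n)]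
    rw [← ofReal_integral_eq_lintegral_ofReal hFin (by filter_upwards [hF0] with x hx using hx n)]
    refine ENNReal.ofReal_le_ofReal ((integral_mono_ae hFin i3 (hFle n hn)).trans ?_)
    rw [integral_add i1 i2, integral_add hR hSi, hR0, integral_const_mul, zero_add]
    have := hK' n
    rw [hM]
    gcongr
  have hlim : ∀ x, Tendsto (fun n => ENNReal.ofReal (F n x)) atTop
      (𝓝 (ENNReal.ofReal (lam x (v x) * trunc 1 (v x)))) := fun x => by
    refine tendsto_const_nhds.congr' ?_
    obtain ⟨n₀, hn₀⟩ := exists_nat_gt |v x|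
    filter_upwards [eventually_ge_atTop n₀, eventually_gt_atTop 0] with n hn hn0
    have : (n₀ : ℝ) ≤ n := by exact_mod_cast hn
    simp only [hF]
    rw [cutoff_eq_one ((abs_div_natCast_lt hn0).2 (by linarith)).le, mul_one]
  -- The integrals of F n are bounded uniformly in n, and the cutoff tends to 1 pointwise.
  have hfatou : ∫⁻ x in Ω, ENNReal.ofReal (lam x (v x) * trunc 1 (v x)) ≤ ENNReal.ofReal M := by
    calc ∫⁻ x in Ω, ENNReal.ofReal (lam x (v x) * trunc 1 (v x))
        = ∫⁻ x in Ω, liminf (fun n => ENNReal.ofReal (F n x)) atTop :=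
          lintegral_congr fun x => (hlim x).liminf_eq.symm
      _ ≤ liminf (fun n => ∫⁻ x in Ω, ENNReal.ofReal (F n x)) atTop :=
          lintegral_liminf_le' fun n => (hFm n).ennreal_ofReal
      _ ≤ ENNReal.ofReal M := by
          refine liminf_le_of_frequently_le' (Eventually.frequently ?_)
          filter_upwards [eventually_gt_atTop 0] with n hn using hFi n hn
  have hG : Integrable (fun x => lam x (v x) * trunc 1 (v x)) (volume.restrict Ω) := by
    refine ⟨(hlm.mul hTm).aestronglyMeasurable, ?_⟩
    rw [hasFiniteIntegral_iff_ofReal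
      (by filter_upwards [hdata.sign_lam] with x hx using mul_trunc_one_nonneg (hx _))]
    exact hfatou.trans_lt ENNReal.ofReal_lt_top
  -- Where |v| ≥ 1 the truncation has modulus 1 and nothing is lost; where |v| ≤ 1 the zero order
  -- term is bounded.
  obtain ⟨c, hc0, hc⟩ := hdata.bound_lam 1 one_pos
  refine ((integrable_const c).add hG).mono' hlm.aestronglyMeasurable ?_
  filter_upwards [hc, hdata.sign_lam] with x hx1 hx2
  have h0 := mul_trunc_one_nonneg (hx2 (v x))
  simp only [Pi.add_apply]
  rcases le_total |v x| 1 with h | h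
  · have := hx1 _ h
    rw [Real.norm_eq_abs]
    linarith
  · have h1 : |lam x (v x) * trunc 1 (v x)| = |lam x (v x)| := by
      rw [abs_mul, abs_trunc_of_le zero_le_one h, mul_one]
    rw [abs_of_nonneg h0] at h1
    rw [Real.norm_eq_abs, ← h1]
    linarith

end FluxError

/-! ### Pointwise lower bound for the difference of the two equations -/

section Pointwise

variable {N : ℕ} {Ω Γd : Set (Space N)} {p α β : ℝ} {a : Space N → Space N → Space N}
  {lam : Space N → ℝ → ℝ} {Φ : Space N → ℝ → Space N} {d b f : Space N → ℝ}
  {u v : Space N → ℝ} {Du Dv : Space N → Space N}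

/-- The lower bound for the monotonicity of the principal part. -/
noncomputable def monotoneForm (p : ℝ) (ξ ξ' : Space N) : ℝ :=
  ‖ξ - ξ'‖ ^ 2 / (‖ξ‖ + ‖ξ'‖) ^ (2 - p)

/-- The weight that multiplies `(s - t)²` in the estimate of the convection term. -/
noncomputable def convectionWeight (p γ b s t : ℝ) (ξ ξ' : Space N) : ℝ :=
  |b| ^ 2 * (|s| + |t| + 1) ^ (2 * γ) * (‖ξ‖ + ‖ξ'‖) ^ (2 - p)

theorem monotoneForm_nonneg (ξ ξ' : Space N) : 0 ≤ monotoneForm p ξ ξ' := by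
  unfold monotoneForm
  positivity

theorem convectionWeight_nonneg (γ b s t : ℝ) (ξ ξ' : Space N) :
    0 ≤ convectionWeight p γ b s t ξ ξ' := by
  unfold convectionWeight
  positivity

theorem monotoneForm_le (hp1 : 1 < p) (ξ ξ' : Space N) :
    monotoneForm p ξ ξ' ≤ (‖ξ‖ + ‖ξ'‖) ^ p := by
  unfold monotoneForm
  rcases (add_nonneg (norm_nonneg ξ) (norm_nonneg ξ')).eq_or_lt with h | h
  · have h1 : ‖ξ‖ = 0 := by linarith [norm_nonneg ξ, norm_nonneg ξ']
    have h2 : ‖ξ'‖ = 0 := by linarith [norm_nonneg ξ, norm_nonneg ξ']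
    rw [norm_eq_zero] at h1 h2
    simp [h1, h2, (by linarith : p ≠ 0)]
  · rw [div_le_iff₀ (Real.rpow_pos_of_pos h _), ← Real.rpow_add h]
    have h1 := norm_sub_le ξ ξ'
    calc ‖ξ - ξ'‖ ^ 2 ≤ (‖ξ‖ + ‖ξ'‖) ^ 2 := by gcongr
      _ = (‖ξ‖ + ‖ξ'‖) ^ (p + (2 - p)) := by
          rw [add_sub_cancel, ← Real.rpow_natCast]
          norm_num

/-- Young's inequality for |ξ - ξ'| = Q^(1/2) P^(1/2), with Q the monotone form and P = (|ξ| +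
|ξ'|)^(2-p). If both vectors vanish the left side is 0. -/
theorem norm_sub_le_monotoneForm {ε : ℝ} (hε : 0 < ε) (ξ ξ' : Space N) :
    ‖ξ - ξ'‖ ≤ monotoneForm p ξ ξ' / ε + ε * (‖ξ‖ + ‖ξ'‖) ^ (2 - p) := by
  unfold monotoneForm
  rcases (add_nonneg (norm_nonneg ξ) (norm_nonneg ξ')).eq_or_lt with h | h
  · have h1 := norm_sub_le ξ ξ'
    rw [← h] at h1
    refine h1.trans ?_
    positivity
  · set P := (‖ξ‖ + ‖ξ'‖) ^ (2 - p) with hP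
    have hP0 : 0 < P := Real.rpow_pos_of_pos h _
    have h2 : ‖ξ - ξ'‖ ^ 2 / P / ε + ε * P - ‖ξ - ξ'‖
        = ((‖ξ - ξ'‖ - ε * P / 2) ^ 2 + 3 / 4 * (ε * P) ^ 2) / (ε * P) := by
      field_simp
      ring
    have h3 : 0 ≤ ((‖ξ - ξ'‖ - ε * P / 2) ^ 2 + 3 / 4 * (ε * P) ^ 2) / (ε * P) := by positivity
    linarith

/-- With M the Lipschitz bound for B - B', Young's inequality gives M|ξ - ξ'| ≤ (α/2)|ξ - ξ'|²/P +
M²P/(2α), P = (|ξ| + |ξ'|)^(2-p). The first term uses half of the monotonicity; the second contains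
the convection weight. -/
theorem inner_flux_sub_ge {α L γ b s t : ℝ} (hα : 0 < α) {A A' B B' ξ ξ' : Space N}
    (hA : α * (‖ξ - ξ'‖ ^ 2 / (‖ξ‖ + ‖ξ'‖) ^ (2 - p)) ≤ inner ℝ (A - A') (ξ - ξ'))
    (hB : ‖B - B'‖ ≤ L * |s - t| * |b| * (|s| + |t| + 1) ^ γ) :
    α / 2 * monotoneForm p ξ ξ' - L ^ 2 / (2 * α) * (s - t) ^ 2 * convectionWeight p γ b s t ξ ξ'
      ≤ inner ℝ (A - A') (ξ - ξ') + inner ℝ (B - B') (ξ - ξ') := by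
  set M := L * |s - t| * |b| * (|s| + |t| + 1) ^ γ with hM
  have hX : 0 ≤ |s| + |t| + 1 := by positivity
  have hM2 : M ^ 2 = L ^ 2 * (s - t) ^ 2 * (|b| ^ 2 * (|s| + |t| + 1) ^ (2 * γ)) := by
    rw [mul_comm 2 γ, Real.rpow_mul hX, Real.rpow_two, hM, mul_pow, mul_pow, mul_pow, sq_abs]
    ring
  have hi : -(M * ‖ξ - ξ'‖) ≤ inner ℝ (B - B') (ξ - ξ') :=
    neg_le_of_abs_le ((abs_real_inner_le_norm _ _).trans
      (mul_le_mul_of_nonneg_right hB (norm_nonneg _)))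
  unfold monotoneForm convectionWeight
  rcases (add_nonneg (norm_nonneg ξ) (norm_nonneg ξ')).eq_or_lt with h | h
  · have h1 : ‖ξ - ξ'‖ = 0 :=
      le_antisymm ((norm_sub_le ξ ξ').trans h.symm.le) (norm_nonneg _)
    rw [h1] at hA hi ⊢
    have h3 : 0 ≤ L ^ 2 / (2 * α) * (s - t) ^ 2 *
      (|b| ^ 2 * (|s| + |t| + 1) ^ (2 * γ) * (‖ξ‖ + ‖ξ'‖) ^ (2 - p)) := by positivity
    simp only [ne_eq, OfNat.ofNat_ne_zero, not_false_eq_true, zero_pow, zero_div, mul_zero,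
      neg_zero] at hA hi ⊢
    linarith
  · set P := (‖ξ‖ + ‖ξ'‖) ^ (2 - p) with hP
    have hP0 : 0 < P := Real.rpow_pos_of_pos h _
    have h1 : M * ‖ξ - ξ'‖ ≤ α / 2 * (‖ξ - ξ'‖ ^ 2 / P) + M ^ 2 * P / (2 * α) := by
      have h2 : α / 2 * (‖ξ - ξ'‖ ^ 2 / P) + M ^ 2 * P / (2 * α) - M * ‖ξ - ξ'‖
          = (α * ‖ξ - ξ'‖ - M * P) ^ 2 / (2 * α * P) := by
        field_simp
        ring
      have h3 : 0 ≤ (α * ‖ξ - ξ'‖ - M * P) ^ 2 / (2 * α * P) := by positivity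
      linarith
    have h4 : L ^ 2 / (2 * α) * (s - t) ^ 2 * (|b| ^ 2 * (|s| + |t| + 1) ^ (2 * γ) * P)
        = M ^ 2 * P / (2 * α) := by
      rw [hM2]
      ring
    rw [h4]
    linarith

/-- This fixes the truncation height at one above the support of the cutoff: beyond c + 1 the
truncated value would be more than 1 away from s. -/
theorem abs_lt_of_abs_trunc_sub_lt {c s t : ℝ} (hc : 0 ≤ c) (hs : |s| < c)
    (h : |trunc (c + 1) s - trunc (c + 1) t| < 1) : |t| < c + 1 := by
  by_contra ht
  rw [not_lt] at ht
  have h1 := abs_trunc_of_le (by linarith) ht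
  rw [trunc_of_abs_le (by linarith : |s| ≤ c + 1)] at h
  have h2 := abs_sub_abs_le_abs_sub (trunc (c + 1) t) s
  rw [h1, abs_sub_comm] at h2
  linarith

theorem mul_smoothSign_nonneg {l l' s t k c : ℝ} (hk : 0 < k) (h : 0 ≤ (l - l') * (s - t)) :
    0 ≤ (l - l') * smoothSign ((trunc c s - trunc c t) / k) := by
  rcases lt_trichotomy s t with hst | rfl | hst
  · have h1 : l - l' ≤ 0 := by nlinarith
    have h2 : smoothSign ((trunc c s - trunc c t) / k) ≤ 0 := by
      rw [← smoothSign_zero]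
      exact monotone_smoothSign (div_nonpos_of_nonpos_of_nonneg
        (sub_nonpos.2 (trunc_mono c hst.le)) hk.le)
    exact mul_nonneg_of_nonpos_of_nonpos h1 h2
  · simp [smoothSign_zero]
  · have h1 : 0 ≤ l - l' := by nlinarith
    have h2 : 0 ≤ smoothSign ((trunc c s - trunc c t) / k) := by
      rw [← smoothSign_zero]
      exact monotone_smoothSign (div_nonneg (sub_nonneg.2 (trunc_mono c hst.le)) hk.le)
    exact mul_nonneg h1 h2

/-- The test function for the difference of the equations of `u` and `v`. -/
noncomputable def testFun (u v : Space N → ℝ) (n : ℕ) (k : ℝ) (x : Space N) : ℝ :=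
  smoothSign ((trunc (2 * n + 1) (u x) - trunc (2 * n + 1) (v x)) / k)

/-- The gradient of `testFun`. -/
noncomputable def testGrad (u : Space N → ℝ) (Du : Space N → Space N) (v : Space N → ℝ)
    (Dv : Space N → Space N) (n : ℕ) (k : ℝ) (x : Space N) : Space N :=
  (bump ((trunc (2 * n + 1) (u x) - trunc (2 * n + 1) (v x)) / k) / k) •
      {x | |u x| < 2 * (n : ℝ) + 1}.indicator Du x
    + (-(bump ((trunc (2 * n + 1) (u x) - trunc (2 * n + 1) (v x)) / k) / k)) •
      {x | |v x| < 2 * (n : ℝ) + 1}.indicator Dv x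

/-- The error in the energy estimate, which tends to zero with `n → ∞`. -/
noncomputable def energyError (p K : ℝ) (lam : Space N → ℝ → ℝ) (d b f u v : Space N → ℝ)
    (g : ℕ → Space N → ℝ) (n : ℕ) (x : Space N) : ℝ :=
  (|lam x (v x)| + |f x|) * |cutoff (u x / n) - cutoff (v x / n)|
    + K * (fluxError p d b u g n x + 2 * fluxError p d b v g n x)

/-- The difference of the flux terms, from below. -/
theorem flux_difference_ge {L γ C : ℝ} (hp1 : 1 < p) (hp2 : p ≤ 2)
    (hdata : StructuralAssumptions Ω p α β a lam Φ d b f)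
    (ha : ∀ᵐ x ∂(volume.restrict Ω), ∀ ξ ξ' : Space N,
      α * (‖ξ - ξ'‖ ^ 2 / (‖ξ‖ + ‖ξ'‖) ^ (2 - p)) ≤ inner ℝ (a x ξ - a x ξ') (ξ - ξ'))
    (hΦ : ∀ᵐ x ∂(volume.restrict Ω), ∀ r r' : ℝ,
      ‖Φ x r - Φ x r'‖ ≤ L * |r - r'| * |b x| * (|r| + |r'| + 1) ^ γ)
    (hC : ∀ s, |deriv cutoff s| ≤ C) :
    ∀ᵐ x ∂(volume.restrict Ω), ∀ (n : ℕ) (k : ℝ), 0 < n → 0 < k → k ≤ 1 →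
      cutoff (u x / n) * (bump ((u x - v x) / k) / k) * (α / 2 * monotoneForm p (Du x) (Dv x)
          - L ^ 2 / (2 * α) * (u x - v x) ^ 2
            * convectionWeight p γ (b x) (u x) (v x) (Du x) (Dv x))
        - C * (3 * |β| + 4) * fluxError p d b v (jointNorm u Du v Dv) n x
      ≤ (cutoff (u x / n) * inner ℝ (a x (Du x)) (testGrad u Du v Dv n k x)
          + cutoff (u x / n) * inner ℝ (Φ x (u x)) (testGrad u Du v Dv n k x))
        - (cutoff (v x / n) * inner ℝ (a x (Dv x)) (testGrad u Du v Dv n k x)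
          + cutoff (v x / n) * inner ℝ (Φ x (v x)) (testGrad u Du v Dv n k x)) := by
  filter_upwards [ha, hΦ, hdata.flux_le hp1 hp2] with x hax hΦx hfx n k hn hk hk1
  have hC0 : 0 ≤ C := (abs_nonneg _).trans (hC 0)
  have hn1 : (1 : ℝ) ≤ n := by exact_mod_cast hn
  have hn0 : (0 : ℝ) < n := by linarith
  have herr : 0 ≤ C * (3 * |β| + 4) * fluxError p d b v (jointNorm u Du v Dv) n x :=
    mul_nonneg (by positivity) (fluxError_nonneg (fun n x => jointNorm_nonneg n x) n x)
  set s := u x with hs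
  set t := v x with ht
  set T := bump ((trunc (2 * n + 1) s - trunc (2 * n + 1) t) / k) with hT
  have hlt : ∀ r : ℝ, bump (r / k) ≠ 0 → |r| < k := fun r hr => by
    by_contra h
    refine hr (bump_eq_zero ?_)
    rw [abs_div, abs_of_pos hk, le_div_iff₀ hk]
    linarith
  by_cases h0 : cutoff (s / n) = 0 ∧ cutoff (t / n) = 0
  · rw [h0.1, h0.2]
    simp only [zero_mul, add_zero, sub_zero, zero_sub, neg_nonpos]
    exact herr
  have hst : |s| < 2 * n ∨ |t| < 2 * n := by
    by_contra h
    rw [not_or, not_lt, not_lt] at h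
    exact h0 ⟨cutoff_div_eq_zero hn h.1, cutoff_div_eq_zero hn h.2⟩
  -- The left side contains the bump of the difference without truncation. If |s| < 2n and |s - t| <
  -- k ≤ 1 then |t| < 2n + 1, so truncation changes nothing and both bumps vanish together.
  by_cases hT0 : T = 0
  · have hG : testGrad u Du v Dv n k x = 0 := by
      simp only [testGrad]
      rw [← hs, ← ht, ← hT, hT0]
      simp
    have hz : cutoff (s / n) * (bump ((s - t) / k) / k) = 0 := by
      by_cases hh : |s| < 2 * n
      · by_cases hb : bump ((s - t) / k) = 0
        · rw [hb]
          simp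
        · have h1 := hlt _ hb
          have h2 : |t| ≤ 2 * n + 1 := by
            have := abs_sub_abs_le_abs_sub t s
            rw [abs_sub_comm] at this
            linarith
          rw [hT, trunc_of_abs_le h2, trunc_of_abs_le (by linarith)] at hT0
          exact absurd hT0 hb
      · rw [cutoff_div_eq_zero hn (not_lt.1 hh), zero_mul]
    rw [hG, hz]
    simp only [inner_zero_right, mul_zero, zero_mul, add_zero, sub_zero, zero_sub, neg_nonpos]
    exact herr
  have hTk := hlt _ hT0
  have hs1 : |s| < 2 * n + 1 := by
    rcases hst with h | h
    · linarith
    · rw [abs_sub_comm] at hTk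
      exact abs_lt_of_abs_trunc_sub_lt (by positivity) h (by linarith)
  have ht1 : |t| < 2 * n + 1 := by
    rcases hst with h | h
    · exact abs_lt_of_abs_trunc_sub_lt (by positivity) h (by linarith)
    · linarith
  rw [trunc_of_abs_le hs1.le, trunc_of_abs_le ht1.le] at hTk hT
  set θ := bump ((s - t) / k) / k with hθ
  have hθ0 : 0 ≤ θ := div_nonneg (bump_nonneg _) hk.le
  have hθ1 : θ * k ≤ 1 := by
    rw [hθ, div_mul_cancel₀ _ hk.ne']
    exact bump_le_one _
  have hG : testGrad u Du v Dv n k x = θ • (Du x - Dv x) := by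
    simp only [testGrad]
    rw [← hs, ← ht, trunc_of_abs_le hs1.le, trunc_of_abs_le ht1.le,
      Set.indicator_of_mem (s := {x | |u x| < 2 * (n : ℝ) + 1}) (a := x) hs1,
      Set.indicator_of_mem (s := {x | |v x| < 2 * (n : ℝ) + 1}) (a := x) ht1, smul_sub,
      neg_smul, ← sub_eq_add_neg]
  have hJ : jointNorm u Du v Dv n x = ‖Du x‖ + ‖Dv x‖ := jointNorm_eq hs1 ht1
  have hmain := inner_flux_sub_ge hdata.α_pos (hax (Du x) (Dv x)) (hΦx s t)
  have hh0 := cutoff_nonneg (s / n)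
  have h1 := mul_le_mul_of_nonneg_left hmain (mul_nonneg hh0 hθ0)
  -- The flux of v carries the cutoff of v instead of that of u. The factor 1/k of the test gradient
  -- is compensated by the Lipschitz bound for the cutoff on {|s - t| < k}, which leaves C/n, and
  -- the remainder is a flux error.
  have h2 : |(cutoff (s / n) - cutoff (t / n)) * θ * (inner ℝ (a x (Dv x)) (Du x - Dv x)
      + inner ℝ (Φ x t) (Du x - Dv x))|
      ≤ C * (3 * |β| + 4) * fluxError p d b v (jointNorm u Du v Dv) n x := by
    by_cases htn : (n : ℝ) ≤ 1 + |t|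
    · have h3 := hfx n v (jointNorm u Du v Dv) (Dv x) hn ht1 htn (norm_right_le_jointNorm ht1)
      have h4 : |inner ℝ (a x (Dv x)) (Du x - Dv x) + inner ℝ (Φ x t) (Du x - Dv x)|
          ≤ (‖a x (Dv x)‖ + ‖Φ x t‖) * jointNorm u Du v Dv n x := by
        calc _ ≤ |inner ℝ (a x (Dv x)) (Du x - Dv x)| + |inner ℝ (Φ x t) (Du x - Dv x)| :=
              abs_add_le _ _
          _ ≤ ‖a x (Dv x)‖ * ‖Du x - Dv x‖ + ‖Φ x t‖ * ‖Du x - Dv x‖ :=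
              add_le_add (abs_real_inner_le_norm _ _) (abs_real_inner_le_norm _ _)
          _ = (‖a x (Dv x)‖ + ‖Φ x t‖) * ‖Du x - Dv x‖ := by ring
          _ ≤ _ := by
              rw [hJ]
              gcongr
              exact norm_sub_le _ _
      have h5 : |(cutoff (s / n) - cutoff (t / n)) * θ| ≤ C / n := by
        rw [abs_mul, abs_of_nonneg hθ0]
        calc |cutoff (s / n) - cutoff (t / n)| * θ ≤ C / n * |s - t| * θ := by
              gcongr
              exact abs_cutoff_sub_le hC hn0 s t
          _ ≤ C / n * k * θ := by gcongr
          _ = C / n * (θ * k) := by ring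
          _ ≤ C / n := mul_le_of_le_one_right (by positivity) hθ1
      rw [abs_mul]
      calc _ ≤ C / n * ((‖a x (Dv x)‖ + ‖Φ x t‖) * jointNorm u Du v Dv n x) :=
            mul_le_mul h5 h4 (abs_nonneg _) (by positivity)
        _ = C * ((‖a x (Dv x)‖ + ‖Φ x t‖) * jointNorm u Du v Dv n x / n) := by ring
        _ ≤ C * ((3 * |β| + 4) * fluxError p d b v (jointNorm u Du v Dv) n x) := by gcongr
        _ = _ := by ring
    -- Here |t| < n - 1, hence |s| < n since |s - t| < 1, and both cutoffs equal 1.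
    · rw [not_le] at htn
      have h3 : |s| < n := by
        have := abs_sub_abs_le_abs_sub s t
        linarith
      rw [cutoff_eq_one ((abs_div_natCast_lt hn).2 (by linarith)).le,
        cutoff_eq_one ((abs_div_natCast_lt hn).2 (by linarith)).le]
      simpa using herr
  rw [hG]
  simp only [inner_smul_right]
  have h3 := neg_le_of_abs_le h2
  rw [inner_sub_left, inner_sub_left] at h1
  linarith

/-- The difference of the two equations, from below. -/
theorem residual_difference_ge {L γ C : ℝ} (hp1 : 1 < p) (hp2 : p ≤ 2)
    (hdata : StructuralAssumptions Ω p α β a lam Φ d b f)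
    (hlam : ∀ᵐ x ∂(volume.restrict Ω), ∀ r r' : ℝ, 0 ≤ (lam x r - lam x r') * (r - r'))
    (ha : ∀ᵐ x ∂(volume.restrict Ω), ∀ ξ ξ' : Space N,
      α * (‖ξ - ξ'‖ ^ 2 / (‖ξ‖ + ‖ξ'‖) ^ (2 - p)) ≤ inner ℝ (a x ξ - a x ξ') (ξ - ξ'))
    (hΦ : ∀ᵐ x ∂(volume.restrict Ω), ∀ r r' : ℝ,
      ‖Φ x r - Φ x r'‖ ≤ L * |r - r'| * |b x| * (|r| + |r'| + 1) ^ γ)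
    (hC : ∀ s, |deriv cutoff s| ≤ C) :
    ∀ᵐ x ∂(volume.restrict Ω), ∀ (n : ℕ) (k : ℝ), 0 < n → 0 < k → k ≤ 1 →
      cutoff (u x / n) * (bump ((u x - v x) / k) / k) * (α / 2 * monotoneForm p (Du x) (Dv x)
          - L ^ 2 / (2 * α) * (u x - v x) ^ 2
            * convectionWeight p γ (b x) (u x) (v x) (Du x) (Dv x))
        - energyError p (C * (3 * |β| + 4)) lam d b f u v (jointNorm u Du v Dv) n x
      ≤ residual a lam Φ f u Du n (testFun u v n k) (testGrad u Du v Dv n k) x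
        - residual a lam Φ f v Dv n (testFun u v n k) (testGrad u Du v Dv n k) x := by
  filter_upwards [flux_difference_ge (u := u) (v := v) (Du := Du) (Dv := Dv) hp1 hp2 hdata ha hΦ hC,
    hlam, hdata.deriv_term_le hp1 hp2 hC] with x hx hlx hdx n k hn hk hk1
  have h1 := hx n k hn hk hk1
  have hJ0 : ∀ n x, 0 ≤ jointNorm u Du v Dv n x := fun n x => jointNorm_nonneg n x
  have hφ1 : |testFun u v n k x| ≤ 1 := abs_smoothSign_le _
  have h2 := neg_le_of_abs_le (hdx n u _ (Du x) _ hn hJ0 hφ1 fun h => norm_left_le_jointNorm h)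
  have h3 := le_of_abs_le (hdx n v _ (Dv x) _ hn hJ0 hφ1 fun h => norm_right_le_jointNorm h)
  have h4 : 0 ≤ cutoff (u x / n) * ((lam x (u x) - lam x (v x)) * testFun u v n k x) :=
    mul_nonneg (cutoff_nonneg _) (mul_smoothSign_nonneg hk (hlx _ _))
  -- The source and `lam x (v x)` also meet different cutoffs; the mismatch is integrated against
  -- fixed L¹ functions, which requires the integrability of `lam x (v x)`.
  have hb : ∀ c : ℝ, |c * (cutoff (u x / n) - cutoff (v x / n)) * testFun u v n k x|
      ≤ |c| * |cutoff (u x / n) - cutoff (v x / n)| := fun c => by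
    rw [abs_mul, abs_mul]
    exact mul_le_of_le_one_right (by positivity) hφ1
  have h5 := neg_le_of_abs_le (hb (lam x (v x)))
  have h6 := le_of_abs_le (hb (f x))
  simp only [residual, energyError]
  linarith

end Pointwise

/-! ### The energy estimate -/

section Energy

variable {N : ℕ} {Ω Γd : Set (Space N)} {p α β : ℝ} {a : Space N → Space N → Space N}
  {lam : Space N → ℝ → ℝ} {Φ : Space N → ℝ → Space N} {d b f : Space N → ℝ}
  {u v : Space N → ℝ} {Du Dv : Space N → Space N}

/-- The chain rule for a function of the truncations of `u` and `v` at height `M`. -/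
theorem HasRegularTruncations.comp₂ (hp1 : 1 < p) (hu : HasRegularTruncations Ω Γd p u Du)
    (hv : HasRegularTruncations Ω Γd p v Dv) {M : ℝ} (hM : 0 < M) {F F₁ F₂ : ℝ × ℝ → ℝ}
    (hF₁ : Continuous F₁) (hF₂ : Continuous F₂)
    (hF : ∀ z, HasFDerivAt F (F₁ z • ContinuousLinearMap.fst ℝ ℝ ℝ
      + F₂ z • ContinuousLinearMap.snd ℝ ℝ ℝ) z) (hF0 : F 0 = 0) {C : ℝ}
    (hC₁ : ∀ z, |F₁ z| ≤ C) (hC₂ : ∀ z, |F₂ z| ≤ C) :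
    ∃ g, SobolevTriple Ω (ENNReal.ofReal p) (fun x => F (trunc M (u x), trunc M (v x)))
      (fun x => F₁ (trunc M (u x), trunc M (v x)) • {x | |u x| < M}.indicator Du x
        + F₂ (trunc M (u x), trunc M (v x)) • {x | |v x| < M}.indicator Dv x) g ∧
      ∀ᵐ x ∂(surfaceMeasure Ω), x ∈ Γd → g x = 0 := by
  have hq1 : 1 ≤ ENNReal.ofReal p := by simpa using ENNReal.ofReal_le_ofReal hp1.le
  obtain ⟨g₁, hg₁, hg₁0⟩ := hu.triple M hM
  obtain ⟨g₂, hg₂, hg₂0⟩ := hv.triple M hM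
  refine ⟨_, hg₁.comp₂ hq1 ENNReal.ofReal_ne_top hg₂ hF₁ hF₂ hF hF0 hC₁ hC₂, ?_⟩
  filter_upwards [hg₁0, hg₂0] with x h1 h2 hx
  rw [h1 hx, h2 hx]
  exact hF0

theorem hasFDerivAt_smoothSign_sub {k : ℝ} (z : ℝ × ℝ) :
    HasFDerivAt (fun z : ℝ × ℝ => smoothSign ((z.1 - z.2) / k))
      ((bump ((z.1 - z.2) / k) / k) • ContinuousLinearMap.fst ℝ ℝ ℝ
        + (-(bump ((z.1 - z.2) / k) / k)) • ContinuousLinearMap.snd ℝ ℝ ℝ) z := by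
  have h1 : HasFDerivAt (fun z : ℝ × ℝ => (z.1 - z.2) / k)
      (k⁻¹ • (ContinuousLinearMap.fst ℝ ℝ ℝ - ContinuousLinearMap.snd ℝ ℝ ℝ)) z := by
    have := ((hasFDerivAt_fst (𝕜 := ℝ) (p := z)).sub (hasFDerivAt_snd (𝕜 := ℝ) (p := z))).const_mul
      k⁻¹
    refine this.congr_of_eventuallyEq (.of_forall fun y => ?_)
    simp [div_eq_inv_mul]
  refine ((hasDerivAt_smoothSign _).comp_hasFDerivAt z h1).congr_fderiv ?_
  ext <;> simp [div_eq_mul_inv]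

theorem exists_testFun_triple (hp1 : 1 < p) (hu : HasRegularTruncations Ω Γd p u Du)
    (hv : HasRegularTruncations Ω Γd p v Dv) (n : ℕ) {k : ℝ} (hk : 0 < k) :
    ∃ g, SobolevTriple Ω (ENNReal.ofReal p) (testFun u v n k) (testGrad u Du v Dv n k) g ∧
      ∀ᵐ x ∂(surfaceMeasure Ω), x ∈ Γd → g x = 0 := by
  have hb : ∀ z : ℝ × ℝ, |bump ((z.1 - z.2) / k) / k| ≤ 1 / k := fun z => by
    rw [abs_div, abs_of_pos hk, abs_of_nonneg (bump_nonneg _)]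
    gcongr
    exact bump_le_one _
  have hc : Continuous fun z : ℝ × ℝ => bump ((z.1 - z.2) / k) / k :=
    (bump.continuous.comp ((continuous_fst.sub continuous_snd).div_const k)).div_const k
  exact hu.comp₂ hp1 hv (M := 2 * n + 1) (by positivity) hc hc.neg
    hasFDerivAt_smoothSign_sub (by simp [smoothSign_zero]) hb fun z => (abs_neg _).trans_le (hb z)

theorem rpow_le_of_le_of_le_two_mul {X Y e : ℝ} (hY : 0 < Y) (h1 : Y ≤ X) (h2 : X ≤ 2 * Y) :
    X ^ e ≤ 2 ^ |e| * Y ^ e := by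
  rcases le_total 0 e with h0 | h0
  · calc X ^ e ≤ (2 * Y) ^ e := Real.rpow_le_rpow (by linarith) h2 h0
      _ = 2 ^ |e| * Y ^ e := by rw [Real.mul_rpow two_pos.le hY.le, abs_of_nonneg h0]
  · calc X ^ e ≤ Y ^ e := Real.rpow_le_rpow_of_nonpos hY h1 h0
      _ ≤ 2 ^ |e| * Y ^ e := le_mul_of_one_le_left (by positivity)
          (Real.one_le_rpow one_le_two (abs_nonneg e))

/-- For |s - t| ≤ 1 the quantity |s| + |t| + 1 lies between 1 + |s| and 2(1 + |s|), and likewise for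
t, so its powers are comparable for either sign of γ. With the subadditivity of r^(2-p), this
separates the weight into one term for each solution. -/
theorem convectionWeight_le (hp1 : 1 < p) (hp2 : p ≤ 2) {γ b s t : ℝ} (hst : |s - t| ≤ 1)
    (ξ ξ' : Space N) :
    convectionWeight p γ b s t ξ ξ' ≤ 2 ^ |2 * γ| * (|b| ^ 2 * (1 + |s|) ^ (2 * γ) * ‖ξ‖ ^ (2 - p)
      + |b| ^ 2 * (1 + |t|) ^ (2 * γ) * ‖ξ'‖ ^ (2 - p)) := by
  have h1 : (|s| + |t| + 1) ^ (2 * γ) ≤ 2 ^ |2 * γ| * (1 + |s|) ^ (2 * γ) := by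
    have := abs_sub_abs_le_abs_sub t s
    rw [abs_sub_comm] at this
    exact rpow_le_of_le_of_le_two_mul (by positivity) (by linarith [abs_nonneg t])
      (by linarith [abs_nonneg s])
  have h2 : (|s| + |t| + 1) ^ (2 * γ) ≤ 2 ^ |2 * γ| * (1 + |t|) ^ (2 * γ) := by
    have := abs_sub_abs_le_abs_sub s t
    exact rpow_le_of_le_of_le_two_mul (by positivity) (by linarith [abs_nonneg s])
      (by linarith [abs_nonneg t])
  have h3 : (‖ξ‖ + ‖ξ'‖) ^ (2 - p) ≤ ‖ξ‖ ^ (2 - p) + ‖ξ'‖ ^ (2 - p) :=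
    Real.rpow_add_le_add_rpow (norm_nonneg _) (norm_nonneg _) (by linarith) (by linarith)
  unfold convectionWeight
  calc _ ≤ |b| ^ 2 * (|s| + |t| + 1) ^ (2 * γ) * (‖ξ‖ ^ (2 - p) + ‖ξ'‖ ^ (2 - p)) := by gcongr
    _ = |b| ^ 2 * (|s| + |t| + 1) ^ (2 * γ) * ‖ξ‖ ^ (2 - p)
        + |b| ^ 2 * (|s| + |t| + 1) ^ (2 * γ) * ‖ξ'‖ ^ (2 - p) := by ring
    _ ≤ |b| ^ 2 * (2 ^ |2 * γ| * (1 + |s|) ^ (2 * γ)) * ‖ξ‖ ^ (2 - p)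
        + |b| ^ 2 * (2 ^ |2 * γ| * (1 + |t|) ^ (2 * γ)) * ‖ξ'‖ ^ (2 - p) := by gcongr
    _ = _ := by ring

theorem bump_div_eq_zero {k r : ℝ} (hk : 0 < k) (h : k ≤ |r|) : bump (r / k) = 0 := by
  refine bump_eq_zero ?_
  rwa [abs_div, abs_of_pos hk, le_div_iff₀ hk, one_mul]

theorem aemeasurable_monotoneForm (hDum : AEMeasurable Du (volume.restrict Ω))
    (hDvm : AEMeasurable Dv (volume.restrict Ω)) :
    AEMeasurable (fun x => monotoneForm p (Du x) (Dv x)) (volume.restrict Ω) :=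
  ((hDum.sub hDvm).norm.pow_const 2).div ((hDum.norm.add hDvm.norm).pow_const _)

theorem aemeasurable_convectionWeight {γ : ℝ} (hbm : AEMeasurable b (volume.restrict Ω))
    (hum : AEMeasurable u (volume.restrict Ω)) (hvm : AEMeasurable v (volume.restrict Ω))
    (hDum : AEMeasurable Du (volume.restrict Ω)) (hDvm : AEMeasurable Dv (volume.restrict Ω)) :
    AEMeasurable (fun x => convectionWeight p γ (b x) (u x) (v x) (Du x) (Dv x))
      (volume.restrict Ω) :=
  ((hbm.abs.pow_const 2).mul (((hum.abs.add hvm.abs).add_const 1).pow_const _)).mul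
    ((hDum.norm.add hDvm.norm).pow_const _)

theorem aemeasurable_bump (k : ℝ) (hum : AEMeasurable u (volume.restrict Ω))
    (hvm : AEMeasurable v (volume.restrict Ω)) :
    AEMeasurable (fun x => bump ((u x - v x) / k)) (volume.restrict Ω) :=
  bump.continuous.measurable.comp_aemeasurable ((hum.sub hvm).div_const k)

theorem aemeasurable_cutoff (n : ℕ) (hum : AEMeasurable u (volume.restrict Ω)) :
    AEMeasurable (fun x => cutoff (u x / n)) (volume.restrict Ω) :=
  cutoff.continuous.measurable.comp_aemeasurable (hum.div_const _)

/-- The convection contributes `o(1)` on the set where `u` and `v` are close. -/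
theorem tendsto_convectionWeight (hΩ : IsOpen Ω) (hb : Bornology.IsBounded Ω)
    (hL : HasLipschitzBoundary Ω) (hN : 2 < N) (hp1 : 1 < p) (hp2 : p ≤ 2)
    (hdata : StructuralAssumptions Ω p α β a lam Φ d b f) {γ : ℝ} (hγ : γ < p - 3 / 2)
    (hu : HasRegularTruncations Ω Γd p u Du) (hv : HasRegularTruncations Ω Γd p v Dv) :
    (∀ k, 0 < k → k ≤ 1 → Integrable (fun x => bump ((u x - v x) / k) * ((u x - v x) / k) ^ 2
      * convectionWeight p γ (b x) (u x) (v x) (Du x) (Dv x)) (volume.restrict Ω)) ∧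
    Tendsto (fun j : ℕ => ∫ x in Ω, bump ((u x - v x) / (1 / ((j : ℝ) + 1)))
      * ((u x - v x) / (1 / ((j : ℝ) + 1))) ^ 2
      * convectionWeight p γ (b x) (u x) (v x) (Du x) (Dv x)) atTop (𝓝 0) := by
  set G : Space N → ℝ := fun x => 2 ^ |2 * γ| * (|b x| ^ 2 * (1 + |u x|) ^ (2 * γ)
    * ‖Du x‖ ^ (2 - p) + |b x| ^ 2 * (1 + |v x|) ^ (2 * γ) * ‖Dv x‖ ^ (2 - p)) with hG
  have hI : Integrable G (volume.restrict Ω) :=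
    ((hu.integrable_weight hΩ hb hL hN hp1 hp2 hdata.aemeasurable_b
      (hdata.integrable_b hN hp1) hγ).add (hv.integrable_weight hΩ hb hL hN hp1 hp2
      hdata.aemeasurable_b (hdata.integrable_b hN hp1) hγ)).const_mul (2 ^ |2 * γ|)
  have hG0 : ∀ x, 0 ≤ G x := fun x => by
    simp only [hG]
    positivity
  have hm : ∀ k : ℝ, AEStronglyMeasurable (fun x => bump ((u x - v x) / k)
      * ((u x - v x) / k) ^ 2 * convectionWeight p γ (b x) (u x) (v x) (Du x) (Dv x))
      (volume.restrict Ω) := fun k =>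
    (((aemeasurable_bump k hu.aemeasurable hv.aemeasurable).mul
      (((hu.aemeasurable.sub hv.aemeasurable).div_const k).pow_const 2)).mul
      (aemeasurable_convectionWeight hdata.aemeasurable_b hu.aemeasurable hv.aemeasurable
        hu.aemeasurable_grad hv.aemeasurable_grad)).aestronglyMeasurable
  have hle : ∀ k, 0 < k → k ≤ 1 → ∀ x, ‖bump ((u x - v x) / k) * ((u x - v x) / k) ^ 2
      * convectionWeight p γ (b x) (u x) (v x) (Du x) (Dv x)‖ ≤ G x := by
    intro k hk hk1 x
    have hW := convectionWeight_nonneg (p := p) γ (b x) (u x) (v x) (Du x) (Dv x)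
    have hb0 := bump_nonneg ((u x - v x) / k)
    rw [Real.norm_of_nonneg (by positivity)]
    by_cases h : |u x - v x| < k
    · have h1 : ((u x - v x) / k) ^ 2 ≤ 1 := by
        rw [sq_le_one_iff_abs_le_one, abs_div, abs_of_pos hk, div_le_one hk]
        exact h.le
      exact (mul_le_of_le_one_left hW (mul_le_one₀ (bump_le_one _) (sq_nonneg _) h1)).trans
        (convectionWeight_le hp1 hp2 (by linarith) _ _)
    · rw [bump_div_eq_zero hk (not_lt.1 h), zero_mul, zero_mul]
      exact hG0 x
  have hkj : ∀ j : ℕ, 1 / ((j : ℝ) + 1) ≤ 1 := fun j => by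
    rw [div_le_one (by positivity)]
    linarith [(Nat.cast_nonneg j : (0 : ℝ) ≤ j)]
  refine ⟨fun k hk hk1 => hI.mono' (hm k) (.of_forall (hle k hk hk1)), ?_⟩
  -- The pointwise limit is 0: where u = v the square vanishes, elsewhere the bump does as soon as k
  -- ≤ |u - v|.
  have := tendsto_integral_of_dominated_convergence (μ := volume.restrict Ω) (f := fun _ => 0) G
    (fun j : ℕ => hm (1 / ((j : ℝ) + 1))) hI
    (fun j => .of_forall (hle _ (by positivity) (hkj j))) (.of_forall fun x => by
      refine tendsto_const_nhds.congr' ?_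
      by_cases h : u x - v x = 0
      · refine .of_forall fun j => ?_
        rw [h]
        simp
      · filter_upwards [(tendsto_one_div_add_atTop_nhds_zero_nat (𝕜 := ℝ)).eventually
          (gt_mem_nhds (abs_pos.2 h))] with j hj
        rw [bump_div_eq_zero (by positivity) hj.le, zero_mul, zero_mul])
  simpa using this

theorem tendsto_energyError (hΩ : IsOpen Ω) (hb : Bornology.IsBounded Ω)
    (hL : HasLipschitzBoundary Ω) (hN : 2 < N) (hp1 : 1 < p) (hp2 : p ≤ 2)
    (hdata : StructuralAssumptions Ω p α β a lam Φ d b f)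
    (hu : HasRegularTruncations Ω Γd p u Du) (hv : HasRegularTruncations Ω Γd p v Dv)
    (hlv : Integrable (fun x => lam x (v x)) (volume.restrict Ω)) (K : ℝ) :
    (∀ n, 0 < n → Integrable (energyError p K lam d b f u v (jointNorm u Du v Dv) n)
      (volume.restrict Ω)) ∧
    Tendsto (fun n => ∫ x in Ω, energyError p K lam d b f u v (jointNorm u Du v Dv) n x)
      atTop (𝓝 0) := by
  have hp0 : 0 < p := by linarith
  have hJ0 : ∀ n x, 0 ≤ jointNorm u Du v Dv n x := fun n x => jointNorm_nonneg n x
  obtain ⟨hui, hut⟩ := fluxError_tendsto hΩ hb hL hN hp1 hp2 hdata hu hJ0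
    (aemeasurable_jointNorm hu hv) (integrable_jointNorm_rpow hp0 hp2 hu hv)
    (tendsto_jointNorm hp0 hp2 hu hv)
  obtain ⟨hvi, hvt⟩ := fluxError_tendsto hΩ hb hL hN hp1 hp2 hdata hv hJ0
    (aemeasurable_jointNorm hu hv) (integrable_jointNorm_rpow hp0 hp2 hu hv)
    (tendsto_jointNorm hp0 hp2 hu hv)
  have hfi : Integrable f (volume.restrict Ω) := memLp_one_iff_integrable.1 hdata.f_mem
  have hS : Integrable (fun x => |lam x (v x)| + |f x|) (volume.restrict Ω) := hlv.abs.add hfi.abs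
  have hm : ∀ n : ℕ, AEStronglyMeasurable (fun x => (|lam x (v x)| + |f x|)
      * |cutoff (u x / n) - cutoff (v x / n)|) (volume.restrict Ω) := fun n =>
    (hS.1.aemeasurable.mul ((aemeasurable_cutoff n hu.aemeasurable).sub
      (aemeasurable_cutoff n hv.aemeasurable)).abs).aestronglyMeasurable
  have hle : ∀ (n : ℕ) x, ‖(|lam x (v x)| + |f x|) * |cutoff (u x / n) - cutoff (v x / n)|‖
      ≤ |lam x (v x)| + |f x| := fun n x => by
    rw [Real.norm_of_nonneg (by positivity)]
    refine mul_le_of_le_one_right (by positivity) (abs_le.2 ⟨?_, ?_⟩) <;>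
    linarith [cutoff_nonneg (u x / n), cutoff_le_one (u x / n), cutoff_nonneg (v x / n),
      cutoff_le_one (v x / n)]
  have hi : ∀ n : ℕ, Integrable (fun x => (|lam x (v x)| + |f x|)
      * |cutoff (u x / n) - cutoff (v x / n)|) (volume.restrict Ω) := fun n =>
    hS.mono' (hm n) (.of_forall (hle n))
  have h1 : Tendsto (fun n : ℕ => ∫ x in Ω, (|lam x (v x)| + |f x|)
      * |cutoff (u x / n) - cutoff (v x / n)|) atTop (𝓝 0) := by
    have := tendsto_integral_of_dominated_convergence (μ := volume.restrict Ω) (f := fun _ => 0)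
      _ hm hS (fun n => .of_forall (hle n)) (.of_forall fun x => by
        refine tendsto_const_nhds.congr' ?_
        obtain ⟨n₀, hn₀⟩ := exists_nat_gt (max |u x| |v x|)
        filter_upwards [eventually_ge_atTop n₀, eventually_gt_atTop 0] with n hn hn0
        have : (n₀ : ℝ) ≤ n := by exact_mod_cast hn
        rw [max_lt_iff] at hn₀
        rw [cutoff_eq_one ((abs_div_natCast_lt hn0).2 (by linarith)).le,
          cutoff_eq_one ((abs_div_natCast_lt hn0).2 (by linarith)).le]
        simp)
    simpa using this
  have hF : ∀ n : ℕ, 0 < n → Integrable (fun x => fluxError p d b u (jointNorm u Du v Dv) n x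
      + 2 * fluxError p d b v (jointNorm u Du v Dv) n x) (volume.restrict Ω) := fun n hn =>
    (hui n hn).add ((hvi n hn).const_mul 2)
  refine ⟨fun n hn => (hi n).add ((hF n hn).const_mul K), ?_⟩
  have h2 := h1.add ((hut.add (hvt.const_mul 2)).const_mul K)
  simp only [mul_zero, add_zero] at h2
  refine h2.congr' ?_
  filter_upwards [eventually_gt_atTop 0] with n hn
  unfold energyError
  rw [integral_add (hi n) ((hF n hn).const_mul K), integral_const_mul,
    integral_add (hui n hn) ((hvi n hn).const_mul 2), integral_const_mul]

/-- Where the product of cutoff and bump is nonzero both |u| and |v| are below 2m + 1, and there the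
form is at most the p-th power of `jointNorm`. -/
theorem integrable_monotoneForm (hp1 : 1 < p) (hp2 : p ≤ 2)
    (hu : HasRegularTruncations Ω Γd p u Du) (hv : HasRegularTruncations Ω Γd p v Dv) {m : ℕ}
    (hm : 0 < m) {k : ℝ} (hk : 0 < k) (hk1 : k ≤ 1) :
    Integrable (fun x => cutoff (u x / m) * (bump ((u x - v x) / k) / k)
      * monotoneForm p (Du x) (Dv x)) (volume.restrict Ω) := by
  have hp0 : 0 < p := by linarith
  refine ((integrable_jointNorm_rpow hp0 hp2 hu hv m).const_mul (1 / k)).mono'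
    (((aemeasurable_cutoff m hu.aemeasurable).mul ((aemeasurable_bump k hu.aemeasurable
      hv.aemeasurable).div_const k)).mul (aemeasurable_monotoneForm hu.aemeasurable_grad
      hv.aemeasurable_grad)).aestronglyMeasurable (.of_forall fun x => ?_)
  have hQ := monotoneForm_nonneg (p := p) (Du x) (Dv x)
  have h0 := cutoff_nonneg (u x / m)
  have h1 := bump_nonneg ((u x - v x) / k)
  have hJ := Real.rpow_nonneg (jointNorm_nonneg (u := u) (Du := Du) (v := v) (Dv := Dv) m x) p
  rw [Real.norm_of_nonneg (by positivity)]
  by_cases h : |u x| < 2 * m ∧ |u x - v x| < k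
  · have h2 : |v x| < 2 * m + 1 := by
      have := abs_sub_abs_le_abs_sub (v x) (u x)
      rw [abs_sub_comm] at this
      linarith [h.1, h.2]
    rw [jointNorm_eq (by linarith [h.1]) h2]
    refine mul_le_mul ?_ (monotoneForm_le hp1 _ _) hQ (by positivity)
    calc cutoff (u x / m) * (bump ((u x - v x) / k) / k) ≤ 1 * (1 / k) := by
          gcongr
          · exact cutoff_le_one _
          · exact bump_le_one _
      _ = 1 / k := one_mul _
  · have : cutoff (u x / m) * (bump ((u x - v x) / k) / k) = 0 := by
      rw [not_and_or, not_lt, not_lt] at h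
      rcases h with h | h
      · rw [cutoff_div_eq_zero hm h, zero_mul]
      · rw [bump_div_eq_zero hk h, zero_div, mul_zero]
    rw [this, zero_mul]
    positivity

/-- The energy estimate for the difference of two renormalized solutions. -/
theorem energy_estimate {L γ : ℝ} (hΩ : IsOpen Ω) (hb : Bornology.IsBounded Ω)
    (hL : HasLipschitzBoundary Ω) (hN : 2 < N) (hp1 : 1 < p) (hp2 : p ≤ 2)
    (hdata : StructuralAssumptions Ω p α β a lam Φ d b f)
    (hlam : ∀ᵐ x ∂(volume.restrict Ω), ∀ r r' : ℝ, 0 ≤ (lam x r - lam x r') * (r - r'))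
    (ha : ∀ᵐ x ∂(volume.restrict Ω), ∀ ξ ξ' : Space N,
      α * (‖ξ - ξ'‖ ^ 2 / (‖ξ‖ + ‖ξ'‖) ^ (2 - p)) ≤ inner ℝ (a x ξ - a x ξ') (ξ - ξ'))
    (hγ : γ < p - 3 / 2)
    (hΦ : ∀ᵐ x ∂(volume.restrict Ω), ∀ r r' : ℝ,
      ‖Φ x r - Φ x r'‖ ≤ L * |r - r'| * |b x| * (|r| + |r'| + 1) ^ γ)
    (hu : HasRegularTruncations Ω Γd p u Du) (hv : HasRegularTruncations Ω Γd p v Dv)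
    (hequ : SatisfiesEquation Ω Γd p a lam Φ f u Du)
    (heqv : SatisfiesEquation Ω Γd p a lam Φ f v Dv) {m : ℕ} (hm : 0 < m) {k : ℝ} (hk : 0 < k)
    (hk1 : k ≤ 1) :
    ∫ x in Ω, cutoff (u x / m) * (bump ((u x - v x) / k) / k) * monotoneForm p (Du x) (Dv x)
      ≤ L ^ 2 / α ^ 2 * k * ∫ x in Ω, bump ((u x - v x) / k) * ((u x - v x) / k) ^ 2
        * convectionWeight p γ (b x) (u x) (v x) (Du x) (Dv x) := by
  obtain ⟨C, hC0, hC⟩ := exists_deriv_cutoff_bound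
  have hα := hdata.α_pos
  have hlv := heqv.integrable_lam hΩ hb hL hN hp1 hp2 hdata hv
  obtain ⟨hEi, hEt⟩ := tendsto_energyError hΩ hb hL hN hp1 hp2 hdata hu hv hlv
    (C * (3 * |β| + 4))
  have hq := integrable_monotoneForm hp1 hp2 hu hv hm hk hk1
  have hr := (tendsto_convectionWeight hΩ hb hL hN hp1 hp2 hdata hγ hu hv).1 k hk hk1
  set q : Space N → ℝ := fun x => cutoff (u x / m) * (bump ((u x - v x) / k) / k)
    * monotoneForm p (Du x) (Dv x) with hqdef
  set r : Space N → ℝ := fun x => bump ((u x - v x) / k) * ((u x - v x) / k) ^ 2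
    * convectionWeight p γ (b x) (u x) (v x) (Du x) (Dv x) with hrdef
  set c : ℝ := L ^ 2 / (2 * α) * k with hc
  -- m and k are fixed and the left side does not depend on n, so the error may be sent to zero by n
  -- → ∞.
  have hkey : ∀ᶠ n : ℕ in atTop, α / 2 * (∫ x in Ω, q x) - c * (∫ x in Ω, r x)
      ≤ ∫ x in Ω, energyError p (C * (3 * |β| + 4)) lam d b f u v (jointNorm u Du v Dv) n x := by
    filter_upwards [eventually_ge_atTop (2 * m), eventually_gt_atTop 0] with n hn hn0
    obtain ⟨g, hg, hg0⟩ := exists_testFun_triple hp1 hu hv n hk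
    obtain ⟨iu, eu⟩ := hequ n _ g _ hn0 hg hg0 fun x => abs_smoothSign_le _
    obtain ⟨iv, ev⟩ := heqv n _ g _ hn0 hg hg0 fun x => abs_smoothSign_le _
    have i1 : Integrable (fun x => α / 2 * q x - c * r x) (volume.restrict Ω) :=
      (hq.const_mul _).sub (hr.const_mul _)
    have h1 := integral_mono_ae (i1.sub (hEi n hn0)) (iu.sub iv) (by
      filter_upwards [residual_difference_ge (u := u) (v := v) (Du := Du) (Dv := Dv) hp1 hp2 hdata
        hlam ha hΦ hC] with x hx
      refine le_trans ?_ (hx n k hn0 hk hk1)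
      simp only [Pi.sub_apply]
      refine sub_le_sub_right ?_ _
      have hQ := monotoneForm_nonneg (p := p) (Du x) (Dv x)
      have hW := convectionWeight_nonneg (p := p) γ (b x) (u x) (v x) (Du x) (Dv x)
      have hθ : 0 ≤ bump ((u x - v x) / k) / k := div_nonneg (bump_nonneg _) hk.le
      -- For n ≥ 2m the n-cutoff equals 1 on the support of the m-cutoff, so the good term may be
      -- localized further.
      have hcut : cutoff (u x / m) ≤ cutoff (u x / n) := by
        by_cases h : |u x| < 2 * m
        · have : (2 * m : ℝ) ≤ n := by exact_mod_cast hn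
          rw [cutoff_eq_one (s := u x / n) ((abs_div_natCast_lt hn0).2 (by linarith)).le]
          exact cutoff_le_one _
        · rw [cutoff_div_eq_zero hm (not_lt.1 h)]
          exact cutoff_nonneg _
      -- (u - v)²/k = k ((u - v)/k)²: this is the source of the factor k.
      have e1 : c * r x = 1 * (bump ((u x - v x) / k) / k * (L ^ 2 / (2 * α) * (u x - v x) ^ 2
          * convectionWeight p γ (b x) (u x) (v x) (Du x) (Dv x))) := by
        simp only [hc, hrdef]
        field_simp
      have e2 : α / 2 * q x = cutoff (u x / m) * (bump ((u x - v x) / k) / k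
          * (α / 2 * monotoneForm p (Du x) (Dv x))) := by
        simp only [hqdef]
        ring
      rw [e1, e2]
      have h2 : cutoff (u x / m) * (bump ((u x - v x) / k) / k
          * (α / 2 * monotoneForm p (Du x) (Dv x))) ≤ cutoff (u x / n)
          * (bump ((u x - v x) / k) / k * (α / 2 * monotoneForm p (Du x) (Dv x))) := by gcongr
      have h3 : cutoff (u x / n) * (bump ((u x - v x) / k) / k * (L ^ 2 / (2 * α)
          * (u x - v x) ^ 2 * convectionWeight p γ (b x) (u x) (v x) (Du x) (Dv x)))
          ≤ 1 * (bump ((u x - v x) / k) / k * (L ^ 2 / (2 * α)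
          * (u x - v x) ^ 2 * convectionWeight p γ (b x) (u x) (v x) (Du x) (Dv x))) :=
        mul_le_mul_of_nonneg_right (cutoff_le_one _) (by positivity)
      linarith)
    rw [integral_sub' i1 (hEi n hn0), integral_sub' iu iv, eu, ev,
      integral_sub (hq.const_mul _) (hr.const_mul _), integral_const_mul,
      integral_const_mul] at h1
    linarith
  have hfin := ge_of_tendsto hEt hkey
  have h1 : α / 2 * (∫ x in Ω, q x) ≤ c * ∫ x in Ω, r x := by linarith
  have h2 : L ^ 2 / α ^ 2 * k * (∫ x in Ω, r x) = 2 / α * (c * ∫ x in Ω, r x) := by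
    rw [hc]
    field_simp
  rw [h2]
  calc ∫ x in Ω, q x = 2 / α * (α / 2 * ∫ x in Ω, q x) := by field_simp
    _ ≤ _ := by gcongr

end Energy

/-! ### Passage to the limit and uniqueness -/

section Conclusion

variable {N : ℕ} {Ω Γn Γd : Set (Space N)}

/-- If functions with null trace on `Γd` tend to `w` in `L¹(Ω)` and their gradients tend to zero
in `L¹(Ω)`, then `w = 0`. -/
theorem ae_eq_zero_of_tendsto_sobolevTriple (hΩ : IsAdmissibleDomain Ω Γn Γd) {q : ℝ≥0∞}
    (hq : 1 ≤ q) {ψ g : ℕ → Space N → ℝ} {D : ℕ → Space N → Space N}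
    (h : ∀ m, SobolevTriple Ω q (ψ m) (D m) (g m))
    (hg : ∀ m, ∀ᵐ x ∂(surfaceMeasure Ω), x ∈ Γd → g m x = 0) {w : Space N → ℝ}
    (hw : AEMeasurable w (volume.restrict Ω))
    (h1 : Tendsto (fun m => eLpNorm (fun x => ψ m x - w x) 1 (volume.restrict Ω)) atTop (𝓝 0))
    (h2 : Tendsto (fun m => ∫⁻ x in Ω, ‖D m x‖ₑ) atTop (𝓝 0)) :
    ∀ᵐ x ∂(volume.restrict Ω), w x = 0 := by
  have hfin := isFiniteMeasure_restrict hΩ.isBounded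
  have hδ : Tendsto (fun m : ℕ => ENNReal.ofReal (1 / ((m : ℝ) + 1))) atTop (𝓝 0) := by
    simpa using ENNReal.tendsto_ofReal (tendsto_one_div_add_atTop_nhds_zero_nat (𝕜 := ℝ))
  -- A diagonal choice: each triple is replaced by one C¹ function within 1/(m + 1) of its function,
  -- gradient and trace.
  have hex : ∀ m : ℕ, ∃ φ : Space N → ℝ, ContDiff ℝ 1 φ ∧
      eLpNorm (fun x => φ x - ψ m x) q (volume.restrict Ω) ≤ ENNReal.ofReal (1 / ((m : ℝ) + 1)) ∧
      eLpNorm (fun x => gradient φ x - D m x) q (volume.restrict Ω)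
        ≤ ENNReal.ofReal (1 / ((m : ℝ) + 1)) ∧
      eLpNorm (fun x => φ x - g m x) q (surfaceMeasure Ω)
        ≤ ENNReal.ofReal (1 / ((m : ℝ) + 1)) := by
    intro m
    obtain ⟨φ, hφ, e1, e2, e3⟩ := (h m).approx
    have hpos : 0 < ENNReal.ofReal (1 / ((m : ℝ) + 1)) := by
      rw [ENNReal.ofReal_pos]
      positivity
    obtain ⟨i, hi1, hi2, hi3⟩ := ((e1.eventually (gt_mem_nhds hpos)).and
      ((e2.eventually (gt_mem_nhds hpos)).and (e3.eventually (gt_mem_nhds hpos)))).exists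
    exact ⟨φ i, hφ i, hi1.le, hi2.le, hi3.le⟩
  choose φ hφ e1 e2 e3 using hex
  have hlim : ∀ {F : ℕ → ℝ≥0∞}, (∀ m : ℕ, F m ≤ ENNReal.ofReal (1 / ((m : ℝ) + 1))) →
      Tendsto F atTop (𝓝 0) := fun hF =>
    tendsto_of_tendsto_of_tendsto_of_le_of_le tendsto_const_nhds hδ (fun _ => zero_le) hF
  have m1 : ∀ m, AEStronglyMeasurable (fun x => φ m x - ψ m x) (volume.restrict Ω) := fun m =>
    (hφ m).continuous.aestronglyMeasurable.sub (h m).memLp.1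
  have m2 : ∀ m, AEStronglyMeasurable (fun x => gradient (φ m) x - D m x) (volume.restrict Ω) :=
    fun m => (continuous_gradient (hφ m)).aestronglyMeasurable.sub (h m).memLp_grad.1
  have t1 := tendsto_eLpNorm_one_of_tendsto hq m1 (hlim e1)
  have t2 := tendsto_eLpNorm_one_of_tendsto hq m2 (hlim e2)
  refine ae_eq_zero_of_tendsto_trace hΩ hφ hw ?_ ?_ fun A hA hAt => ?_
  · have := t1.add h1
    rw [add_zero] at this
    refine tendsto_of_tendsto_of_tendsto_of_le_of_le tendsto_const_nhds this (fun _ => zero_le)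
      fun m => ?_
    rw [← eLpNorm_one_eq_lintegral_enorm]
    refine le_trans (le_of_eq ?_) (eLpNorm_add_le (m1 m)
      ((h m).memLp.1.sub hw.aestronglyMeasurable) le_rfl)
    congr 1
    ext x
    simp
  · have := h2.add t2
    rw [add_zero] at this
    exact tendsto_of_tendsto_of_tendsto_of_le_of_le tendsto_const_nhds this (fun _ => zero_le)
      fun m => lintegral_enorm_le_add_eLpNorm_sub
        (continuous_gradient (hφ m)).aestronglyMeasurable (h m).memLp_grad.1
  -- On Γd the trace vanishes, so the distance to the trace is the approximant itself; finiteness of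
  -- the measure of A allows passing from L^q to L¹.
  · have hAfin : IsFiniteMeasure ((surfaceMeasure Ω).restrict (Γd ∩ A)) :=
      ⟨by
        rw [Measure.restrict_apply_univ]
        exact (measure_mono Set.inter_subset_right).trans_lt hAt.lt_top⟩
    have m3 : ∀ m, AEStronglyMeasurable (fun x => φ m x - g m x)
        ((surfaceMeasure Ω).restrict (Γd ∩ A)) := fun m =>
      ((hφ m).continuous.aestronglyMeasurable.sub (h m).memLp_trace.1).mono_measure
        Measure.restrict_le_self
    have t3 := tendsto_eLpNorm_one_of_tendsto hq m3 (hlim fun m =>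
      (eLpNorm_mono_measure _ Measure.restrict_le_self).trans (e3 m))
    refine t3.congr fun m => ?_
    rw [eLpNorm_one_eq_lintegral_enorm]
    refine lintegral_congr_ae ?_
    filter_upwards [ae_restrict_mem₀ (hΩ.nullMeasurable_dirichlet.inter hA.nullMeasurableSet),
      ae_restrict_of_ae (hg m)] with x hx hgx
    rw [hgx hx.1, sub_zero]

theorem abs_limitSign_le (s : ℝ) : |limitSign s| ≤ 1 := by
  by_cases h : s = 0
  · rw [limitSign_eq_zero_iff.2 h]
    simp
  · rw [← smoothSign_div_eq_limitSign (abs_pos.2 h) (Or.inr le_rfl)]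
    exact abs_smoothSign_le _

variable {p α β : ℝ} {a : Space N → Space N → Space N}
  {lam : Space N → ℝ → ℝ} {Φ : Space N → ℝ → Space N} {d b f : Space N → ℝ}
  {u v : Space N → ℝ} {Du Dv : Space N → Space N}

/-- The function of the two truncations that is compared with the sign of `u - v`. -/
noncomputable def localizedSign (m k : ℝ) (z : ℝ × ℝ) : ℝ :=
  cutoff (z.1 / m) * smoothSign ((z.1 - z.2) / k)

theorem abs_localizedSign_le (m k : ℝ) (z : ℝ × ℝ) : |localizedSign m k z| ≤ 1 := by
  rw [localizedSign, abs_mul, abs_of_nonneg (cutoff_nonneg _)]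
  exact mul_le_one₀ (cutoff_le_one _) (abs_nonneg _) (abs_smoothSign_le _)

theorem hasFDerivAt_localizedSign {m k : ℝ} (z : ℝ × ℝ) :
    HasFDerivAt (localizedSign m k)
      ((deriv cutoff (z.1 / m) / m * smoothSign ((z.1 - z.2) / k)
          + cutoff (z.1 / m) * (bump ((z.1 - z.2) / k) / k)) • ContinuousLinearMap.fst ℝ ℝ ℝ
        + (-(cutoff (z.1 / m) * (bump ((z.1 - z.2) / k) / k)))
          • ContinuousLinearMap.snd ℝ ℝ ℝ) z := by
  have h1 := (hasDerivAt_cutoff_div (m := m) z.1).comp_hasFDerivAt z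
    (hasFDerivAt_fst (𝕜 := ℝ) (p := z))
  refine (h1.mul (hasFDerivAt_smoothSign_sub (k := k) z)).congr_fderiv ?_
  ext
  · simp
    ring
  · simp

/-- The comparison function with its gradient, which is small in `L¹(Ω)`. -/
theorem exists_localizedSign_triple (hp1 : 1 < p) (hu : HasRegularTruncations Ω Γd p u Du)
    (hv : HasRegularTruncations Ω Γd p v Dv) {C : ℝ} (hC0 : 0 < C)
    (hC : ∀ s, |deriv cutoff s| ≤ C) {m : ℕ} (hm : 0 < m) {k : ℝ} (hk : 0 < k) (hk1 : k ≤ 1) :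
    ∃ D g, SobolevTriple Ω (ENNReal.ofReal p)
        (fun x => localizedSign m k (trunc (2 * m + 1) (u x), trunc (2 * m + 1) (v x))) D g ∧
      (∀ᵐ x ∂(surfaceMeasure Ω), x ∈ Γd → g x = 0) ∧
      ∀ x, ‖D x‖ ≤ C / m * {x | |u x| < 2 * (m : ℝ) + 1}.indicator (fun x => ‖Du x‖) x
        + cutoff (u x / m) * (bump ((u x - v x) / k) / k) * ‖Du x - Dv x‖ := by
  have hm0 : (0 : ℝ) < m := by exact_mod_cast hm
  have hc1 : Continuous fun z : ℝ × ℝ => bump ((z.1 - z.2) / k) / k :=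
    (bump.continuous.comp ((continuous_fst.sub continuous_snd).div_const k)).div_const k
  have hc2 : Continuous fun z : ℝ × ℝ => cutoff (z.1 / m) :=
    cutoff.continuous.comp (continuous_fst.div_const _)
  have hc3 : Continuous fun z : ℝ × ℝ => deriv cutoff (z.1 / m) / m :=
    (continuous_deriv_cutoff.comp (continuous_fst.div_const _)).div_const _
  have hc4 : Continuous fun z : ℝ × ℝ => smoothSign ((z.1 - z.2) / k) :=
    continuous_smoothSign.comp ((continuous_fst.sub continuous_snd).div_const k)
  have hb1 : ∀ s t : ℝ, |cutoff s * (bump t / k)| ≤ 1 / k := fun s t => by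
    rw [abs_of_nonneg (mul_nonneg (cutoff_nonneg _) (div_nonneg (bump_nonneg _) hk.le))]
    calc cutoff s * (bump t / k) ≤ 1 * (1 / k) := by
          gcongr
          · exact div_nonneg (bump_nonneg _) hk.le
          · exact cutoff_le_one _
          · exact bump_le_one _
      _ = 1 / k := one_mul _
  have hb2 : ∀ s t : ℝ, |deriv cutoff s / m * smoothSign t| ≤ C / m := fun s t => by
    rw [abs_mul, abs_div, abs_of_pos hm0]
    exact (mul_le_of_le_one_right (by positivity) (abs_smoothSign_le _)).trans (by
      gcongr
      exact hC _)
  obtain ⟨g, hg, hg0⟩ := hu.comp₂ hp1 hv (M := 2 * m + 1) (by positivity)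
    ((hc3.mul hc4).add (hc2.mul hc1)) (hc2.mul hc1).neg (hasFDerivAt_localizedSign (m := m) (k := k))
    (by simp [localizedSign, smoothSign_zero]) (C := C / m + 1 / k)
    (fun z => (abs_add_le _ _).trans (add_le_add (hb2 _ _) (hb1 _ _)))
    (fun z => (abs_neg _).trans_le ((hb1 _ _).trans (le_add_of_nonneg_left (by positivity))))
  refine ⟨_, g, hg, hg0, fun x => ?_⟩
  set T : ℝ := bump ((trunc (2 * m + 1) (u x) - trunc (2 * m + 1) (v x)) / k) with hT
  have hcut : cutoff (trunc (2 * m + 1) (u x) / m) = cutoff (u x / m) :=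
    cutoff_trunc_div hm0 (by linarith)
  have hind : ‖{x | |u x| < 2 * (m : ℝ) + 1}.indicator Du x‖
      = {x | |u x| < 2 * (m : ℝ) + 1}.indicator (fun x => ‖Du x‖) x := by
    by_cases hx : |u x| < 2 * (m : ℝ) + 1 <;> simp [hx]
  -- Regrouped so that the bump multiplies Du - Dv and the derivative of the cutoff multiplies Du
  -- alone.
  have hsplit : ∀ (A B : ℝ) (U V : Space N), (A + B) • U + (-B) • V = A • U + B • (U - V) := by
    intro A B U V
    rw [add_smul, smul_sub, neg_smul]
    abel
  simp only [Pi.neg_apply, Pi.add_apply, Pi.mul_apply]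
  rw [hsplit, hcut]
  refine (norm_add_le _ _).trans (add_le_add ?_ ?_)
  · rw [norm_smul, hind, Real.norm_eq_abs]
    exact mul_le_mul_of_nonneg_right (hb2 _ _) (Set.indicator_nonneg (fun _ _ => norm_nonneg _) _)
  · have hR : 0 ≤ cutoff (u x / m) * (bump ((u x - v x) / k) / k) * ‖Du x - Dv x‖ :=
      mul_nonneg (mul_nonneg (cutoff_nonneg _) (div_nonneg (bump_nonneg _) hk.le)) (norm_nonneg _)
    by_cases hu2 : |u x| < 2 * m
    · by_cases hT0 : T = 0
      · rw [← hT, hT0]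
        simpa using hR
      · have hTk : |trunc (2 * m + 1) (u x) - trunc (2 * m + 1) (v x)| < 1 := by
          by_contra h
          exact hT0 (bump_div_eq_zero hk (by linarith))
        have hv1 := abs_lt_of_abs_trunc_sub_lt (by positivity) hu2 hTk
        have hu1 : |u x| < 2 * m + 1 := by linarith
        rw [trunc_of_abs_le hu1.le, trunc_of_abs_le hv1.le,
          Set.indicator_of_mem (s := {x | |u x| < 2 * (m : ℝ) + 1}) (a := x) hu1,
          Set.indicator_of_mem (s := {x | |v x| < 2 * (m : ℝ) + 1}) (a := x) hv1, norm_smul,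
          Real.norm_of_nonneg (mul_nonneg (cutoff_nonneg _) (div_nonneg (bump_nonneg _) hk.le))]
    · rw [cutoff_div_eq_zero hm (not_lt.1 hu2)]
      simp

theorem integrable_jointNorm_rpow_two_sub [IsFiniteMeasure (volume.restrict Ω)] (hp1 : 1 < p)
    (hp2 : p ≤ 2) (hu : HasRegularTruncations Ω Γd p u Du)
    (hv : HasRegularTruncations Ω Γd p v Dv) (m : ℕ) :
    Integrable (fun x => jointNorm u Du v Dv m x ^ (2 - p)) (volume.restrict Ω) := by
  refine ((integrable_const (1 : ℝ)).add (integrable_jointNorm_rpow (by linarith) hp2 hu hv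
    m)).mono' ((aemeasurable_jointNorm hu hv m).pow_const _).aestronglyMeasurable
    (.of_forall fun x => ?_)
  have hJ := jointNorm_nonneg (u := u) (Du := Du) (v := v) (Dv := Dv) m x
  rw [Real.norm_of_nonneg (Real.rpow_nonneg hJ _)]
  simp only [Pi.add_apply]
  rcases le_total (jointNorm u Du v Dv m x) 1 with h | h
  · linarith [Real.rpow_le_one hJ h (by linarith : 0 ≤ 2 - p), Real.rpow_nonneg hJ p]
  · linarith [Real.rpow_le_rpow_of_exponent_le h (by linarith : 2 - p ≤ p)]

theorem abs_lt_of_cutoff_mul_bump_ne_zero {s t k : ℝ} {m : ℕ} (hm : 0 < m) (hk : 0 < k)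
    (hk1 : k ≤ 1) (h : cutoff (s / m) * (bump ((s - t) / k) / k) ≠ 0) :
    |s| < 2 * m + 1 ∧ |t| < 2 * m + 1 := by
  have h1 : |s| < 2 * m := by
    by_contra h'
    rw [cutoff_div_eq_zero hm (not_lt.1 h'), zero_mul] at h
    exact h rfl
  have h2 : |s - t| < k := by
    by_contra h'
    rw [bump_div_eq_zero hk (not_lt.1 h'), zero_div, mul_zero] at h
    exact h rfl
  have h3 := abs_sub_abs_le_abs_sub t s
  rw [abs_sub_comm] at h3
  exact ⟨by linarith, by linarith⟩

/-- Young's inequality with parameter εk. In the second term k cancels the 1/k carried by the bump;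
in the first, 1/(εk) is compensated by the factor k of the energy estimate. -/
theorem cutoff_mul_bump_mul_norm_le {ε : ℝ} (hε : 0 < ε) {m : ℕ} (hm : 0 < m) {k : ℝ} (hk : 0 < k)
    (hk1 : k ≤ 1) (x : Space N) :
    cutoff (u x / m) * (bump ((u x - v x) / k) / k) * ‖Du x - Dv x‖
      ≤ 1 / (ε * k) * (cutoff (u x / m) * (bump ((u x - v x) / k) / k)
          * monotoneForm p (Du x) (Dv x)) + ε * jointNorm u Du v Dv m x ^ (2 - p) := by
  have hJ := Real.rpow_nonneg (jointNorm_nonneg (u := u) (Du := Du) (v := v) (Dv := Dv) m x)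
    (2 - p)
  by_cases h : cutoff (u x / m) * (bump ((u x - v x) / k) / k) = 0
  · rw [h, zero_mul, zero_mul, mul_zero, zero_add]
    positivity
  · obtain ⟨h1, h2⟩ := abs_lt_of_cutoff_mul_bump_ne_zero hm hk hk1 h
    have h3 := norm_sub_le_monotoneForm (p := p) (mul_pos hε hk) (Du x) (Dv x)
    rw [jointNorm_eq h1 h2] at hJ ⊢
    set c := cutoff (u x / m) * (bump ((u x - v x) / k) / k) with hc
    have hc0 : 0 ≤ c := mul_nonneg (cutoff_nonneg _) (div_nonneg (bump_nonneg _) hk.le)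
    have hc1 : c * k ≤ 1 := by
      rw [hc, mul_assoc, div_mul_cancel₀ _ hk.ne']
      exact mul_le_one₀ (cutoff_le_one _) (bump_nonneg _) (bump_le_one _)
    calc c * ‖Du x - Dv x‖ ≤ c * (monotoneForm p (Du x) (Dv x) / (ε * k)
          + ε * k * (‖Du x‖ + ‖Dv x‖) ^ (2 - p)) := by gcongr
      _ = 1 / (ε * k) * (c * monotoneForm p (Du x) (Dv x))
          + ε * ((c * k) * (‖Du x‖ + ‖Dv x‖) ^ (2 - p)) := by ring
      _ ≤ _ := by
          gcongr
          exact mul_le_of_le_one_left hJ hc1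

theorem integrable_cutoff_mul_bump_mul_norm [IsFiniteMeasure (volume.restrict Ω)] (hp1 : 1 < p)
    (hp2 : p ≤ 2) (hu : HasRegularTruncations Ω Γd p u Du)
    (hv : HasRegularTruncations Ω Γd p v Dv) {m : ℕ} (hm : 0 < m) {k : ℝ} (hk : 0 < k)
    (hk1 : k ≤ 1) :
    Integrable (fun x => cutoff (u x / m) * (bump ((u x - v x) / k) / k) * ‖Du x - Dv x‖)
      (volume.restrict Ω) := by
  refine (((integrable_monotoneForm hp1 hp2 hu hv hm hk hk1).const_mul (1 / (1 * k))).add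
    ((integrable_jointNorm_rpow_two_sub hp1 hp2 hu hv m).const_mul 1)).mono'
    (((aemeasurable_cutoff m hu.aemeasurable).mul ((aemeasurable_bump k hu.aemeasurable
      hv.aemeasurable).div_const k)).mul
      (hu.aemeasurable_grad.sub hv.aemeasurable_grad).norm).aestronglyMeasurable
    (.of_forall fun x => ?_)
  rw [Real.norm_of_nonneg (mul_nonneg (mul_nonneg (cutoff_nonneg _)
    (div_nonneg (bump_nonneg _) hk.le)) (norm_nonneg _))]
  exact cutoff_mul_bump_mul_norm_le one_pos hm hk hk1 x

/-- For fixed `m`, the part of the gradient of the comparison function that contains `Du - Dv`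
tends to zero as `k → 0`. -/
theorem eventually_integral_gradient_le {L γ : ℝ} (hΩ : IsOpen Ω) (hb : Bornology.IsBounded Ω)
    (hL : HasLipschitzBoundary Ω) (hN : 2 < N) (hp1 : 1 < p) (hp2 : p ≤ 2)
    (hdata : StructuralAssumptions Ω p α β a lam Φ d b f)
    (hlam : ∀ᵐ x ∂(volume.restrict Ω), ∀ r r' : ℝ, 0 ≤ (lam x r - lam x r') * (r - r'))
    (ha : ∀ᵐ x ∂(volume.restrict Ω), ∀ ξ ξ' : Space N,
      α * (‖ξ - ξ'‖ ^ 2 / (‖ξ‖ + ‖ξ'‖) ^ (2 - p)) ≤ inner ℝ (a x ξ - a x ξ') (ξ - ξ'))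
    (hγ : γ < p - 3 / 2)
    (hΦ : ∀ᵐ x ∂(volume.restrict Ω), ∀ r r' : ℝ,
      ‖Φ x r - Φ x r'‖ ≤ L * |r - r'| * |b x| * (|r| + |r'| + 1) ^ γ)
    (hu : HasRegularTruncations Ω Γd p u Du) (hv : HasRegularTruncations Ω Γd p v Dv)
    (hequ : SatisfiesEquation Ω Γd p a lam Φ f u Du)
    (heqv : SatisfiesEquation Ω Γd p a lam Φ f v Dv) {m : ℕ} (hm : 0 < m) {δ : ℝ} (hδ : 0 < δ) :
    ∀ᶠ j : ℕ in atTop, ∫ x in Ω, cutoff (u x / m)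
      * (bump ((u x - v x) / (1 / ((j : ℝ) + 1))) / (1 / ((j : ℝ) + 1))) * ‖Du x - Dv x‖ ≤ δ := by
  have hfin := isFiniteMeasure_restrict hb
  have hJi := integrable_jointNorm_rpow_two_sub hp1 hp2 hu hv m
  set K : ℝ := ∫ x in Ω, jointNorm u Du v Dv m x ^ (2 - p) with hK
  have hK0 : 0 ≤ K := integral_nonneg fun x => Real.rpow_nonneg (jointNorm_nonneg m x) _
  -- With this choice the term with `jointNorm` is at most δ/2 for every k; K + 1 avoids division by
  -- zero.
  set ε : ℝ := δ / (2 * (K + 1)) with hε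
  have hε0 : 0 < ε := by positivity
  have hεK : ε * K ≤ δ / 2 := by
    rw [hε, div_mul_eq_mul_div, div_le_div_iff₀ (by positivity) two_pos]
    nlinarith
  have hω := ((tendsto_convectionWeight hΩ hb hL hN hp1 hp2 hdata hγ hu hv).2).const_mul
    (L ^ 2 / α ^ 2 / ε)
  rw [mul_zero] at hω
  filter_upwards [hω.eventually (gt_mem_nhds (half_pos hδ))] with j hj
  set k : ℝ := 1 / ((j : ℝ) + 1) with hk
  have hk0 : 0 < k := by positivity
  have hk1 : k ≤ 1 := by
    rw [hk, div_le_one (by positivity)]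
    linarith [(Nat.cast_nonneg j : (0 : ℝ) ≤ j)]
  have hq := integrable_monotoneForm hp1 hp2 hu hv hm hk0 hk1
  have h1 := integral_mono (integrable_cutoff_mul_bump_mul_norm hp1 hp2 hu hv hm hk0 hk1)
    ((hq.const_mul (1 / (ε * k))).add (hJi.const_mul ε))
    fun x => cutoff_mul_bump_mul_norm_le (p := p) hε0 hm hk0 hk1 x
  rw [integral_add' (hq.const_mul _) (hJi.const_mul _), integral_const_mul,
    integral_const_mul] at h1
  have h2 := mul_le_mul_of_nonneg_left (energy_estimate hΩ hb hL hN hp1 hp2 hdata hlam ha hγ hΦ hu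
    hv hequ heqv hm hk0 hk1) (by positivity : 0 ≤ 1 / (ε * k))
  set W : ℝ := ∫ x in Ω, bump ((u x - v x) / k) * ((u x - v x) / k) ^ 2
    * convectionWeight p γ (b x) (u x) (v x) (Du x) (Dv x) with hW
  -- The powers of k cancel, and what remains tends to zero because the convection integral does.
  have e : 1 / (ε * k) * (L ^ 2 / α ^ 2 * k * W) = L ^ 2 / α ^ 2 / ε * W := by
    field_simp
  rw [e] at h2
  linarith

/-- |Du| ≤ 1 + |Du|^p reduces the claim to the decay of the p-energy and the finite measure of Ω. -/
theorem tendsto_integral_norm_div [IsFiniteMeasure (volume.restrict Ω)] (hp1 : 1 < p)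
    (hu : HasRegularTruncations Ω Γd p u Du) :
    (∀ n : ℕ, Integrable ({x | |u x| < 2 * (n : ℝ) + 1}.indicator fun x => ‖Du x‖)
      (volume.restrict Ω)) ∧
    Tendsto (fun n : ℕ => (1 / (n : ℝ)) *
      ∫ x in Ω, {x | |u x| < 2 * (n : ℝ) + 1}.indicator (fun x => ‖Du x‖) x) atTop (𝓝 0) := by
  have hp0 : 0 < p := by linarith
  have hi : ∀ n : ℕ, Integrable ({x | |u x| < 2 * (n : ℝ) + 1}.indicator fun x => ‖Du x‖ ^ p)
      (volume.restrict Ω) := fun n => hu.integrable_indicator hp0 (by positivity)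
  have hle : ∀ (n : ℕ) x, {x | |u x| < 2 * (n : ℝ) + 1}.indicator (fun x => ‖Du x‖) x
      ≤ 1 + {x | |u x| < 2 * (n : ℝ) + 1}.indicator (fun x => ‖Du x‖ ^ p) x := fun n x => by
    by_cases hx : x ∈ {x | |u x| < 2 * (n : ℝ) + 1}
    · rw [Set.indicator_of_mem hx, Set.indicator_of_mem hx]
      rcases le_total ‖Du x‖ 1 with h | h
      · linarith [Real.rpow_nonneg (norm_nonneg (Du x)) p]
      · have := Real.rpow_le_rpow_of_exponent_le h hp1.le
        rw [Real.rpow_one] at this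
        linarith
    · rw [Set.indicator_of_notMem hx, Set.indicator_of_notMem hx]
      norm_num
  have hI : ∀ n : ℕ, Integrable (fun x => 1 + {x | |u x| < 2 * (n : ℝ) + 1}.indicator
      (fun x => ‖Du x‖ ^ p) x) (volume.restrict Ω) := fun n => (integrable_const 1).add (hi n)
  have h0 : ∀ (n : ℕ) x, 0 ≤ {x | |u x| < 2 * (n : ℝ) + 1}.indicator (fun x => ‖Du x‖) x :=
    fun n x => Set.indicator_nonneg (fun _ _ => norm_nonneg _) _
  have hInt : ∀ n : ℕ, Integrable ({x | |u x| < 2 * (n : ℝ) + 1}.indicator fun x => ‖Du x‖)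
      (volume.restrict Ω) := fun n => by
    refine (hI n).mono' (hu.aemeasurable_grad.norm.indicator₀
      (hu.nullMeasurableSet_lt _)).aestronglyMeasurable (.of_forall fun x => ?_)
    rw [Real.norm_of_nonneg (h0 n x)]
    exact hle n x
  refine ⟨hInt, ?_⟩
  have hlim := ((tendsto_one_div_atTop_nhds_zero_nat (𝕜 := ℝ)).mul_const
    (∫ _ in Ω, (1 : ℝ))).add hu.tendsto_decay
  rw [zero_mul, add_zero] at hlim
  refine squeeze_zero (fun n => mul_nonneg (by positivity) (integral_nonneg (h0 n)))
    (fun n => ?_) hlim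
  rw [← mul_add, ← integral_add (integrable_const 1) (hi n)]
  exact mul_le_mul_of_nonneg_left (integral_mono (hInt n) (hI n) (hle n)) (by positivity)

/-- Two functions that satisfy the renormalized equation coincide. -/
theorem ae_eq_of_satisfiesEquation {L γ : ℝ} (hΩ : IsAdmissibleDomain Ω Γn Γd) (hN : 2 < N)
    (hp1 : 1 < p) (hp2 : p ≤ 2)
    (hdata : StructuralAssumptions Ω p α β a lam Φ d b f)
    (hlam : ∀ᵐ x ∂(volume.restrict Ω), ∀ r r' : ℝ, 0 ≤ (lam x r - lam x r') * (r - r'))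
    (ha : ∀ᵐ x ∂(volume.restrict Ω), ∀ ξ ξ' : Space N,
      α * (‖ξ - ξ'‖ ^ 2 / (‖ξ‖ + ‖ξ'‖) ^ (2 - p)) ≤ inner ℝ (a x ξ - a x ξ') (ξ - ξ'))
    (hγ : γ < p - 3 / 2)
    (hΦ : ∀ᵐ x ∂(volume.restrict Ω), ∀ r r' : ℝ,
      ‖Φ x r - Φ x r'‖ ≤ L * |r - r'| * |b x| * (|r| + |r'| + 1) ^ γ)
    (hu : HasRegularTruncations Ω Γd p u Du) (hv : HasRegularTruncations Ω Γd p v Dv)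
    (hequ : SatisfiesEquation Ω Γd p a lam Φ f u Du)
    (heqv : SatisfiesEquation Ω Γd p a lam Φ f v Dv) : u =ᵐ[volume.restrict Ω] v := by
  have hfin := isFiniteMeasure_restrict hΩ.isBounded
  have hq1 : 1 ≤ ENNReal.ofReal p := by simpa using ENNReal.ofReal_le_ofReal hp1.le
  obtain ⟨C, hC0, hC⟩ := exists_deriv_cutoff_bound
  -- k is chosen after m, small enough for the gradient estimate at level m + 1 and with j ≥ m so
  -- that k → 0; using m + 1 keeps the level positive.
  have hex : ∀ m : ℕ, ∃ j : ℕ, m ≤ j ∧ ∫ x in Ω, cutoff (u x / (m + 1 : ℕ))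
      * (bump ((u x - v x) / (1 / ((j : ℝ) + 1))) / (1 / ((j : ℝ) + 1))) * ‖Du x - Dv x‖
      ≤ 1 / ((m : ℝ) + 1) := fun m =>
    ((eventually_ge_atTop m).and (eventually_integral_gradient_le hΩ.isOpen hΩ.isBounded
      hΩ.lipschitz_boundary hN hp1 hp2 hdata hlam ha hγ hΦ hu hv hequ heqv m.succ_pos
      (by positivity))).exists
  choose j hj hjI using hex
  set k : ℕ → ℝ := fun m => 1 / ((j m : ℝ) + 1) with hk
  have hk0 : ∀ m, 0 < k m := fun m => by positivity
  have hkm : ∀ m, k m ≤ 1 / ((m : ℝ) + 1) := fun m => by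
    have : (m : ℝ) ≤ j m := by exact_mod_cast hj m
    simp only [hk]
    gcongr
  have hk1 : ∀ m, k m ≤ 1 := fun m => (hkm m).trans (by
    rw [div_le_one (by positivity)]
    linarith [(Nat.cast_nonneg m : (0 : ℝ) ≤ m)])
  choose D g hT hg hD using fun m : ℕ => exists_localizedSign_triple hp1 hu hv hC0 hC m.succ_pos
    (hk0 m) (hk1 m)
  have hwm : AEMeasurable (fun x => limitSign (u x - v x)) (volume.restrict Ω) :=
    measurable_limitSign.comp_aemeasurable (hu.aemeasurable.sub hv.aemeasurable)
  have hzero := ae_eq_zero_of_tendsto_sobolevTriple hΩ hq1 hT hg hwm ?_ ?_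
  · filter_upwards [hzero] with x hx
    exact sub_eq_zero.1 (limitSign_eq_zero_iff.1 hx)
  · refine tendsto_eLpNorm_zero_of_dominated one_ne_zero ENNReal.one_ne_top (g := fun _ => (2 : ℝ))
      (fun m => (hT m).memLp.1.sub hwm.aestronglyMeasurable) (memLp_const 2)
      (fun m => .of_forall fun x => ?_) (.of_forall fun x => ?_)
    · refine (norm_sub_le _ _).trans ?_
      have h1 := abs_localizedSign_le ((m + 1 : ℕ) : ℝ) (k m)
        (trunc (2 * (m + 1 : ℕ) + 1) (u x), trunc (2 * (m + 1 : ℕ) + 1) (v x))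
      have h2 := abs_limitSign_le (u x - v x)
      rw [Real.norm_eq_abs, Real.norm_eq_abs]
      linarith
    -- At each x the sequence is eventually equal to its limit: once m exceeds |u| and |v| the
    -- truncations and the cutoff are inactive, and the smooth sign has saturated or u = v.
    · refine tendsto_const_nhds.congr' ?_
      obtain ⟨n₀, hn₀⟩ := exists_nat_gt (max |u x| |v x|)
      rw [max_lt_iff] at hn₀
      have hev : ∀ᶠ m : ℕ in atTop, u x - v x = 0 ∨ k m ≤ |u x - v x| := by
        by_cases h : u x - v x = 0
        · exact .of_forall fun m => Or.inl h
        · filter_upwards [(tendsto_one_div_add_atTop_nhds_zero_nat (𝕜 := ℝ)).eventually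
            (gt_mem_nhds (abs_pos.2 h))] with m hm
          exact Or.inr ((hkm m).trans hm.le)
      filter_upwards [eventually_ge_atTop n₀, hev] with m hm hm'
      have hmn : (n₀ : ℝ) ≤ m := by exact_mod_cast hm
      have h1 : |u x| < ((m + 1 : ℕ) : ℝ) := by
        push_cast
        linarith
      have h2 : |v x| < ((m + 1 : ℕ) : ℝ) := by
        push_cast
        linarith
      rw [trunc_of_abs_le (by linarith [abs_nonneg (u x)]),
        trunc_of_abs_le (by linarith [abs_nonneg (v x)]), localizedSign,
        cutoff_eq_one ((abs_div_natCast_lt m.succ_pos).2 (by linarith)).le, one_mul,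
        smoothSign_div_eq_limitSign (hk0 m) hm', sub_self]
  -- The gradient has two parts: (C/m)|Du| on {|u| < 2m + 1}, small because ∫ |Du| there is o(m),
  -- and the part with Du - Dv, small by the choice of k.
  · obtain ⟨hi, ht⟩ := tendsto_integral_norm_div hp1 hu
    have hlim := ((((tendsto_add_atTop_iff_nat 1).2 ht).const_mul C).add
      (tendsto_one_div_add_atTop_nhds_zero_nat (𝕜 := ℝ)))
    rw [mul_zero, add_zero] at hlim
    have hlim' := ENNReal.tendsto_ofReal hlim
    rw [ENNReal.ofReal_zero] at hlim'
    refine tendsto_of_tendsto_of_tendsto_of_le_of_le tendsto_const_nhds hlim' (fun _ => zero_le)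
      fun m => ?_
    have i2 := integrable_cutoff_mul_bump_mul_norm hp1 hp2 hu hv m.succ_pos (hk0 m) (hk1 m)
    have i1 := (hi (m + 1)).const_mul (C / (m + 1 : ℕ))
    have hDi := (hT m).memLp_grad.integrable hq1
    rw [← ofReal_integral_norm_eq_lintegral_enorm hDi]
    refine ENNReal.ofReal_le_ofReal ((integral_mono hDi.norm (i1.add i2) (hD m)).trans ?_)
    rw [integral_add' i1 i2, integral_const_mul]
    refine add_le_add (le_of_eq ?_) (hjI m)
    ring

end Conclusion

end NoncoerciveElliptic

theorem theorem4p2 {N : ℕ} (Ω Γn Γd : Set (NoncoerciveElliptic.Space N))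
    (hΩ : NoncoerciveElliptic.IsAdmissibleDomain Ω Γn Γd)
    (p α β : ℝ) (hp1 : 1 < p) (hp2 : p ≤ 2) (hN : 2 < N)
    (a : NoncoerciveElliptic.Space N → NoncoerciveElliptic.Space N → NoncoerciveElliptic.Space N)
    (lam : NoncoerciveElliptic.Space N → ℝ → ℝ)
    (Φ : NoncoerciveElliptic.Space N → ℝ → NoncoerciveElliptic.Space N)
    (d b f : NoncoerciveElliptic.Space N → ℝ)
    (hdata : NoncoerciveElliptic.StructuralAssumptions Ω p α β a lam Φ d b f)
    (hlam : ∀ᵐ x ∂(volume.restrict Ω), ∀ r r' : ℝ, 0 ≤ (lam x r - lam x r') * (r - r'))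
    (ha : ∀ᵐ x ∂(volume.restrict Ω), ∀ ξ ξ' : NoncoerciveElliptic.Space N,
      α * (‖ξ - ξ'‖ ^ 2 / (‖ξ‖ + ‖ξ'‖) ^ (2 - p)) ≤ inner ℝ (a x ξ - a x ξ') (ξ - ξ'))
    (hΦ : ∃ L γ : ℝ, 0 < L ∧ γ < p - 3 / 2 ∧
      ∀ᵐ x ∂(volume.restrict Ω), ∀ r r' : ℝ,
        ‖Φ x r - Φ x r'‖ ≤ L * |r - r'| * |b x| * (|r| + |r'| + 1) ^ γ)
    (u v : NoncoerciveElliptic.Space N → ℝ)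
    (hu : NoncoerciveElliptic.IsRenormalizedSolution Ω Γd p a lam Φ f u)
    (hv : NoncoerciveElliptic.IsRenormalizedSolution Ω Γd p a lam Φ f v) :
    u =ᵐ[volume.restrict Ω] v := by
  obtain ⟨L, γ, -, hγ, hΦ⟩ := hΦ
  obtain ⟨Du, hDu, hequ⟩ :=
    hu.exists_satisfiesEquation hΩ.isOpen hΩ.isBounded hN hp1 hp2 hdata
  obtain ⟨Dv, hDv, heqv⟩ :=
    hv.exists_satisfiesEquation hΩ.isOpen hΩ.isBounded hN hp1 hp2 hdata
  exact NoncoerciveElliptic.ae_eq_of_satisfiesEquation hΩ hN hp1 hp2 hdata hlam ha hγ hΦ hDu hDv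
    hequ heqv
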